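/- Let $F=(F_n)_{n\in\mathbb Z}$ be an $\Omega$-spectrum, i.e. pointed spaces with pointed homotopy equivalences $F_n\simeq\Omega F_{n+1}$. For a pair $(X,Y)$ let $h^n(X,Y)=[(X,Y),(F_n,*)]$, an abelian group under concatenation of loops. For a topological group $\Gamma$, a continuous homomorphism $\phi:\Gamma\to\{\pm1\}$ and a $\Gamma$-space $X$ with $\Gamma$-invariant $Y\subset X$, put $$h^n_\Gamma(X,Y)=h^n(E\Gamma\times_\Gamma X,\;E\Gamma\times_\Gamma Y),\qquad h^{\phi+n}_\Gamma(X,Y)=h^{n+1}_\Gamma(X\times\tilde I,\;Y\times\tilde I\cup X\times\partial\tilde I),$$ where $E\Gamma$ is Milnor's universal free $\Gamma$-space and $\tilde I=[0,1]$ with $g\cdot x=\tfrac12+\phi(g)(x-\tfrac12)$; write $h^{\phi+n}_\Gamma(X)=h^{\phi+n}_\Gamma(X,\emptyset)$. Following the generalized cohomology hypothesis, the group of $d$-dimensional SPT phases with symmetry $(\Gamma,\phi)$ is $\mathcal{SPT}^d(\Gamma,\phi)=h^{\phi+d}_\Gamma(\mathrm{pt})$, for all $d\in\mathbb Z$; a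 homomorphism $\psi:\Gamma_1\to\Gamma_2$ with $\phi_2\circ\psi=\phi_1$ induces a symmetry-forgetting map $\psi^*:\mathcal{SPT}^d(\Gamma_2,\phi_2)\to\mathcal{SPT}^d(\Gamma_1,\phi_1)$. Let $\mathbb Z\rtimes\mathbb Z_2^R$ be the discrete group of isometries of $\mathbb R$ generated by the translation $x\mapsto x+1$ and the reflection $x\mapsto-x$. Let $G$ be any topological group and $\phi:G\to\{\pm1\}$ a continuous homomorphism, extended to $G\times(\mathbb Z\rtimes\mathbb Z_2^R)$ and to $G\times\mathbb Z_2^R$ by $\phi=+1$ on translations and $\phi=-1$ on the reflection; all these extensions are denoted $\phi$. **Theorem.** There is a long exact sequence of abelian groups, indexed by $d\in\mathbb Z$, $$\cdots\to\mathcal{SPT}^{d-1}(G,\phi)\xrightarrow{\alpha}\mathcal{SPT}^{d}(G\times(\mathbb Z\rtimes\mathbb Z_2^R),\phi)\xrightarrow{\beta_1\times\beta_2}\mathcal{SPT}^{d}(G\times\mathbb Z_2^R,\phi)\oplus\mathcal{SPT}^{d}(G\times\mathbb Z_2^R,\phi)\xrightarrow{\gamma_1\oplus\gamma_2}\mathcal{SPT}^{d}(G,\phi)\xrightarrow{\alpha}\cdots$$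 in which $\beta_1,\beta_2$ are the symmetry-forgetting maps for the inclusions $G\times\mathbb Z_2^R\to G\times(\mathbb Z\rtimes\mathbb Z_2^R)$ that are the identity on $G$ and send the generator of $\mathbb Z_2^R$ to the reflection $x\mapsto -x$, respectively $x\mapsto 1-x$, and $(\gamma_1\oplus\gamma_2)(b_1,b_2)=b_1|_G-b_2|_G$. It is obtained from a Mayer–Vietoris sequence as follows. Let $S^1\subset\mathbb C$ be the unit circle, on which $G\times\mathbb Z_2^R$ acts through complex conjugation, and let $U=\{\mathrm{Re}\,z\ge0\}$, $V=\{\mathrm{Re}\,z\le0\}$, so that $U\cap V=\{i,-i\}=\mathrm{pt}\sqcup\mathrm{pt}$. 1. The Mayer–Vietoris sequence $$\cdots\to h^{\phi+n-1}_{G\times\mathbb Z_2^R}(U\cap V)\xrightarrow{\delta}h^{\phi+n}_{G\times\mathbb Z_2^R}(S^1)\to h^{\phi+n}_{G\times\mathbb Z_2^R}(U)\oplus h^{\phi+n}_{G\times\mathbb Z_2^R}(V)\to h^{\phi+n}_{G\times\mathbb Z_2^R}(U\cap V)\to\cdots$$ (pair of restrictions, difference of restrictions, and the Mayer–Vietoris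 connecting homomorphism $\delta$) is exact. 2. The following maps are isomorphisms for every $n$: the pullbacks $h^{\phi+n}_{G\times\mathbb Z_2^R}(\mathrm{pt})\to h^{\phi+n}_{G\times\mathbb Z_2^R}(U)$ and $h^{\phi+n}_{G\times\mathbb Z_2^R}(\mathrm{pt})\to h^{\phi+n}_{G\times\mathbb Z_2^R}(V)$; the restriction $h^{\phi+n}_{G\times\mathbb Z_2^R}(\mathrm{pt}\sqcup\mathrm{pt})\to h^{\phi+n}_G(\mathrm{pt})$ to the subgroup $G$ and the point $i$; and the pullbacks $h^{\phi+n}_{G\times(\mathbb Z\rtimes\mathbb Z_2^R)}(\mathrm{pt})\to h^{\phi+n}_{G\times(\mathbb Z\rtimes\mathbb Z_2^R)}(\mathbb R)\leftarrow h^{\phi+n}_{G\times\mathbb Z_2^R}(S^1)$ along $\mathbb R\to\mathrm{pt}$ and along $\mathbb R\to S^1$, $x\mapsto e^{2\pi i x}$. The last two give $\mathcal{SPT}^n(G\times(\mathbb Z\rtimes\mathbb Z_2^R),\phi)\cong h^{\phi+n}_{G\times\mathbb Z_2^R}(S^1)$. 3. Under these isomorphisms the maps $\alpha$, $\beta_1\times\beta_2$,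 $\gamma_1\oplus\gamma_2$ of the long exact sequence are the maps of the Mayer–Vietoris sequence in 1. -/

import Mathlib

open scoped unitInterval

universe u v

noncomputable section

/-! ### Homotopy classes of maps of pairs -/

/-- Maps of pairs `(X, Y) → (Z, z)`: continuous maps `X → Z` sending all of `Y` to `z`. -/
def PairMap {X : Type*} {Z : Type*} [TopologicalSpace X] [TopologicalSpace Z]
    (Y : Set X) (z : Z) : Type _ :=
  {f : C(X, Z) // ∀ y ∈ Y, f y = z}

/-- Homotopy through maps of pairs `(X, Y) → (Z, z)`, that is, homotopy relative to `Y`. -/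
instance pairSetoid {X : Type*} {Z : Type*} [TopologicalSpace X] [TopologicalSpace Z]
    (Y : Set X) (z : Z) : Setoid (PairMap Y z) where
  r f g := f.1.HomotopicRel g.1 Y
  iseqv := ⟨fun f => .refl f.1, fun h => h.symm, fun h₁ h₂ => h₁.trans h₂⟩

/-- The set `[(X, Y), (Z, z)]` of homotopy classes of maps of pairs. -/
def PairClass {X : Type*} {Z : Type*} [TopologicalSpace X] [TopologicalSpace Z]
    (Y : Set X) (z : Z) : Type _ :=
  Quotient (pairSetoid Y z)

section PairClass

variable {X X' : Type*} [TopologicalSpace X] [TopologicalSpace X']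
  {Z Z' Z'' : Type*} [TopologicalSpace Z] [TopologicalSpace Z'] [TopologicalSpace Z'']
  {Y : Set X} {Y' : Set X'} {z : Z} {z' : Z'} {z'' : Z''}

theorem homotopicRel_comp_of_pointed {k k' : C(Z, Z')} (h : k.HomotopicRel k' {z})
    (f : PairMap Y z) : (k.comp f.1).HomotopicRel (k'.comp f.1) Y := by
  obtain ⟨H⟩ := h
  refine ⟨⟨⟨⟨fun p => H (p.1, f.1 p.2), by fun_prop⟩, fun x => ?_, fun x => ?_⟩, ?_⟩⟩
  · exact H.apply_zero _
  · exact H.apply_one _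
  · intro t x hx
    change H (t, f.1 x) = k (f.1 x)
    rw [f.2 x hx]
    exact H.eq_fst t rfl

namespace PairClass

/-- Composition with a pointed map `(Z, z) → (Z', z')`. -/
def post (k : C(Z, Z')) (hk : k z = z') : PairClass Y z → PairClass Y z' :=
  Quotient.map (fun f => ⟨k.comp f.1, fun y hy => by simp [f.2 y hy, hk]⟩)
    (fun _ _ h => h.comp_continuousMap k)

/-- Pullback along a map of pairs `(X', Y') → (X, Y)`. -/
def pre (f : C(X', X)) (hf : Set.MapsTo f Y' Y) : PairClass Y z → PairClass Y' z :=
  Quotient.map (fun g => ⟨g.1.comp f, fun y hy => g.2 _ (hf hy)⟩)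
    (by
      rintro g g' ⟨H⟩
      refine ⟨⟨⟨⟨fun p => H (p.1, f p.2), by fun_prop⟩, fun x => ?_, fun x => ?_⟩, ?_⟩⟩
      · exact H.apply_zero _
      · exact H.apply_one _
      · intro t x hx
        exact H.eq_fst t (hf hx))

/-- The class of a pair of maps. -/
def pair : PairClass Y z → PairClass Y z' → PairClass Y (z, z') :=
  Quotient.map₂ (fun f g => ⟨f.1.prodMk g.1, fun y hy => by simp [f.2 y hy, g.2 y hy]⟩)
    (by
      rintro f f' ⟨H⟩ g g' ⟨K⟩
      refine ⟨⟨⟨⟨fun p => (H p, K p), by fun_prop⟩, fun x => ?_, fun x => ?_⟩, ?_⟩⟩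
      · exact Prod.ext (H.apply_zero _) (K.apply_zero _)
      · exact Prod.ext (H.apply_one _) (K.apply_one _)
      · intro t x hx
        exact Prod.ext (H.eq_fst t hx) (K.eq_fst t hx))

/-- The class of the constant map. -/
def const (Y : Set X) (z : Z) : PairClass Y z := ⟦⟨.const X z, fun _ _ => rfl⟩⟧

theorem post_congr {k k' : C(Z, Z')} (hk : k z = z') (hk' : k' z = z')
    (h : k.HomotopicRel k' {z}) (a : PairClass Y z) : post k hk a = post k' hk' a := by
  induction a using Quotient.inductionOn with | h f =>
  exact Quotient.sound (homotopicRel_comp_of_pointed h f)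

theorem post_post (k : C(Z, Z')) (hk : k z = z') (l : C(Z', Z'')) (hl : l z' = z'')
    (a : PairClass Y z) :
    post l hl (post k hk a) = post (l.comp k) (by simp [hk, hl]) a := by
  induction a using Quotient.inductionOn with | h f => rfl

theorem post_id (a : PairClass Y z) : post (.id Z) rfl a = a := by
  induction a using Quotient.inductionOn with | h f => rfl

theorem post_pre (k : C(Z, Z')) (hk : k z = z') (f : C(X', X)) (hf : Set.MapsTo f Y' Y)
    (a : PairClass Y z) : post k hk (pre f hf a) = pre f hf (post k hk a) := by
  induction a using Quotient.inductionOn with | h g => rfl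

theorem pre_pair (f : C(X', X)) (hf : Set.MapsTo f Y' Y) (a : PairClass Y z)
    (b : PairClass Y z') : pre f hf (pair a b) = pair (pre f hf a) (pre f hf b) := by
  induction a using Quotient.inductionOn with | h a =>
  induction b using Quotient.inductionOn with | h b => rfl

end PairClass

end PairClass

/-! ### The group structure on homotopy classes of maps into a loop space -/

section Loops

variable {Z : Type*} [TopologicalSpace Z] {z : Z} {W : Type*} [TopologicalSpace W] {w : W}

/-- Concatenation of loops. -/
def loopMul (z : Z) : C(Path z z × Path z z, Path z z) :=
  ⟨fun p => p.1.trans p.2, by fun_prop⟩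

/-- Reversal of loops. -/
def loopInv (z : Z) : C(Path z z, Path z z) := ⟨Path.symm, Path.continuous_symm⟩

theorem loopMul_refl (z : Z) : loopMul z (Path.refl z, Path.refl z) = Path.refl z :=
  Path.refl_trans_refl

theorem loopInv_refl (z : Z) : loopInv z (Path.refl z) = Path.refl z := Path.refl_symm

/-- The map of loop spaces induced by a pointed map. -/
def loopMap (k : C(Z, W)) (hk : k z = w) : C(Path z z, Path w w) :=
  ⟨fun p => (p.map k.continuous).cast hk.symm hk.symm,
    Path.continuous_uncurry_iff.mp (by
      change Continuous fun p : Path z z × I => k (p.1 p.2)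
      fun_prop)⟩

theorem loopMap_refl (k : C(Z, W)) (hk : k z = w) :
    loopMap k hk (Path.refl z) = Path.refl w := by
  ext t; exact hk

theorem loopMap_trans (k : C(Z, W)) (hk : k z = w) (p q : Path z z) :
    loopMap k hk (p.trans q) = (loopMap k hk p).trans (loopMap k hk q) := by
  subst hk
  exact Path.map_trans p q k.continuous

theorem loopMap_homotopic {k k' : C(Z, W)} (hk : k z = w) (hk' : k' z = w)
    (h : k.HomotopicRel k' {z}) :
    (loopMap k hk).HomotopicRel (loopMap k' hk') {Path.refl z} := by
  obtain ⟨H⟩ := h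
  have hH : ∀ s, H (s, z) = w := fun s => (H.eq_fst s rfl).trans hk
  let Φ : I × Path z z → Path w w := fun q =>
    { toFun := fun t => H (q.1, q.2 t)
      continuous_toFun := by fun_prop
      source' := by simp [hH]
      target' := by simp [hH] }
  have hΦ : Continuous Φ := Path.continuous_uncurry_iff.mp (by
    change Continuous fun p : (I × Path z z) × I => H (p.1.1, p.1.2 p.2)
    fun_prop)
  refine ⟨⟨⟨⟨Φ, hΦ⟩, fun p => ?_, fun p => ?_⟩, ?_⟩⟩
  · ext t; exact H.apply_zero _
  · ext t; exact H.apply_one _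
  · rintro s _ rfl
    ext t
    exact (hH s).trans hk.symm

theorem loopMul_assoc_homotopic (z : Z) :
    ContinuousMap.HomotopicRel
      (⟨fun p => (p.1.1.trans p.1.2).trans p.2, by fun_prop⟩ :
        C((Path z z × Path z z) × Path z z, Path z z))
      ⟨fun p => p.1.1.trans (p.1.2.trans p.2), by fun_prop⟩
      {((Path.refl z, Path.refl z), Path.refl z)} := by
  let ψ : I → I := fun t => ⟨Path.Homotopy.transAssocReparamAux t,
    Path.Homotopy.transAssocReparamAux_mem_I t⟩
  have hψ : Continuous ψ := by fun_prop
  have ψ0 : ψ 0 = 0 := Subtype.ext Path.Homotopy.transAssocReparamAux_zero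
  have ψ1 : ψ 1 = 1 := Subtype.ext Path.Homotopy.transAssocReparamAux_one
  let θ : I × I → I := fun q => ⟨σ q.1 * ψ q.2 + q.1 * q.2,
    (convex_Icc (0 : ℝ) 1) (ψ q.2).2 q.2.2 (σ q.1).2.1 q.1.2.1 (by simp)⟩
  have hθ : Continuous θ := by
    refine Continuous.subtype_mk ?_ _
    fun_prop
  have θ0 : ∀ s, θ (s, 0) = 0 := fun s => by ext; simp [θ, ψ0]
  have θ1 : ∀ s, θ (s, 1) = 1 := fun s => by ext; simp [θ, ψ1]
  let P := (Path z z × Path z z) × Path z z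
  let Φ : I × P → Path z z := fun q =>
    (q.2.1.1.trans (q.2.1.2.trans q.2.2)).reparam (fun t => θ (q.1, t)) (by fun_prop)
      (θ0 _) (θ1 _)
  have hc : Continuous fun q : P => q.1.1.trans (q.1.2.trans q.2) := by fun_prop
  have hΦ : Continuous Φ := Path.continuous_uncurry_iff.mp (by
    change Continuous fun p : (I × P) × I =>
      (p.1.2.1.1.trans (p.1.2.1.2.trans p.1.2.2)) (θ (p.1.1, p.2))
    exact (hc.comp (continuous_snd.comp continuous_fst)).eval (by fun_prop))
  refine ⟨⟨⟨⟨Φ, hΦ⟩, fun p => ?_, fun p => ?_⟩, ?_⟩⟩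
  · change Φ (0, p) = (p.1.1.trans p.1.2).trans p.2
    rw [Path.Homotopy.trans_assoc_reparam]
    ext t
    change (p.1.1.trans (p.1.2.trans p.2)) (θ (0, t)) = (p.1.1.trans (p.1.2.trans p.2)) (ψ t)
    congr 1
    ext
    simp [θ]
  · ext t
    change (p.1.1.trans (p.1.2.trans p.2)) (θ (1, t)) = (p.1.1.trans (p.1.2.trans p.2)) t
    congr 1
    ext
    simp [θ]
  · rintro s _ rfl
    ext t
    simp [Φ]

theorem loopMul_inv_homotopic (z : Z) :
    ContinuousMap.HomotopicRel
      (⟨fun p => p.symm.trans p, Path.continuous_symm.path_trans continuous_id⟩ : C(Path z z, Path z z))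
      (.const _ (Path.refl z)) {Path.refl z} := by
  let θ : I × I → I := fun q => ⟨Path.Homotopy.reflTransSymmAux q,
    Path.Homotopy.reflTransSymmAux_mem_I q⟩
  have hθ : Continuous θ := by fun_prop
  have θ0 : ∀ s, θ (s, 0) = 0 := fun s => by
    ext; simp [θ, Path.Homotopy.reflTransSymmAux]
  have θ1 : ∀ s, θ (s, 1) = 0 := fun s => by
    ext; norm_num [θ, Path.Homotopy.reflTransSymmAux]
  let Φ : I × Path z z → Path z z := fun q =>
    { toFun := fun t => q.2.symm (θ (q.1, t))
      continuous_toFun := by fun_prop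
      source' := by rw [θ0]; simp
      target' := by rw [θ1]; simp }
  have hΦ : Continuous Φ := Path.continuous_uncurry_iff.mp (by
    change Continuous fun p : (I × Path z z) × I => p.1.2 (σ (θ (p.1.1, p.2)))
    fun_prop)
  refine ContinuousMap.HomotopicRel.symm ⟨⟨⟨⟨Φ, hΦ⟩, fun p => ?_, fun p => ?_⟩, ?_⟩⟩
  · ext t
    have : θ (0, t) = 0 := by ext; simp [θ, Path.Homotopy.reflTransSymmAux]
    change p.symm (θ (0, t)) = z
    rw [this]; simp
  · ext t
    have h : Path.Homotopy.reflTransSymm p.symm (1, t) = (p.symm.trans p.symm.symm) t :=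
      (Path.Homotopy.reflTransSymm p.symm).apply_one t
    exact h.trans (congrArg (fun q => (p.symm.trans q) t) p.symm_symm)
  · rintro s _ rfl
    rfl

variable {X X' : Type*} [TopologicalSpace X] [TopologicalSpace X'] {Y : Set X} {Y' : Set X'}

/-- Homotopy classes of maps from `(X, Y)` to the loop space of `(Z, z)`, with basepoint the
constant loop. -/
abbrev LoopClass (Y : Set X) (z : Z) := PairClass Y (Path.refl z)

/-- Homotopy classes of maps of pairs into a loop space form a group under pointwise
concatenation of loops (written additively). -/
instance loopAddGroup (Y : Set X) (z : Z) : AddGroup (LoopClass Y z) :=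
  let _ : Add (LoopClass Y z) :=
    ⟨fun a b => (PairClass.pair a b).post (loopMul z) (loopMul_refl z)⟩
  let _ : Zero (LoopClass Y z) := ⟨PairClass.const Y _⟩
  let _ : Neg (LoopClass Y z) := ⟨fun a => a.post (loopInv z) (loopInv_refl z)⟩
  AddGroup.ofLeftAxioms
    (by
      intro a b c
      induction a using Quotient.inductionOn with | h a =>
      induction b using Quotient.inductionOn with | h b =>
      induction c using Quotient.inductionOn with | h c =>
      exact Quotient.sound (homotopicRel_comp_of_pointed (loopMul_assoc_homotopic z)
        ⟨(a.1.prodMk b.1).prodMk c.1, fun y hy => by simp [a.2 y hy, b.2 y hy, c.2 y hy]⟩))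
    (by
      intro a
      induction a using Quotient.inductionOn with | h a =>
      exact Quotient.sound
        (homotopicRel_comp_of_pointed ⟨HSpace.eHmul (X := Path z z)⟩ a))
    (by
      intro a
      induction a using Quotient.inductionOn with | h a =>
      exact Quotient.sound (homotopicRel_comp_of_pointed (loopMul_inv_homotopic z) a))

theorem LoopClass.add_def (a b : LoopClass Y z) :
    a + b = (PairClass.pair a b).post (loopMul z) (loopMul_refl z) := rfl

theorem LoopClass.pre_add (f : C(X', X)) (hf : Set.MapsTo f Y' Y) (a b : LoopClass Y z) :
    PairClass.pre f hf (a + b) = PairClass.pre f hf a + PairClass.pre f hf b := by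
  rw [LoopClass.add_def, LoopClass.add_def, ← PairClass.post_pre, PairClass.pre_pair]

theorem LoopClass.post_loopMap_add (k : C(Z, W)) (hk : k z = w) (a b : LoopClass Y z) :
    PairClass.post (loopMap k hk) (loopMap_refl k hk) (a + b) =
      PairClass.post (loopMap k hk) (loopMap_refl k hk) a +
        PairClass.post (loopMap k hk) (loopMap_refl k hk) b := by
  induction a using Quotient.inductionOn with | h a =>
  induction b using Quotient.inductionOn with | h b =>
  refine congrArg (Quotient.mk _) (Subtype.ext (ContinuousMap.ext fun x => ?_))
  exact loopMap_trans k hk _ _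

/-- Concatenation in a double loop space with respect to the inner loop coordinate. -/
def innerMul (z : Z) :
    C(Path (Path.refl z) (Path.refl z) × Path (Path.refl z) (Path.refl z),
      Path (Path.refl z) (Path.refl z)) :=
  (loopMap (loopMul z) (loopMul_refl z)).comp
    ⟨fun p => p.1.prod p.2, Path.continuous_uncurry_iff.mp (by
      change Continuous fun q : (Path (Path.refl z) (Path.refl z) ×
        Path (Path.refl z) (Path.refl z)) × I => (q.1.1 q.2, q.1.2 q.2)
      fun_prop)⟩

theorem innerMul_refl (z : Z) :
    innerMul z (Path.refl (Path.refl z), Path.refl (Path.refl z)) = Path.refl (Path.refl z) :=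
  Path.ext (funext fun _ => loopMul_refl z)

theorem innerMul_left_homotopic (z : Z) :
    ((innerMul z).comp ((ContinuousMap.const _ (Path.refl (Path.refl z))).prodMk
      (ContinuousMap.id _))).HomotopicRel (ContinuousMap.id _) {Path.refl (Path.refl z)} :=
  loopMap_homotopic
    (k := (loopMul z).comp ((ContinuousMap.const _ (Path.refl z)).prodMk (ContinuousMap.id _)))
    (k' := ContinuousMap.id _) (loopMul_refl z) rfl ⟨HSpace.eHmul (X := Path z z)⟩

theorem innerMul_right_homotopic (z : Z) :
    ((innerMul z).comp ((ContinuousMap.id _).prodMk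
      (ContinuousMap.const _ (Path.refl (Path.refl z))))).HomotopicRel (ContinuousMap.id _)
        {Path.refl (Path.refl z)} :=
  loopMap_homotopic
    (k := (loopMul z).comp ((ContinuousMap.id _).prodMk (ContinuousMap.const _ (Path.refl z))))
    (k' := ContinuousMap.id _) (loopMul_refl z) rfl ⟨HSpace.hmulE (X := Path z z)⟩

theorem innerMul_interchange (p q r s : Path (Path.refl z) (Path.refl z)) :
    innerMul z (p.trans q, r.trans s) = (innerMul z (p, r)).trans (innerMul z (q, s)) := by
  refine Path.ext (funext fun t => ?_)
  change (p.trans q t).trans (r.trans s t) = _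
  simp only [Path.trans_apply]
  split_ifs <;> rfl

theorem LoopClass.add_comm_of_double (a b : LoopClass Y (Path.refl z)) : a + b = b + a := by
  let m : LoopClass Y (Path.refl z) → LoopClass Y (Path.refl z) → LoopClass Y (Path.refl z) :=
    fun a b => (PairClass.pair a b).post (innerMul z) (innerMul_refl z)
  have hm : EckmannHilton.IsUnital m (0 : LoopClass Y (Path.refl z)) :=
    { left_id := by
        intro a
        induction a using Quotient.inductionOn with | h a =>
        exact Quotient.sound (homotopicRel_comp_of_pointed (innerMul_left_homotopic z) a)
      right_id := by
        intro a
        induction a using Quotient.inductionOn with | h a =>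
        exact Quotient.sound (homotopicRel_comp_of_pointed (innerMul_right_homotopic z) a) }
  have hadd : EckmannHilton.IsUnital (fun a b : LoopClass Y (Path.refl z) => a + b) 0 :=
    EckmannHilton.AddZeroClass.IsUnital
  refine (EckmannHilton.mul_comm hm hadd ?_).comm a b
  intro a b c d
  induction a using Quotient.inductionOn with | h a =>
  induction b using Quotient.inductionOn with | h b =>
  induction c using Quotient.inductionOn with | h c =>
  induction d using Quotient.inductionOn with | h d =>
  exact congrArg (Quotient.mk _) (Subtype.ext (ContinuousMap.ext fun x =>
    innerMul_interchange (a.1 x) (b.1 x) (c.1 x) (d.1 x)))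

end Loops

/-! ### Ω-spectra and generalized cohomology -/

/-- A pointed homotopy equivalence `(Z, z) ≃ (W, w)`. -/
structure PointedHomotopyEquiv {Z : Type*} {W : Type*} [TopologicalSpace Z] [TopologicalSpace W]
    (z : Z) (w : W) where
  toFun : C(Z, W)
  invFun : C(W, Z)
  map_pt : toFun z = w
  inv_pt : invFun w = z
  left_inv : (invFun.comp toFun).HomotopicRel (.id Z) {z}
  right_inv : (toFun.comp invFun).HomotopicRel (.id W) {w}

/-- An Ω-spectrum: pointed spaces `F n`, `n ∈ ℤ`, with pointed homotopy equivalences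
`F n ≃ Ω F (n + 1)`; loop spaces are spaces of loops with the compact-open topology. -/
structure OmegaSpectrum where
  space : ℤ → Type v
  [top : ∀ n, TopologicalSpace (space n)]
  pt : ∀ n, space n
  equiv : ∀ n, PointedHomotopyEquiv (pt n) (Path.refl (pt (n + 1)))

attribute [instance] OmegaSpectrum.top

namespace OmegaSpectrum

variable (F : OmegaSpectrum.{v}) {X X' : Type*} [TopologicalSpace X] [TopologicalSpace X']

/-- The generalized cohomology `hⁿ(X, Y) = [(X, Y), (F n, *)]` of a pair. -/
def coh (n : ℤ) (X : Type*) [TopologicalSpace X] (Y : Set X) : Type _ := PairClass Y (F.pt n)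

/-- The bijection `[(X, Y), (F n, *)] ≃ [(X, Y), (Ω F (n + 1), const)]` given by the structure
map of the spectrum. -/
def toLoop (n : ℤ) (Y : Set X) : F.coh n X Y ≃ LoopClass Y (F.pt (n + 1)) where
  toFun := PairClass.post (F.equiv n).toFun (F.equiv n).map_pt
  invFun := PairClass.post (F.equiv n).invFun (F.equiv n).inv_pt
  left_inv a := (PairClass.post_post _ _ _ _ a).trans
    ((PairClass.post_congr _ rfl (F.equiv n).left_inv a).trans (PairClass.post_id a))
  right_inv a := (PairClass.post_post _ _ _ _ a).trans
    ((PairClass.post_congr _ rfl (F.equiv n).right_inv a).trans (PairClass.post_id a))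

theorem loop_add_comm (n : ℤ) (Y : Set X) (a b : LoopClass Y (F.pt n)) : a + b = b + a := by
  have inj : Function.Injective
      (PairClass.post (Y := Y) (loopMap (F.equiv n).toFun (F.equiv n).map_pt)
        (loopMap_refl _ _)) := by
    apply Function.LeftInverse.injective
      (g := PairClass.post (loopMap (F.equiv n).invFun (F.equiv n).inv_pt) (loopMap_refl _ _))
    intro a
    rw [PairClass.post_post]
    have h := loopMap_homotopic (by simp [(F.equiv n).map_pt, (F.equiv n).inv_pt]) rfl
      (F.equiv n).left_inv
    exact (PairClass.post_congr _ rfl h a).trans (PairClass.post_id a)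
  apply inj
  rw [LoopClass.post_loopMap_add, LoopClass.post_loopMap_add, LoopClass.add_comm_of_double]

/-- The abelian group structure of `hⁿ(X, Y)`, given by concatenation of loops under the
identification of `F n` with the loop space of `F (n + 1)`. -/
instance (n : ℤ) (Y : Set X) : AddCommGroup (F.coh n X Y) where
  __ := (F.toLoop n Y).addGroup
  add_comm a b := (F.toLoop n Y).injective (by
    rw [Equiv.add_def, Equiv.add_def, Equiv.apply_symm_apply, Equiv.apply_symm_apply,
      loop_add_comm])

theorem toLoop_add (n : ℤ) (Y : Set X) (a b : F.coh n X Y) :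
    F.toLoop n Y (a + b) = F.toLoop n Y a + F.toLoop n Y b :=
  (F.toLoop n Y).apply_symm_apply _

/-- The homomorphism `hⁿ(X, Y) → hⁿ(X', Y')` induced by a map of pairs `(X', Y') → (X, Y)`. -/
def pullback (n : ℤ) {Y : Set X} {Y' : Set X'} (f : C(X', X)) (hf : Set.MapsTo f Y' Y) :
    F.coh n X Y →+ F.coh n X' Y' :=
  AddMonoidHom.mk' (PairClass.pre f hf) (fun a b => (F.toLoop n Y').injective (by
    have h : ∀ c : F.coh n X Y,
        F.toLoop n Y' (PairClass.pre f hf c) = PairClass.pre f hf (F.toLoop n Y c) :=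
      fun c => PairClass.post_pre (F.equiv n).toFun (F.equiv n).map_pt f hf c
    refine (h (a + b)).trans ((congrArg (PairClass.pre f hf) (F.toLoop_add n Y a b)).trans ?_)
    refine (LoopClass.pre_add f hf _ _).trans (Eq.trans ?_ (F.toLoop_add n Y' _ _).symm)
    exact (congrArg₂ (· + ·) (h a) (h b)).symm))

/-- `δ : hⁿ(A, A₀) → hⁿ⁺¹(X, X₀)` is the Mayer-Vietoris connecting homomorphism of
`X = U ∪ V`, `A = U ∩ V`, where `iU`, `iV`, `jU`, `jV` are the inclusions of `U`, `V` into `X`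
and of `A` into `U`, `V`. It is characterized as follows. Let `g : (X, X₀) → (F (n + 1), *)` be a
map with null-homotopies `HU` of `g|U` and `HV` of `g|V`, both starting at the constant map `*`.
Over `A`, running `HU` forwards and then `HV` backwards gives a map `w : (A, A₀) → Ω F (n + 1)`.
Then `δ` sends the class in `hⁿ(A, A₀)` corresponding to `w` to the class of `g`. -/
def IsMayerVietorisConnecting (n : ℤ) {X U V A : Type*}
    [TopologicalSpace X] [TopologicalSpace U] [TopologicalSpace V] [TopologicalSpace A]
    (X₀ : Set X) (U₀ : Set U) (V₀ : Set V) (A₀ : Set A)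
    (iU : C(U, X)) (iV : C(V, X)) (jU : C(A, U)) (jV : C(A, V))
    (δ : F.coh n A A₀ →+ F.coh (n + 1) X X₀) : Prop :=
  ∀ (g : PairMap X₀ (F.pt (n + 1))) (HU : C(I × U, F.space (n + 1)))
    (HV : C(I × V, F.space (n + 1))),
    (∀ u, HU (0, u) = F.pt (n + 1)) → (∀ u, HU (1, u) = g.1 (iU u)) →
    (∀ t, ∀ u ∈ U₀, HU (t, u) = F.pt (n + 1)) →
    (∀ v, HV (0, v) = F.pt (n + 1)) → (∀ v, HV (1, v) = g.1 (iV v)) →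
    (∀ t, ∀ v ∈ V₀, HV (t, v) = F.pt (n + 1)) →
    ∀ w : PairMap A₀ (Path.refl (F.pt (n + 1))),
      (∀ (a : A) (t : I), w.1 a t =
        if (t : ℝ) ≤ 1 / 2 then HU (Set.projIcc 0 1 zero_le_one (2 * (t : ℝ)), jU a)
        else HV (Set.projIcc 0 1 zero_le_one (2 - 2 * (t : ℝ)), jV a)) →
      δ ((F.toLoop n A₀).symm (Quotient.mk _ w)) = (Quotient.mk _ g : PairClass X₀ (F.pt (n + 1)))

end OmegaSpectrum

/-! ### The universal space `EΓ` -/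

/-- Milnor's model (infinite join) of the universal contractible free `Γ`-space `EΓ`, for a
topological group `Γ`. A point is a formal convex combination `∑ tᵢ gᵢ`, `i ∈ ℕ`, with finitely
many nonzero weights `tᵢ ≥ 0` of total `1` and with a label `gᵢ ∈ Γ` wherever `tᵢ ≠ 0`. -/
@[ext]
structure MilnorE (Γ : Type*) where
  weight : ℕ →₀ ℝ
  nonneg : ∀ i, 0 ≤ weight i
  sum_eq_one : (weight.sum fun _ t => t) = 1
  label : ℕ → Option Γ
  label_eq_none : ∀ i, label i = none ↔ weight i = 0

namespace MilnorE

variable {Γ Γ₁ Γ₂ : Type*}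

/-- The coarsest topology for which all weights `tᵢ : EΓ → ℝ` and all (partially defined) labels
`gᵢ : {tᵢ ≠ 0} → Γ`, with open domain of definition, are continuous. -/
instance [TopologicalSpace Γ] : TopologicalSpace (MilnorE Γ) :=
  (⨅ i : ℕ, TopologicalSpace.induced (fun x : MilnorE Γ => x.weight i) inferInstance) ⊓
    TopologicalSpace.generateFrom
      {S | ∃ (i : ℕ) (O : Set Γ), IsOpen O ∧ S = {x | ∃ g ∈ O, x.label i = some g}}

/-- Relabelling along a map `Γ₁ → Γ₂`. -/
def relabel (f : Γ₁ → Γ₂) (x : MilnorE Γ₁) : MilnorE Γ₂ where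
  weight := x.weight
  nonneg := x.nonneg
  sum_eq_one := x.sum_eq_one
  label i := (x.label i).map f
  label_eq_none i := by simp [x.label_eq_none]

theorem continuous_relabel [TopologicalSpace Γ₁] [TopologicalSpace Γ₂] {f : Γ₁ → Γ₂}
    (hf : Continuous f) : Continuous (relabel f) := by
  refine continuous_inf_rng.2 ⟨continuous_iInf_rng.2 fun i => continuous_induced_rng.2 ?_,
    continuous_generateFrom_iff.2 ?_⟩
  · change Continuous fun x : MilnorE Γ₁ => x.weight i
    exact continuous_iff_le_induced.2 (inf_le_left.trans (iInf_le _ i))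
  · rintro _ ⟨i, O, hO, rfl⟩
    refine (inf_le_right : (_ ⊓ _ : TopologicalSpace (MilnorE Γ₁)) ≤ _) _
      (TopologicalSpace.isOpen_generateFrom_of_mem ⟨i, f ⁻¹' O, hO.preimage hf, ?_⟩)
    ext x
    cases h : x.label i <;> simp [relabel, h]

/-- The free action of `Γ` on `EΓ` by left multiplication of the labels. -/
instance [Group Γ] : MulAction Γ (MilnorE Γ) where
  smul g x := relabel (g * ·) x
  one_smul x := by
    ext1
    · rfl
    · funext i
      change (x.label i).map (1 * ·) = _
      simp
  mul_smul g h x := by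
    ext1
    · rfl
    · funext i
      change (x.label i).map (g * h * ·) = ((x.label i).map (h * ·)).map (g * ·)
      simp [Function.comp_def, mul_assoc]

theorem relabel_smul [Group Γ₁] [Group Γ₂] (f : Γ₁ →* Γ₂) (g : Γ₁) (x : MilnorE Γ₁) :
    relabel f (g • x) = f g • relabel f x := by
  ext1
  · rfl
  · funext i
    change ((x.label i).map (g * ·)).map f = ((x.label i).map f).map (f g * ·)
    simp [Function.comp_def]

end MilnorE

/-! ### Twisted equivariant generalized cohomology -/

section Equivariant

variable {Γ Γ₁ Γ₂ : Type*} [Group Γ] [TopologicalSpace Γ] [Group Γ₁] [TopologicalSpace Γ₁]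
  [Group Γ₂] [TopologicalSpace Γ₂]
  {X X₁ X₂ : Type*} [TopologicalSpace X] [TopologicalSpace X₁] [TopologicalSpace X₂]

/-- The Borel construction `EΓ ×_Γ X = (EΓ × X) / Γ`. -/
abbrev BorelConstruction (Γ : Type*) [Group Γ] (X : Type*) [MulAction Γ X] : Type _ :=
  MulAction.orbitRel.Quotient Γ (MilnorE Γ × X)

/-- The subspace `EΓ ×_Γ Y` of `EΓ ×_Γ X`. -/
def borelSubset (Γ : Type*) [Group Γ] {X : Type*} [MulAction Γ X] (Y : Set X) :
    Set (BorelConstruction Γ X) :=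
  Quotient.mk _ '' {p : MilnorE Γ × X | p.2 ∈ Y}

/-- The map of Borel constructions induced by a homomorphism `ψ : Γ₁ → Γ₂` and a `ψ`-equivariant
map `f : X₁ → X₂`. -/
def borelMap [MulAction Γ₁ X₁] [MulAction Γ₂ X₂] (ψ : Γ₁ →ₜ* Γ₂) (f : C(X₁, X₂))
    (hf : ∀ (g : Γ₁) (x : X₁), f (g • x) = ψ g • f x) : C(BorelConstruction Γ₁ X₁, BorelConstruction Γ₂ X₂) where
  toFun := Quotient.map (fun p => (MilnorE.relabel ψ p.1, f p.2)) (by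
    rintro _ p ⟨g, rfl⟩
    exact ⟨ψ g, Prod.ext (MilnorE.relabel_smul ψ.toMonoidHom g p.1).symm (hf g p.2).symm⟩)
  continuous_toFun := by
    refine continuous_quot_lift _ (continuous_quot_mk.comp ?_)
    exact ((MilnorE.continuous_relabel ψ.continuous_toFun).comp continuous_fst).prodMk
      (f.continuous.comp continuous_snd)

/-- The unit interval `Ĩ = [0, 1]` on which `g ∈ Γ` acts by `x ↦ 1/2 + φ(g) (x - 1/2)`. -/
def TwistedInterval (_φ : Γ →ₜ* ℤˣ) : Type := I

instance (φ : Γ →ₜ* ℤˣ) : TopologicalSpace (TwistedInterval φ) := inferInstanceAs (TopologicalSpace I)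

instance (φ : Γ →ₜ* ℤˣ) : MulAction Γ (TwistedInterval φ) where
  smul g x := (⟨1 / 2 + ((φ g : ℤ) : ℝ) * (x.1 - 1 / 2), by
    obtain ⟨x, h0, h1⟩ := x
    rcases Int.units_eq_one_or (φ g) with h | h <;> simp [h] <;> constructor <;> linarith⟩ : I)
  one_smul x := Subtype.ext (by
    change 1 / 2 + ((φ 1 : ℤ) : ℝ) * (x.1 - 1 / 2) = x.1
    simp)
  mul_smul g h x := Subtype.ext (by
    change 1 / 2 + ((φ (g * h) : ℤ) : ℝ) * (x.1 - 1 / 2) =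
      1 / 2 + ((φ g : ℤ) : ℝ) * ((1 / 2 + ((φ h : ℤ) : ℝ) * (x.1 - 1 / 2)) - 1 / 2)
    simp [mul_assoc])

/-- The subset `Y × Ĩ ∪ X × ∂Ĩ` of `X × Ĩ`. -/
def twistedBoundary (φ : Γ →ₜ* ℤˣ) (Y : Set X) : Set (X × TwistedInterval φ) :=
  {p | p.1 ∈ Y ∨ p.2 = (0 : I) ∨ p.2 = (1 : I)}

namespace OmegaSpectrum

variable (F : OmegaSpectrum.{v})

/-- Borel equivariant generalized cohomology `hⁿ_Γ(X, Y) = hⁿ(EΓ ×_Γ X, EΓ ×_Γ Y)`. -/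
abbrev equivariantCoh (n : ℤ) (Γ : Type*) [Group Γ] [TopologicalSpace Γ] (X : Type*)
    [TopologicalSpace X] [MulAction Γ X] (Y : Set X) : Type _ :=
  F.coh n (BorelConstruction Γ X) (borelSubset Γ Y)

/-- Twisted equivariant generalized cohomology
`h^{φ+n}_Γ(X, Y) = h^{n+1}_Γ(X × Ĩ, Y × Ĩ ∪ X × ∂Ĩ)`. -/
abbrev twistedCoh (n : ℤ) (φ : Γ →ₜ* ℤˣ) (X : Type*) [TopologicalSpace X] [MulAction Γ X]
    (Y : Set X) : Type _ :=
  F.equivariantCoh (n + 1) Γ (X × TwistedInterval φ) (twistedBoundary φ Y)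

end OmegaSpectrum

/-- The map `EΓ₁ ×_{Γ₁} (X₁ × Ĩ) → EΓ₂ ×_{Γ₂} (X₂ × Ĩ)` induced by a homomorphism `ψ : Γ₁ → Γ₂`
with `φ₂ ∘ ψ = φ₁` and a `ψ`-equivariant map `f : X₁ → X₂`. -/
def twistedMap [MulAction Γ₁ X₁] [MulAction Γ₂ X₂] {φ₁ : Γ₁ →ₜ* ℤˣ} {φ₂ : Γ₂ →ₜ* ℤˣ}
    (ψ : Γ₁ →ₜ* Γ₂) (hψ : ∀ g, φ₂ (ψ g) = φ₁ g) (f : C(X₁, X₂))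
    (hf : ∀ (g : Γ₁) (x : X₁), f (g • x) = ψ g • f x) :
    C(BorelConstruction Γ₁ (X₁ × TwistedInterval φ₁), BorelConstruction Γ₂ (X₂ × TwistedInterval φ₂)) :=
  borelMap ψ (f.prodMap (ContinuousMap.id I)) (fun g x => Prod.ext (hf g x.1) (Subtype.ext (by
    change 1 / 2 + ((φ₁ g : ℤ) : ℝ) * (x.2.1 - 1 / 2) =
      1 / 2 + ((φ₂ (ψ g) : ℤ) : ℝ) * (x.2.1 - 1 / 2)
    rw [hψ])))

theorem twistedMap_mapsTo [MulAction Γ₁ X₁] [MulAction Γ₂ X₂] {φ₁ : Γ₁ →ₜ* ℤˣ} {φ₂ : Γ₂ →ₜ* ℤˣ}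
    (ψ : Γ₁ →ₜ* Γ₂) (hψ : ∀ g, φ₂ (ψ g) = φ₁ g) (f : C(X₁, X₂))
    (hf : ∀ (g : Γ₁) (x : X₁), f (g • x) = ψ g • f x) {Y₁ : Set X₁} {Y₂ : Set X₂}
    (hY : Set.MapsTo f Y₁ Y₂) :
    Set.MapsTo (twistedMap ψ hψ f hf) (borelSubset Γ₁ (twistedBoundary φ₁ Y₁))
      (borelSubset Γ₂ (twistedBoundary φ₂ Y₂)) := by
  rintro _ ⟨⟨e, x, t⟩, h, rfl⟩
  exact ⟨(MilnorE.relabel ψ e, f x, t), h.imp (fun h => hY h) id, rfl⟩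

/-- The homomorphism `h^{φ₂+n}_{Γ₂}(X₂) → h^{φ₁+n}_{Γ₁}(X₁)` of absolute groups induced by a
homomorphism `ψ : Γ₁ → Γ₂` with `φ₂ ∘ ψ = φ₁` and a `ψ`-equivariant map `f : X₁ → X₂`. -/
def OmegaSpectrum.twistedPullback (F : OmegaSpectrum.{v}) (n : ℤ)
    [MulAction Γ₁ X₁] [MulAction Γ₂ X₂] {φ₁ : Γ₁ →ₜ* ℤˣ} {φ₂ : Γ₂ →ₜ* ℤˣ}
    (ψ : Γ₁ →ₜ* Γ₂) (hψ : ∀ g, φ₂ (ψ g) = φ₁ g) (f : C(X₁, X₂))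
    (hf : ∀ (g : Γ₁) (x : X₁), f (g • x) = ψ g • f x) :
    F.twistedCoh n φ₂ X₂ ∅ →+ F.twistedCoh n φ₁ X₁ ∅ :=
  F.pullback (n + 1) (twistedMap ψ hψ f hf) (twistedMap_mapsTo ψ hψ f hf (Set.mapsTo_empty f _))

/-- The group `SPTᵈ(Γ, φ) = h^{φ+d}_Γ(pt)` of `d`-dimensional symmetry protected topological
phases with symmetry `(Γ, φ)`, for the Ω-spectrum `F` of short-range entangled states. -/
abbrev SPT (F : OmegaSpectrum.{v}) (d : ℤ) (φ : Γ →ₜ* ℤˣ) : Type _ :=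
  F.twistedCoh d φ PUnit.{1} ∅

/-- The symmetry-forgetting (relabelling) map `ψ^* : SPTᵈ(Γ₂, φ₂) → SPTᵈ(Γ₁, φ₁)`. -/
def SPT.forget (F : OmegaSpectrum.{v}) (d : ℤ) {φ₁ : Γ₁ →ₜ* ℤˣ} {φ₂ : Γ₂ →ₜ* ℤˣ}
    (ψ : Γ₁ →ₜ* Γ₂) (hψ : ∀ g, φ₂ (ψ g) = φ₁ g) : SPT F d φ₂ →+ SPT F d φ₁ :=
  F.twistedPullback d ψ hψ (ContinuousMap.id PUnit) (fun _ _ => rfl)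

end Equivariant

/-! ### The symmetry groups `G × ℤ₂^R` and `G × (ℤ ⋊ ℤ₂^R)` -/

/-- The action of `ℤ₂^R = {±1}` on the group of translations `ℤ` by sign. -/
def signAction : ℤˣ →* MulAut (Multiplicative ℤ) where
  toFun u :=
    { toFun := fun n => n ^ (u : ℤ)
      invFun := fun n => n ^ (u : ℤ)
      left_inv := fun n => by
        change (n ^ (u : ℤ)) ^ (u : ℤ) = n
        rw [← zpow_mul, ← Units.val_mul, Int.units_mul_self, Units.val_one, zpow_one]
      right_inv := fun n => by
        change (n ^ (u : ℤ)) ^ (u : ℤ) = n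
        rw [← zpow_mul, ← Units.val_mul, Int.units_mul_self, Units.val_one, zpow_one]
      map_mul' := fun a b => mul_zpow a b _ }
  map_one' := by ext; simp
  map_mul' u v := by
    ext n
    change (n ^ ((u * v : ℤˣ) : ℤ)) = (n ^ (v : ℤ)) ^ (u : ℤ)
    rw [← zpow_mul, Units.val_mul, mul_comm]

/-- The space group `ℤ ⋊ ℤ₂^R` of the line, generated by the translation `x ↦ x + 1` and the
reflection `x ↦ -x`; the element `(n, u)` is the isometry `x ↦ n + u x`. -/
abbrev LineGroup : Type := Multiplicative ℤ ⋊[signAction] ℤˣ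

/-- `ℤ ⋊ ℤ₂^R` is a discrete group. -/
instance : TopologicalSpace LineGroup := ⊥

/-- The reflection `x ↦ k - x` about `k / 2` generates a subgroup `ℤ₂^R` of `ℤ ⋊ ℤ₂^R`. -/
def reflectionAt (k : ℤ) : ℤˣ →* LineGroup where
  toFun u := ⟨Multiplicative.ofAdd (if u = 1 then 0 else k), u⟩
  map_one' := rfl
  map_mul' u v := by
    refine SemidirectProduct.ext ?_ rfl
    change Multiplicative.ofAdd (if u * v = 1 then 0 else k) =
      Multiplicative.ofAdd (if u = 1 then 0 else k) *
        Multiplicative.ofAdd (if v = 1 then 0 else k) ^ (u : ℤ)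
    rcases Int.units_eq_one_or u with rfl | rfl <;> rcases Int.units_eq_one_or v with rfl | rfl <;>
      simp

section SymmetryGroups

variable (G : Type u) [Group G] [TopologicalSpace G]

/-- The inclusion `G → G × ℤ₂^R`. -/
def inclG : G →ₜ* G × ℤˣ := ⟨MonoidHom.inl G ℤˣ, by
  change Continuous fun g : G => (g, (1 : ℤˣ))
  fun_prop⟩

/-- The projection `G × (ℤ ⋊ ℤ₂^R) → G × ℤ₂^R` to the point group. -/
def projPointGroup : G × LineGroup →ₜ* G × ℤˣ :=
  ⟨(MonoidHom.id G).prodMap SemidirectProduct.rightHom, by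
    have : DiscreteTopology LineGroup := ⟨rfl⟩
    exact continuous_id.prodMap (continuous_of_discreteTopology (f := SemidirectProduct.right))⟩

/-- The inclusion `G × ℤ₂^R → G × (ℤ ⋊ ℤ₂^R)` sending the generator of `ℤ₂^R` to the reflection
`x ↦ k - x`. -/
def inclReflection (k : ℤ) : G × ℤˣ →ₜ* G × LineGroup :=
  ⟨(MonoidHom.id G).prodMap (reflectionAt k),
    continuous_id.prodMap (continuous_of_discreteTopology (f := reflectionAt k))⟩

variable {G}

/-- The extension of `φ` to `G × ℤ₂^R` taking the value `-1` on the reflection. -/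
def pointTwist (φ : G →ₜ* ℤˣ) : G × ℤˣ →ₜ* ℤˣ :=
  ⟨φ.toMonoidHom.coprod (MonoidHom.id ℤˣ), by
    change Continuous fun p : G × ℤˣ => φ p.1 * p.2
    exact (φ.continuous_toFun.comp continuous_fst).mul continuous_snd⟩

/-- The extension of `φ` to `G × (ℤ ⋊ ℤ₂^R)` taking the value `1` on the translations and `-1` on
the reflections. -/
def lineTwist (φ : G →ₜ* ℤˣ) : G × LineGroup →ₜ* ℤˣ := (pointTwist φ).comp (projPointGroup G)

variable (G)

/-- The unit circle in `ℂ`, on which `G × ℤ₂^R` acts through the complex conjugation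
`z ↦ conj z = z⁻¹`. -/
def ReflCircle (_G : Type u) : Type := Circle

instance : TopologicalSpace (ReflCircle G) := inferInstanceAs (TopologicalSpace Circle)

instance : MulAction (G × ℤˣ) (ReflCircle G) where
  smul p z := (show Circle from z) ^ (p.2 : ℤ)
  one_smul z := zpow_one (show Circle from z)
  mul_smul p q z := by
    change (show Circle from z) ^ ((p.2 * q.2 : ℤˣ) : ℤ) =
      ((show Circle from z) ^ (q.2 : ℤ)) ^ (p.2 : ℤ)
    rw [← zpow_mul, Units.val_mul, mul_comm]

/-- The real line, on which `G × (ℤ ⋊ ℤ₂^R)` acts through the isometries `x ↦ n + u x`. -/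
def SymLine (_G : Type u) : Type := ℝ

instance : TopologicalSpace (SymLine G) := inferInstanceAs (TopologicalSpace ℝ)

instance : MulAction (G × LineGroup) (SymLine G) where
  smul p x := ((p.2.left.toAdd : ℤ) : ℝ) + ((p.2.right : ℤ) : ℝ) * (show ℝ from x)
  one_smul x := by
    have h : ∀ x : ℝ, (((0 : ℤ)) : ℝ) + (((1 : ℤˣ) : ℤ) : ℝ) * x = x := fun x => by simp
    exact h x
  mul_smul p q x := by
    have h : ∀ x : ℝ, (((p.2.left * q.2.left ^ (p.2.right : ℤ)).toAdd : ℤ) : ℝ) +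
        (((p.2.right * q.2.right : ℤˣ) : ℤ) : ℝ) * x =
        ((p.2.left.toAdd : ℤ) : ℝ) + ((p.2.right : ℤ) : ℝ) *
          (((q.2.left.toAdd : ℤ) : ℝ) + ((q.2.right : ℤ) : ℝ) * x) := fun x => by
      simp
      ring
    exact h x

/-- The covering `ℝ → S¹ = ℝ / ℤ`, `x ↦ exp(2πix)`. -/
def lineToCircle : C(SymLine G, ReflCircle G) :=
  ⟨fun x => Circle.exp (2 * Real.pi * (show ℝ from x)),
    Circle.exp.continuous.comp (continuous_const.mul (continuous_id (X := ℝ)))⟩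

theorem lineToCircle_smul (p : G × LineGroup) (x : SymLine G) :
    lineToCircle G (p • x) = projPointGroup G p • lineToCircle G x := by
  have h : ∀ (n : ℤ) (u : ℤˣ) (x : ℝ), Circle.exp (2 * Real.pi * ((n : ℝ) + ((u : ℤ) : ℝ) * x)) =
      Circle.exp (2 * Real.pi * x) ^ (u : ℤ) := by
    intro n u x
    have h1 : Circle.exp (2 * Real.pi * (n : ℝ)) = 1 :=
      Circle.exp_eq_one.2 ⟨n, by ring⟩
    rw [mul_add, Circle.exp_add, h1, one_mul, ← Circle.exp_zsmul, zsmul_eq_mul]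
    ring_nf
  exact h _ _ x

theorem re_zpow_units (z : Circle) (u : ℤˣ) : ((z ^ (u : ℤ) : Circle) : ℂ).re = (z : ℂ).re := by
  rcases Int.units_eq_one_or u with rfl | rfl
  · simp
  · simp

/-- The arc `U = {z ∈ S¹ | Re z ≥ 0}`, containing the fixed point `1` of the reflection. -/
def arcU : SubMulAction (G × ℤˣ) (ReflCircle G) where
  carrier := {z | 0 ≤ (show Circle from z : ℂ).re}
  smul_mem' p z hz := hz.trans_eq (re_zpow_units z p.2).symm

/-- The arc `V = {z ∈ S¹ | Re z ≤ 0}`, containing the fixed point `-1` of the reflection. -/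
def arcV : SubMulAction (G × ℤˣ) (ReflCircle G) where
  carrier := {z | (show Circle from z : ℂ).re ≤ 0}
  smul_mem' p z hz := (re_zpow_units z p.2).trans_le hz

/-- The intersection `U ∩ V = {i, -i} = pt ⊔ pt`, whose two points are exchanged by the
reflection. -/
abbrev arcUV : SubMulAction (G × ℤˣ) (ReflCircle G) := arcU G ⊓ arcV G

/-- The point `i ∈ U ∩ V`. -/
def pointI : arcUV G :=
  ⟨(⟨Complex.I, by simp [Submonoid.unitSphere]⟩ : Circle), by
    constructor
    · change (0 : ℝ) ≤ Complex.I.re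
      simp
    · change Complex.I.re ≤ (0 : ℝ)
      simp⟩

theorem pointI_smul (g : G) : inclG G g • pointI G = pointI G :=
  Subtype.ext (zpow_one (show Circle from (pointI G).1))

end SymmetryGroups

/-! ### The Mayer-Vietoris sequence -/

section MayerVietoris

variable (F : OmegaSpectrum.{v}) (n : ℤ) {Γ : Type*} [Group Γ] [TopologicalSpace Γ]
  (φ : Γ →ₜ* ℤˣ) {X X' : Type*} [TopologicalSpace X] [MulAction Γ X]
  [TopologicalSpace X'] [MulAction Γ X']

/-- The inclusion of an invariant subspace. -/
def subIncl (S : SubMulAction Γ X) : C(S, X) := ⟨Subtype.val, continuous_subtype_val⟩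

/-- The inclusion of an invariant subspace into a larger one. -/
def subInclLE {S T : SubMulAction Γ X} (h : S ≤ T) : C(S, T) :=
  ⟨Set.inclusion h, continuous_inclusion h⟩

namespace OmegaSpectrum

/-- The homomorphism `f^* : h^{φ+n}_Γ(X) → h^{φ+n}_Γ(X')` induced by a `Γ`-map `f : X' → X`. -/
def spacePullback (f : C(X', X)) (hf : ∀ (g : Γ) (x : X'), f (g • x) = g • f x) :
    F.twistedCoh n φ X ∅ →+ F.twistedCoh n φ X' ∅ :=
  F.twistedPullback n (ContinuousMonoidHom.id Γ) (fun _ => rfl) f hf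

variable (X) in
/-- The homomorphism `h^{φ+n}_Γ(pt) → h^{φ+n}_Γ(X)` induced by `X → pt`. -/
def fromPoint : F.twistedCoh n φ PUnit.{1} ∅ →+ F.twistedCoh n φ X ∅ :=
  F.spacePullback n φ (.const X PUnit.unit) (fun _ _ => rfl)

/-- `h^{φ+n}_Γ(X) → h^{φ+n}_Γ(U) ⊕ h^{φ+n}_Γ(V)`, the pair of restriction maps. -/
def mvRestrict (U V : SubMulAction Γ X) :
    F.twistedCoh n φ X ∅ →+ F.twistedCoh n φ U ∅ × F.twistedCoh n φ V ∅ :=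
  (F.spacePullback n φ (subIncl U) (fun _ _ => rfl)).prod
    (F.spacePullback n φ (subIncl V) (fun _ _ => rfl))

/-- `h^{φ+n}_Γ(U) ⊕ h^{φ+n}_Γ(V) → h^{φ+n}_Γ(U ∩ V)`, the difference of the restriction maps. -/
def mvDifference (U V : SubMulAction Γ X) :
    F.twistedCoh n φ U ∅ × F.twistedCoh n φ V ∅ →+ F.twistedCoh n φ ↥(U ⊓ V) ∅ :=
  (F.spacePullback n φ (subInclLE (inf_le_left : U ⊓ V ≤ U)) (fun _ _ => rfl)).comp
      (AddMonoidHom.fst _ _) -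
    (F.spacePullback n φ (subInclLE (inf_le_right : U ⊓ V ≤ V)) (fun _ _ => rfl)).comp
      (AddMonoidHom.snd _ _)

/-- `δ : h^{φ+n}_Γ(U ∩ V) → h^{φ+n+1}_Γ(X)` is the Mayer-Vietoris connecting homomorphism. -/
def IsMVConnecting (U V : SubMulAction Γ X)
    (δ : F.twistedCoh n φ ↥(U ⊓ V) ∅ →+ F.twistedCoh (n + 1) φ X ∅) : Prop :=
  F.IsMayerVietorisConnecting (n + 1)
    (borelSubset Γ (twistedBoundary φ (∅ : Set X)))
    (borelSubset Γ (twistedBoundary φ (∅ : Set U)))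
    (borelSubset Γ (twistedBoundary φ (∅ : Set V)))
    (borelSubset Γ (twistedBoundary φ (∅ : Set ↥(U ⊓ V))))
    (twistedMap (.id Γ) (fun _ => rfl) (subIncl U) (fun _ _ => rfl))
    (twistedMap (.id Γ) (fun _ => rfl) (subIncl V) (fun _ _ => rfl))
    (twistedMap (.id Γ) (fun _ => rfl) (subInclLE (inf_le_left : U ⊓ V ≤ U)) (fun _ _ => rfl))
    (twistedMap (.id Γ) (fun _ => rfl) (subInclLE (inf_le_right : U ⊓ V ≤ V)) (fun _ _ => rfl))
    δ

end OmegaSpectrum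

end MayerVietoris

/-! ### The maps between the groups of SPT phases and the identifications of the terms -/

section SPTMaps

variable (F : OmegaSpectrum.{v}) (d : ℤ) {G : Type u} [Group G] [TopologicalSpace G]
  (φ : G →ₜ* ℤˣ)

/-- The reflection-forgetting map `SPTᵈ(G × ℤ₂^R) → SPTᵈ(G)`. -/
def forgetReflection : SPT F d (pointTwist φ) →+ SPT F d φ :=
  SPT.forget F d (inclG G) (fun g => mul_one (φ g))

/-- The translation-forgetting map `SPTᵈ(G × (ℤ ⋊ ℤ₂^R)) → SPTᵈ(G × ℤ₂^R)` with respect to the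
reflection `x ↦ k - x`. -/
def forgetTranslation (k : ℤ) : SPT F d (lineTwist φ) →+ SPT F d (pointTwist φ) :=
  SPT.forget F d (inclReflection G k) (fun _ => rfl)

/-- The pair `β₁ × β₂` of translation-forgetting maps with respect to the reflections `x ↦ -x` and
`x ↦ 1 - x`. -/
def betaMap : SPT F d (lineTwist φ) →+ SPT F d (pointTwist φ) × SPT F d (pointTwist φ) :=
  (forgetTranslation F d φ 0).prod (forgetTranslation F d φ 1)

/-- The map `γ₁ ⊕ γ₂` sending `(b₁, b₂)` to the difference of `b₁` and `b₂` as `G`-symmetric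
phases. -/
def gammaMap : SPT F d (pointTwist φ) × SPT F d (pointTwist φ) →+ SPT F d φ :=
  (forgetReflection F d φ).comp (AddMonoidHom.fst _ _) -
    (forgetReflection F d φ).comp (AddMonoidHom.snd _ _)

/-- The map `h^{φ+d}_{G × ℤ₂^R}(pt ⊔ pt) → h^{φ+d}_G(pt)`, `pt ⊔ pt = U ∩ V = {i, -i}`, that
restricts the group to `G` and the space to the point `i`. -/
def twoPointsToG : F.twistedCoh d (pointTwist φ) (arcUV G) ∅ →+ F.twistedCoh d φ PUnit.{1} ∅ :=
  F.twistedPullback d (inclG G) (fun g => mul_one (φ g)) (.const PUnit.{1} (pointI G))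
    (fun g _ => (pointI_smul G g).symm)

/-- The map `h^{φ+d}_{G × ℤ₂^R}(S¹) → h^{φ+d}_{G × (ℤ ⋊ ℤ₂^R)}(ℝ)` induced by the covering
`ℝ → S¹ = ℝ / ℤ`. -/
def circleToLine : F.twistedCoh d (pointTwist φ) (ReflCircle G) ∅ →+
    F.twistedCoh d (lineTwist φ) (SymLine G) ∅ :=
  F.twistedPullback d (projPointGroup G) (fun _ => rfl) (lineToCircle G) (lineToCircle_smul G)

end SPTMaps

end

noncomputable section

/-! ### Homotopies of maps of pairs -/

section PairHomotopy

variable {X X' : Type*} [TopologicalSpace X] [TopologicalSpace X']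
  {Z : Type*} [TopologicalSpace Z] {Y : Set X} {Y' : Set X'} {z : Z}

/-! The translations act freely on the line `ℝ`, with quotient the circle, and `ℝ` becomes
equivariantly contractible after multiplication by `EΓ`. Hence phases with the full line symmetry
are classes on `ℝ`, which are classes on `S¹` for the point group `G × ℤ₂^R`. The circle is covered
by two arcs, each contracting equivariantly to a fixed point of the reflection, whose intersection
is a free `ℤ₂^R`-orbit `{i, -i}`. Mayer–Vietoris for this cover, with each term replaced by an SPT
group, is the asserted sequence.

Mayer–Vietoris is proved on the level of maps, for a cover whose intersection `A` has a bicollar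
(`BicollaredCover`). The connecting map spreads a family of loops over `A` across the bicollar
(`susp`). The central fact is `susp_doubleLoop`: a map with null-homotopies over `U` and `V` is
recovered, up to homotopy, by suspending the loops that these null-homotopies form over `A`. It
gives the characterization of the connecting map and half of the exactness. The remaining
ingredients are the cancellation rule `doubleLoopClass_add` and the gluing statement
`exists_of_pre_eq`.

No bundle theory is used. Its role is taken by `MilnorE.exists_homotopy`: the two projections `EΓ ×
EΓ → EΓ` are equivariantly homotopic, so a map that changes only the `EΓ`-coordinate equivariantly
is harmless. The identifications of terms are then explicit homotopy equivalences of Borel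
constructions. For the line, labels are averaged to obtain an equivariant map `EΓ → ℝ`
(`fromPoint_symLine_bijective`). For the covering, labels are lifted from the point group to the
line group by rounding the coordinate `x` (`circleToLine_bijective`). For the two points, the sign
of the label is discarded (`twoPointsToG_bijective`).

The maps `β₁`, `β₂` are identified by lifting the arcs to the line around `0` and `1/2`, the fixed
points of `x ↦ -x` and `x ↦ 1 - x`. -/

theorem PairClass.mk_eq_of_homotopy {f g : PairMap Y z} (H : C(I × X, Z))
    (h0 : ∀ x, H (0, x) = f.1 x) (h1 : ∀ x, H (1, x) = g.1 x)
    (hY : ∀ t, ∀ y ∈ Y, H (t, y) = z) :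
    (Quotient.mk _ f : PairClass Y z) = Quotient.mk _ g :=
  Quotient.sound ⟨⟨⟨H, h0, h1⟩, fun t y hy => (hY t y hy).trans (f.2 y hy).symm⟩⟩

theorem PairClass.exists_homotopy_of_mk_eq {f g : PairMap Y z}
    (h : (Quotient.mk _ f : PairClass Y z) = Quotient.mk _ g) :
    ∃ H : C(I × X, Z), (∀ x, H (0, x) = f.1 x) ∧ (∀ x, H (1, x) = g.1 x) ∧
      ∀ t, ∀ y ∈ Y, H (t, y) = z := by
  obtain ⟨H⟩ := Quotient.exact h
  exact ⟨H.toContinuousMap, H.apply_zero, H.apply_one,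
    fun t y hy => (H.eq_fst t hy).trans (f.2 y hy)⟩

theorem PairClass.pre_congr {f₀ f₁ : C(X', X)} (h₀ : Set.MapsTo f₀ Y' Y)
    (h₁ : Set.MapsTo f₁ Y' Y) (H : C(I × X', X)) (H0 : ∀ x, H (0, x) = f₀ x)
    (H1 : ∀ x, H (1, x) = f₁ x) (HY : ∀ t, ∀ y ∈ Y', H (t, y) ∈ Y) (a : PairClass Y z) :
    PairClass.pre f₀ h₀ a = PairClass.pre f₁ h₁ a := by
  induction a using Quotient.inductionOn with | h a =>
  exact PairClass.mk_eq_of_homotopy (a.1.comp H) (fun x => congrArg a.1 (H0 x))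
    (fun x => congrArg a.1 (H1 x)) (fun t y hy => a.2 _ (HY t y hy))

end PairHomotopy

namespace OmegaSpectrum

variable (F : OmegaSpectrum.{v}) {X X' X'' : Type*} [TopologicalSpace X] [TopologicalSpace X']
  [TopologicalSpace X''] {Y : Set X} {Y' : Set X'} {Y'' : Set X''}

/-- The group structure is transported along `toLoop`, so its zero is only known as a preimage of
the constant loop. The structure map is pointed and therefore sends the constant map there. -/
theorem coh_zero (n : ℤ) : (0 : F.coh n X Y) = PairClass.const Y (F.pt n) := by
  apply (F.toLoop n Y).injective
  have h : F.toLoop n Y 0 = 0 := (F.toLoop n Y).apply_symm_apply (0 : LoopClass Y _)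
  rw [h]
  refine congrArg (Quotient.mk _) (Subtype.ext (ContinuousMap.ext fun x => ?_))
  exact (F.equiv n).map_pt.symm

/-- The structure bijection of the spectrum as an isomorphism of groups. -/
def toLoopHom (n : ℤ) (Y : Set X) : F.coh n X Y ≃+ LoopClass Y (F.pt (n + 1)) where
  __ := F.toLoop n Y
  map_add' := F.toLoop_add n Y

theorem pullback_comp_apply (n : ℤ) (f : C(X', X)) (hf : Set.MapsTo f Y' Y) (g : C(X'', X'))
    (hg : Set.MapsTo g Y'' Y') (a : F.coh n X Y) :
    F.pullback n g hg (F.pullback n f hf a) = F.pullback n (f.comp g) (hf.comp hg) a := by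
  induction a using Quotient.inductionOn with | h a => rfl

theorem pullback_congr (n : ℤ) {f g : C(X', X)} (hf : Set.MapsTo f Y' Y)
    (hg : Set.MapsTo g Y' Y) (h : ∀ x, f x = g x) (a : F.coh n X Y) :
    F.pullback n f hf a = F.pullback n g hg a := by
  obtain rfl : f = g := ContinuousMap.ext h
  rfl

theorem pullback_id (n : ℤ) (h : Set.MapsTo (ContinuousMap.id X) Y Y) (a : F.coh n X Y) :
    F.pullback n (ContinuousMap.id X) h a = a := by
  induction a using Quotient.inductionOn with | h a => rfl

theorem toLoop_pullback (n : ℤ) (f : C(X', X)) (hf : Set.MapsTo f Y' Y) (a : F.coh n X Y) :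
    F.toLoop n Y' (F.pullback n f hf a) = PairClass.pre f hf (F.toLoop n Y a) :=
  PairClass.post_pre (F.equiv n).toFun (F.equiv n).map_pt f hf a

/-- A homotopy equivalence of pairs induces a bijection in cohomology. -/
theorem pullback_bijective (n : ℤ) (f : C(X', X)) (hf : Set.MapsTo f Y' Y) (g : C(X, X'))
    (hg : Set.MapsTo g Y Y') (H : C(I × X', X')) (H0 : ∀ x, H (0, x) = g (f x))
    (H1 : ∀ x, H (1, x) = x) (HY : ∀ t, ∀ y ∈ Y', H (t, y) ∈ Y')
    (K : C(I × X, X)) (K0 : ∀ x, K (0, x) = f (g x))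
    (K1 : ∀ x, K (1, x) = x) (KY : ∀ t, ∀ y ∈ Y, K (t, y) ∈ Y) :
    Function.Bijective (F.pullback n f hf) := by
  refine Function.bijective_iff_has_inverse.2 ⟨F.pullback n g hg, fun a => ?_, fun a => ?_⟩
  · rw [pullback_comp_apply]
    refine Eq.trans ?_ (F.pullback_id n (Set.mapsTo_id Y) a)
    exact PairClass.pre_congr (f₀ := f.comp g) (f₁ := .id X) (hf.comp hg) (Set.mapsTo_id Y) K K0 K1 KY a
  · rw [pullback_comp_apply]
    refine Eq.trans ?_ (F.pullback_id n (Set.mapsTo_id Y') a)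
    exact PairClass.pre_congr (f₀ := g.comp f) (f₁ := .id X') (hg.comp hf) (Set.mapsTo_id Y') H H0 H1 HY a

end OmegaSpectrum

/-! ### Gluing and lifting continuous maps -/

section Gluing

variable {Y W : Type*} [TopologicalSpace Y] [TopologicalSpace W]

/-- The map equal to `f` where `0 ≤ b` and to `g` where `b ≤ 0`. -/
def glue (b : C(Y, ℝ)) (f : C({y // 0 ≤ b y}, W)) (g : C({y // b y ≤ 0}, W))
    (h : ∀ y h₁ h₂, f ⟨y, h₁⟩ = g ⟨y, h₂⟩) : C(Y, W) where
  toFun y := if hy : 0 ≤ b y then f ⟨y, hy⟩ else g ⟨y, le_of_not_ge hy⟩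
  continuous_toFun := by
    rw [← continuousOn_univ]
    have hu : (Set.univ : Set Y) = {y | 0 ≤ b y} ∪ {y | b y ≤ 0} := by
      ext y; simpa using le_total 0 (b y)
    rw [hu]
    refine ContinuousOn.union_of_isClosed ?_ ?_ (isClosed_le continuous_const b.continuous)
      (isClosed_le b.continuous continuous_const)
    · rw [continuousOn_iff_continuous_domRestrict]
      refine f.continuous.congr fun y => ?_
      rw [Set.domRestrict_apply, dif_pos y.2]
    · rw [continuousOn_iff_continuous_domRestrict]
      refine g.continuous.congr fun y => ?_
      by_cases hy : 0 ≤ b y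
      · rw [Set.domRestrict_apply, dif_pos hy, h y.1 hy y.2]
      · rw [Set.domRestrict_apply, dif_neg hy]

theorem glue_of_nonneg {b : C(Y, ℝ)} {f : C({y // 0 ≤ b y}, W)} {g : C({y // b y ≤ 0}, W)}
    {h : ∀ y h₁ h₂, f ⟨y, h₁⟩ = g ⟨y, h₂⟩} {y : Y} (hy : 0 ≤ b y) :
    glue b f g h y = f ⟨y, hy⟩ := dif_pos hy

theorem glue_of_nonpos {b : C(Y, ℝ)} {f : C({y // 0 ≤ b y}, W)} {g : C({y // b y ≤ 0}, W)}
    {h : ∀ y h₁ h₂, f ⟨y, h₁⟩ = g ⟨y, h₂⟩} {y : Y} (hy : b y ≤ 0) :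
    glue b f g h y = g ⟨y, hy⟩ := by
  by_cases hy' : 0 ≤ b y
  · rw [glue_of_nonneg hy', h y hy' hy]
  · exact dif_neg hy'

/-- In the application `U`, `V`, `A` are Borel constructions in their own right, not subsets of `X`.
This turns maps into `X` with the right range into maps into them. -/
theorem exists_lift_of_isInducing {X : Type*} [TopologicalSpace X] {i : W → X}
    (hi : Topology.IsInducing i) (f : C(Y, X)) (hf : ∀ y, f y ∈ Set.range i) :
    ∃ g : C(Y, W), ∀ y, i (g y) = f y := by
  choose g hg using hf
  exact ⟨⟨g, hi.continuous_iff.2 (f.continuous.congr fun y => (hg y).symm)⟩, hg⟩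

/-- The projection of the real line onto the unit interval. -/
abbrev toI (x : ℝ) : I := Set.projIcc 0 1 zero_le_one x

theorem toI_zero : toI 0 = 0 := Set.projIcc_left _

theorem toI_one : toI 1 = 1 := Set.projIcc_right _

theorem toI_of_one_le {x : ℝ} (h : 1 ≤ x) : toI x = 1 := Set.projIcc_of_right_le _ h

theorem toI_coe (t : I) : toI (t : ℝ) = t := Set.projIcc_val _ t

theorem coe_toI {x : ℝ} (h0 : 0 ≤ x) (h1 : x ≤ 1) : ((toI x : I) : ℝ) = x := by
  simp [toI, Set.projIcc_of_mem zero_le_one ⟨h0, h1⟩]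

@[fun_prop]
theorem continuous_toI : Continuous toI := continuous_projIcc

end Gluing

/-! ### The suspension of a family of loops over a bicollared subspace -/

/-- A cover of `X` by two closed subspaces `U = {0 ≤ c}` and `V = {c ≤ 0}` whose intersection
`A = {c = 0}` has the bicollar `{|c| ≤ 1}`: a deformation `p` of the identity of `X` preserves
`U`, `V` and the subset `X₀` and ends with a map that retracts the bicollar onto `A`. -/
structure BicollaredCover {X U V A : Type*} [TopologicalSpace X] [TopologicalSpace U]
    [TopologicalSpace V] [TopologicalSpace A] (X₀ : Set X) (U₀ : Set U) (V₀ : Set V) (A₀ : Set A)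
    (iU : C(U, X)) (iV : C(V, X)) (jU : C(A, U)) (jV : C(A, V)) where
  c : C(X, ℝ)
  p : C(I × X, X)
  indU : Topology.IsEmbedding iU
  rangeU : ∀ x, x ∈ Set.range iU ↔ 0 ≤ c x
  indV : Topology.IsEmbedding iV
  rangeV : ∀ x, x ∈ Set.range iV ↔ c x ≤ 0
  indA : Topology.IsEmbedding (iU.comp jU)
  rangeA : ∀ x, x ∈ Set.range (iU.comp jU) ↔ c x = 0
  comm : ∀ a, iU (jU a) = iV (jV a)
  p_zero : ∀ x, p (0, x) = x
  p_nonneg : ∀ s x, 0 ≤ c x → 0 ≤ c (p (s, x))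
  p_nonpos : ∀ s x, c x ≤ 0 → c (p (s, x)) ≤ 0
  p_one : ∀ x, |c x| ≤ 1 → c (p (1, x)) = 0
  p_one_of_eq_zero : ∀ x, c x = 0 → p (1, x) = x
  p_base : ∀ s, ∀ x ∈ X₀, p (s, x) ∈ X₀
  memU : ∀ u, u ∈ U₀ ↔ iU u ∈ X₀
  memV : ∀ v, v ∈ V₀ ↔ iV v ∈ X₀
  memA : ∀ a, a ∈ A₀ ↔ iU (jU a) ∈ X₀

namespace BicollaredCover

variable {X U V A : Type*} [TopologicalSpace X] [TopologicalSpace U]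
    [TopologicalSpace V] [TopologicalSpace A] {X₀ : Set X} {U₀ : Set U} {V₀ : Set V} {A₀ : Set A}
    {iU : C(U, X)} {iV : C(V, X)} {jU : C(A, U)} {jV : C(A, V)}
    (D : BicollaredCover X₀ U₀ V₀ A₀ iU iV jU jV)
    {Z W : Type*} [TopologicalSpace Z] [TopologicalSpace W] {z : Z} {w' : W}
    {T : Type*} [TopologicalSpace T]

theorem exists_pU : ∃ q : C(I × {x // 0 ≤ D.c x}, U), ∀ y, iU (q y) = D.p (y.1, y.2.1) :=
  exists_lift_of_isInducing D.indU.isInducing ⟨fun y : I × {x // 0 ≤ D.c x} => D.p (y.1, y.2.1), by fun_prop⟩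
    fun y => (D.rangeU _).2 (D.p_nonneg _ _ y.2.2)

theorem exists_pV : ∃ q : C(I × {x // D.c x ≤ 0}, V), ∀ y, iV (q y) = D.p (y.1, y.2.1) :=
  exists_lift_of_isInducing D.indV.isInducing ⟨fun y : I × {x // D.c x ≤ 0} => D.p (y.1, y.2.1), by fun_prop⟩
    fun y => (D.rangeV _).2 (D.p_nonpos _ _ y.2.2)

theorem exists_pA : ∃ q : C({x // |D.c x| ≤ 1}, A), ∀ y, iU (jU (q y)) = D.p (1, y.1) :=
  exists_lift_of_isInducing (i := iU.comp jU) D.indA.isInducing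
    ⟨fun y : {x // |D.c x| ≤ 1} => D.p (1, y.1), by fun_prop⟩ fun y => (D.rangeA _).2 (D.p_one _ y.2)

/-- The deformation of `X` restricted to `U`. -/
def pU : C(I × {x // 0 ≤ D.c x}, U) := D.exists_pU.choose

/-- The deformation of `X` restricted to `V`. -/
def pV : C(I × {x // D.c x ≤ 0}, V) := D.exists_pV.choose

/-- The retraction of the bicollar onto `A`. -/
def pA : C({x // |D.c x| ≤ 1}, A) := D.exists_pA.choose

theorem iU_pU (s : I) (x : X) (h : 0 ≤ D.c x) : iU (D.pU (s, ⟨x, h⟩)) = D.p (s, x) :=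
  D.exists_pU.choose_spec _

theorem iV_pV (s : I) (x : X) (h : D.c x ≤ 0) : iV (D.pV (s, ⟨x, h⟩)) = D.p (s, x) :=
  D.exists_pV.choose_spec _

theorem i_pA (x : X) (h : |D.c x| ≤ 1) : iU (jU (D.pA ⟨x, h⟩)) = D.p (1, x) :=
  D.exists_pA.choose_spec _

theorem nonneg_iU (u : U) : 0 ≤ D.c (iU u) := (D.rangeU _).1 ⟨u, rfl⟩
theorem nonpos_iV (v : V) : D.c (iV v) ≤ 0 := (D.rangeV _).1 ⟨v, rfl⟩
theorem c_iA (a : A) : D.c (iU (jU a)) = 0 := (D.rangeA _).1 ⟨a, rfl⟩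

theorem pU_zero (u : U) : D.pU (0, ⟨iU u, D.nonneg_iU u⟩) = u :=
  D.indU.injective (by rw [D.iU_pU, D.p_zero])

theorem pV_zero (v : V) : D.pV (0, ⟨iV v, D.nonpos_iV v⟩) = v :=
  D.indV.injective (by rw [D.iV_pV, D.p_zero])

theorem pU_one (x : X) (h : 0 ≤ D.c x) (h' : |D.c x| ≤ 1) :
    D.pU (1, ⟨x, h⟩) = jU (D.pA ⟨x, h'⟩) :=
  D.indU.injective (by rw [D.iU_pU, D.i_pA])

theorem pV_one (x : X) (h : D.c x ≤ 0) (h' : |D.c x| ≤ 1) :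
    D.pV (1, ⟨x, h⟩) = jV (D.pA ⟨x, h'⟩) :=
  D.indV.injective (by rw [D.iV_pV, ← D.comm, D.i_pA])

/-- The end of the deformation fixes the zero set of `c` pointwise, so `pA` is a genuine retraction
and not only one up to homotopy. -/
theorem pA_iA (a : A) (h : |D.c (iU (jU a))| ≤ 1) : D.pA ⟨iU (jU a), h⟩ = a :=
  D.indA.injective ((D.i_pA _ h).trans (D.p_one_of_eq_zero _ (D.c_iA a)))

theorem pU_mem (s : I) (x : X) (h : 0 ≤ D.c x) (hx : x ∈ X₀) : D.pU (s, ⟨x, h⟩) ∈ U₀ :=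
  (D.memU _).2 (by rw [D.iU_pU]; exact D.p_base s x hx)

theorem pV_mem (s : I) (x : X) (h : D.c x ≤ 0) (hx : x ∈ X₀) : D.pV (s, ⟨x, h⟩) ∈ V₀ :=
  (D.memV _).2 (by rw [D.iV_pV]; exact D.p_base s x hx)

theorem pA_mem (x : X) (h : |D.c x| ≤ 1) (hx : x ∈ X₀) : D.pA ⟨x, h⟩ ∈ A₀ :=
  (D.memA _).2 (by rw [D.i_pA]; exact D.p_base 1 x hx)

theorem mapsTo_iU (D : BicollaredCover X₀ U₀ V₀ A₀ iU iV jU jV) :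
    Set.MapsTo iU U₀ X₀ := fun u hu => (D.memU u).1 hu

theorem mapsTo_iV (D : BicollaredCover X₀ U₀ V₀ A₀ iU iV jU jV) :
    Set.MapsTo iV V₀ X₀ := fun v hv => (D.memV v).1 hv

theorem mapsTo_jU (D : BicollaredCover X₀ U₀ V₀ A₀ iU iV jU jV) :
    Set.MapsTo jU A₀ U₀ := fun a ha => (D.memU _).2 ((D.memA a).1 ha)

theorem mapsTo_jV (D : BicollaredCover X₀ U₀ V₀ A₀ iU iV jU jV) :
    Set.MapsTo jV A₀ V₀ := fun a ha =>
  (D.memV _).2 (D.comm a ▸ (D.memA a).1 ha)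

/-- The map `X → Z` that runs through the loop `w a` along the bicollar over `a ∈ A`, in the
direction from `U` to `V`, and is constant outside of the bicollar. -/
def suspend (w : C(T × A, Path z z)) : C(T × X, Z) :=
  glue ⟨fun q => 1 - |D.c q.2|, by fun_prop⟩
    ⟨fun q => w (q.1.1, D.pA ⟨q.1.2, sub_nonneg.1 q.2⟩) (toI ((1 - D.c q.1.2) / 2)), by
      have h1 : Continuous fun q : {q : T × X // 0 ≤ 1 - |D.c q.2|} =>
        w (q.1.1, D.pA ⟨q.1.2, sub_nonneg.1 q.2⟩) := by fun_prop
      have h2 : Continuous fun q : {q : T × X // 0 ≤ 1 - |D.c q.2|} =>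
        toI ((1 - D.c q.1.2) / 2) := by fun_prop
      exact h1.eval h2⟩
    (.const _ z) (by
      intro q h₁ h₂
      have h : |D.c q.2| = 1 := le_antisymm (sub_nonneg.1 h₁) (sub_nonpos.1 h₂)
      -- At the edges `c = 1` and `c = -1` of the bicollar the loop time `(1 - c) / 2` is `0` and
      -- `1`, so both formulas give the basepoint.
      change w _ _ = z
      rcases eq_or_eq_neg_of_abs_eq h with h | h
      · have h' : toI ((1 - D.c q.2) / 2) = 0 := by rw [h]; norm_num
        exact (congrArg (w _) h').trans (Path.source _)
      · have h' : toI ((1 - D.c q.2) / 2) = 1 := by rw [h]; norm_num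
        exact (congrArg (w _) h').trans (Path.target _))

theorem suspend_collar (w : C(T × A, Path z z)) (t : T) (x : X) (h : |D.c x| ≤ 1) :
    D.suspend w (t, x) = w (t, D.pA ⟨x, h⟩) (toI ((1 - D.c x) / 2)) :=
  glue_of_nonneg (b := ⟨fun q : T × X => 1 - |D.c q.2|, by fun_prop⟩) (sub_nonneg.2 h)

theorem suspend_outside (w : C(T × A, Path z z)) (t : T) (x : X) (h : 1 ≤ |D.c x|) :
    D.suspend w (t, x) = z :=
  glue_of_nonpos (b := ⟨fun q : T × X => 1 - |D.c q.2|, by fun_prop⟩) (sub_nonpos.2 h)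

/-- Allowing different parameter spaces compares a homotopy (`T = I`) with the single maps (`T =
Unit`) at its ends. -/
theorem suspend_eq {S : Type*} [TopologicalSpace S] {w : C(T × A, Path z z)}
    {v : C(S × A, Path z z)} {t : T} {s : S} (h : ∀ a, w (t, a) = v (s, a)) (x : X) :
    D.suspend w (t, x) = D.suspend v (s, x) := by
  rcases le_total |D.c x| 1 with hx | hx
  · rw [D.suspend_collar _ _ _ hx, D.suspend_collar _ _ _ hx, h]
  · rw [D.suspend_outside _ _ _ hx, D.suspend_outside _ _ _ hx]

theorem suspend_base {w : C(T × A, Path z z)} {t : T} (h : ∀ a ∈ A₀, w (t, a) = Path.refl z)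
    {x : X} (hx : x ∈ X₀) : D.suspend w (t, x) = z := by
  rcases le_total |D.c x| 1 with hc | hc
  · rw [D.suspend_collar _ _ _ hc, h _ (D.pA_mem x hc hx)]
    rfl
  · exact D.suspend_outside _ _ _ hc

/-- The suspension of a single map of pairs. -/
def suspendMap (w : PairMap A₀ (Path.refl z)) : PairMap X₀ z :=
  ⟨(D.suspend (T := Unit) (w.1.comp .snd)).comp ⟨fun x => ((), x), by fun_prop⟩,
    fun _ hx => D.suspend_base (fun a ha => w.2 a ha) hx⟩

theorem suspendMap_eq (w : PairMap A₀ (Path.refl z)) (x : X) {v : C(T × A, Path z z)} {t : T}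
    (h : ∀ a, v (t, a) = w.1 a) : (D.suspendMap w).1 x = D.suspend v (t, x) :=
  D.suspend_eq (fun a => (h a).symm) x

theorem suspendMap_collar (w : PairMap A₀ (Path.refl z)) (x : X) (h : |D.c x| ≤ 1) :
    (D.suspendMap w).1 x = w.1 (D.pA ⟨x, h⟩) (toI ((1 - D.c x) / 2)) :=
  D.suspend_collar _ _ _ h

theorem suspendMap_outside (w : PairMap A₀ (Path.refl z)) (x : X) (h : 1 ≤ |D.c x|) :
    (D.suspendMap w).1 x = z :=
  D.suspend_outside _ _ _ h

/-- Suspension on homotopy classes. -/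
def susp : LoopClass A₀ z → PairClass X₀ z :=
  Quotient.map D.suspendMap (by
    intro w v h
    obtain ⟨H, h0, h1, hA⟩ := PairClass.exists_homotopy_of_mk_eq (Quotient.sound h)
    exact Quotient.exact (PairClass.mk_eq_of_homotopy (D.suspend H)
      (fun x => (D.suspendMap_eq w x h0).symm) (fun x => (D.suspendMap_eq v x h1).symm)
      fun t y hy => D.suspend_base (hA t) hy))

theorem suspendMap_comp {Y Z : Type*} [TopologicalSpace Y] [TopologicalSpace Z] {y : Y} {z : Z}
    (k : Y → Z) (hk : k y = z) (a : PairMap A₀ (Path.refl y)) (b : PairMap A₀ (Path.refl z))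
    (h : ∀ x t, b.1 x t = k (a.1 x t)) (x : X) :
    (D.suspendMap b).1 x = k ((D.suspendMap a).1 x) := by
  rcases le_total |D.c x| 1 with hx | hx
  · rw [D.suspendMap_collar _ _ hx, D.suspendMap_collar _ _ hx, h]
  · rw [D.suspendMap_outside _ _ hx, D.suspendMap_outside _ _ hx, hk]

/-- Naturality in the target. For the structure maps of the spectrum it moves the additivity of the
connecting map into a double loop space. -/
theorem susp_post (k : C(Z, W)) (hk : k z = w') (a : LoopClass A₀ z) :
    (D.susp a).post k hk = D.susp (a.post (loopMap k hk) (loopMap_refl k hk)) := by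
  induction a using Quotient.inductionOn with | h a =>
  exact congrArg (Quotient.mk _) (Subtype.ext (ContinuousMap.ext fun x =>
    (D.suspendMap_comp k hk a _ (fun _ _ => rfl) x).symm))

/-- Eckmann–Hilton: the two concatenations of double loops share a unit and satisfy the interchange
law. Addition may therefore be computed in the coordinate that suspension leaves alone. -/
theorem _root_.LoopClass.add_eq_innerMul {Y : Set X} (a b : LoopClass Y (Path.refl z)) :
    a + b = (PairClass.pair a b).post (innerMul z) (innerMul_refl z) := by
  let m : LoopClass Y (Path.refl z) → LoopClass Y (Path.refl z) → LoopClass Y (Path.refl z) :=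
    fun a b => (PairClass.pair a b).post (innerMul z) (innerMul_refl z)
  have hm : EckmannHilton.IsUnital m (0 : LoopClass Y (Path.refl z)) :=
    { left_id := by
        intro a
        induction a using Quotient.inductionOn with | h a =>
        exact Quotient.sound (homotopicRel_comp_of_pointed (innerMul_left_homotopic z) a)
      right_id := by
        intro a
        induction a using Quotient.inductionOn with | h a =>
        exact Quotient.sound (homotopicRel_comp_of_pointed (innerMul_right_homotopic z) a) }
  have hadd : EckmannHilton.IsUnital (fun a b : LoopClass Y (Path.refl z) => a + b) 0 :=
    EckmannHilton.AddZeroClass.IsUnital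
  have h := EckmannHilton.mul hm hadd (by
    intro a b c d
    induction a using Quotient.inductionOn with | h a =>
    induction b using Quotient.inductionOn with | h b =>
    induction c using Quotient.inductionOn with | h c =>
    induction d using Quotient.inductionOn with | h d =>
    exact congrArg (Quotient.mk _) (Subtype.ext (ContinuousMap.ext fun x =>
      innerMul_interchange (a.1 x) (b.1 x) (c.1 x) (d.1 x))))
  exact (congrFun (congrFun h a) b).symm

/-- Suspension uses up the outer loop coordinate. Once the sum is formed in the inner coordinate,
suspension commutes with it pointwise, already on representatives. -/
theorem susp_add (a b : LoopClass A₀ (Path.refl z)) : D.susp (a + b) = D.susp a + D.susp b := by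
  rw [LoopClass.add_eq_innerMul, LoopClass.add_def]
  induction a using Quotient.inductionOn with | h a =>
  induction b using Quotient.inductionOn with | h b =>
  refine congrArg (Quotient.mk _) (Subtype.ext (ContinuousMap.ext fun x => ?_))
  change (D.suspendMap _).1 x = ((D.suspendMap a).1 x).trans ((D.suspendMap b).1 x)
  have h : ∀ w : PairMap A₀ (Path.refl (Path.refl z)),
      (∀ x t, w.1 x t = (a.1 x t).trans (b.1 x t)) →
        (D.suspendMap w).1 x = ((D.suspendMap a).1 x).trans ((D.suspendMap b).1 x) := by
    intro w hw
    rcases le_total |D.c x| 1 with hx | hx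
    · rw [D.suspendMap_collar _ _ hx, D.suspendMap_collar _ _ hx, D.suspendMap_collar _ _ hx, hw]
    · rw [D.suspendMap_outside _ _ hx, D.suspendMap_outside _ _ hx, D.suspendMap_outside _ _ hx,
        Path.refl_trans_refl]
  exact h _ fun _ _ => rfl

end BicollaredCover

/-! ### Loops formed by two null-homotopies -/

section NullHomotopy

variable {Y Z : Type*} [TopologicalSpace Y] [TopologicalSpace Z] {Y₀ : Set Y} {z : Z}
  {f : Y → Z} {P H Q : C(I × Y, Z)}

/-- `P` is a homotopy of maps of pairs `(Y, Y₀) → (Z, z)` from the constant map to `f`. -/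
structure IsNullHomotopy (Y₀ : Set Y) (z : Z) (P : C(I × Y, Z)) (f : Y → Z) : Prop where
  zero : ∀ y, P (0, y) = z
  one : ∀ y, P (1, y) = f y
  base : ∀ t, ∀ y ∈ Y₀, P (t, y) = z

theorem IsNullHomotopy.comp {Y' : Type*} [TopologicalSpace Y'] {Y₀' : Set Y'}
    (hP : IsNullHomotopy Y₀ z P f) (i : C(Y', Y)) (hi : Set.MapsTo i Y₀' Y₀) :
    IsNullHomotopy Y₀' z (P.comp ((ContinuousMap.id I).prodMap i)) (f ∘ i) :=
  ⟨fun _ => hP.zero _, fun _ => hP.one _, fun t _ hy => hP.base t _ (hi hy)⟩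

/-- A point of the path that follows `P` and then `H` backwards. -/
def thereAndBack (P H : C(I × Y, Z)) (τ : ℝ) (y : Y) : Z :=
  if τ ≤ 1 then P (toI τ, y) else H (toI (2 - τ), y)

theorem continuous_thereAndBack (hP : IsNullHomotopy Y₀ z P f) (hH : IsNullHomotopy Y₀ z H f) :
    Continuous fun q : ℝ × Y => thereAndBack P H q.1 q.2 := by
  refine Continuous.if_le (by fun_prop) (by fun_prop) continuous_fst continuous_const ?_
  rintro ⟨τ, y⟩ rfl
  norm_num [toI_one, hP.one, hH.one]

theorem thereAndBack_zero (hP : IsNullHomotopy Y₀ z P f) (y : Y) :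
    thereAndBack P H 0 y = z := by
  simp [thereAndBack, hP.zero]

theorem thereAndBack_two (hH : IsNullHomotopy Y₀ z H f) (y : Y) :
    thereAndBack P H 2 y = z := by
  norm_num [thereAndBack, toI_zero, hH.zero]

theorem thereAndBack_base (hP : IsNullHomotopy Y₀ z P f) (hH : IsNullHomotopy Y₀ z H f) (τ : ℝ)
    {y : Y} (hy : y ∈ Y₀) : thereAndBack P H τ y = z := by
  unfold thereAndBack
  split_ifs
  · exact hP.base _ _ hy
  · exact hH.base _ _ hy

theorem thereAndBack_symm (hP : IsNullHomotopy Y₀ z P f) (hH : IsNullHomotopy Y₀ z H f) (τ : ℝ)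
    (y : Y) : thereAndBack P H (2 - τ) y = thereAndBack H P τ y := by
  unfold thereAndBack
  rcases lt_trichotomy τ 1 with h | rfl | h
  · rw [if_neg (by linarith), if_pos h.le, sub_sub_cancel]
  · norm_num [toI_one, hP.one, hH.one]
  · rw [if_pos (by linarith), if_neg (by linarith)]

/-- The family of loops that follow `P` and then `H` backwards. -/
def doubleLoop (hP : IsNullHomotopy Y₀ z P f) (hH : IsNullHomotopy Y₀ z H f) :
    PairMap Y₀ (Path.refl z) :=
  ⟨⟨fun y =>
    { toFun := fun t => thereAndBack P H (2 * t) y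
      continuous_toFun := (continuous_thereAndBack hP hH).comp
        (by fun_prop : Continuous fun t : I => ((2 * (t : ℝ), y) : ℝ × Y))
      source' := by simpa using thereAndBack_zero hP y
      target' := by simpa using thereAndBack_two hH y },
    Path.continuous_uncurry_iff.mp ((continuous_thereAndBack hP hH).comp
      (by fun_prop : Continuous fun q : Y × I => ((2 * (q.2 : ℝ), q.1) : ℝ × Y)))⟩,
    fun _ hy => Path.ext (funext fun _ => thereAndBack_base hP hH _ hy)⟩

theorem doubleLoop_apply (hP : IsNullHomotopy Y₀ z P f) (hH : IsNullHomotopy Y₀ z H f) (y : Y)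
    (t : I) : (doubleLoop hP hH).1 y t = thereAndBack P H (2 * t) y := rfl

/-- The homotopy class of the family of loops that follow `P` and then `H` backwards. -/
def doubleLoopClass (hP : IsNullHomotopy Y₀ z P f) (hH : IsNullHomotopy Y₀ z H f) :
    LoopClass Y₀ z := Quotient.mk _ (doubleLoop hP hH)

/-- In the concatenation of `P H⁻¹` with `H Q⁻¹` the middle part `H⁻¹ H` is contracted. This cocycle
rule is what splits a loop over `A` into a part from `U` and a part from `V`. -/
theorem doubleLoopClass_add (hP : IsNullHomotopy Y₀ z P f) (hH : IsNullHomotopy Y₀ z H f)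
    (hQ : IsNullHomotopy Y₀ z Q f) :
    doubleLoopClass hP hH + doubleLoopClass hH hQ = doubleLoopClass hP hQ := by
  let B : C(I × Y, Z) → I → ℝ → Y → Z := fun P s t y => thereAndBack P H ((2 + 2 * s) * t) y
  have hB : ∀ {P}, IsNullHomotopy Y₀ z P f →
      Continuous fun q : (I × Y) × ℝ => B P q.1.1 q.2 q.1.2 := fun hP =>
    (continuous_thereAndBack hP hH).comp (by fun_prop :
      Continuous fun q : (I × Y) × ℝ => (((2 + 2 * (q.1.1 : ℝ)) * q.2, q.1.2) : ℝ × Y))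
  -- Stage `s` follows `P H⁻¹` up to time `1 + s`, that is, it goes back along `H` only by the
  -- amount `s`, and then returns along the corresponding part of `Q H⁻¹` reversed. Stage `0` is `P
  -- Q⁻¹` and stage `1` is the full concatenation. The two halves meet at `H (1 - s)`.
  let Φ : (I × Y) × I → Z := fun q =>
    if (q.2 : ℝ) ≤ 1 / 2 then B P q.1.1 q.2 q.1.2 else B Q q.1.1 (1 - q.2) q.1.2
  have hΦ : Continuous Φ := by
    refine Continuous.if_le ((hB hP).comp (by fun_prop :
      Continuous fun q : (I × Y) × I => (q.1, (q.2 : ℝ)))) ((hB hQ).comp (by fun_prop :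
      Continuous fun q : (I × Y) × I => (q.1, 1 - (q.2 : ℝ)))) (by fun_prop) continuous_const ?_
    rintro ⟨⟨s, y⟩, t⟩ ht
    change (t : ℝ) = 1 / 2 at ht
    change thereAndBack P H ((2 + 2 * s) * (t : ℝ)) y =
      thereAndBack Q H ((2 + 2 * s) * (1 - (t : ℝ))) y
    have h1 : (2 + 2 * (s : ℝ)) * (1 / 2) = 1 + s := by ring
    rw [ht, show (1 : ℝ) - 1 / 2 = 1 / 2 by norm_num, h1]
    unfold thereAndBack
    split_ifs with h
    · rw [toI_of_one_le (by linarith [s.2.1]), hP.one, hQ.one]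
    · rfl
  let Ψ : I × Y → Path z z := fun q =>
    { toFun := fun t => Φ (q, t)
      continuous_toFun := hΦ.comp (by fun_prop)
      source' := by
        change (if ((0 : I) : ℝ) ≤ 1 / 2 then B P q.1 _ q.2 else _) = z
        rw [if_pos (by norm_num)]
        change thereAndBack P H _ _ = z
        rw [Set.Icc.coe_zero, mul_zero, thereAndBack_zero hP]
      target' := by
        change (if ((1 : I) : ℝ) ≤ 1 / 2 then _ else B Q q.1 (1 - ((1 : I) : ℝ)) q.2) = z
        rw [if_neg (by norm_num)]
        change thereAndBack Q H _ _ = z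
        rw [Set.Icc.coe_one, sub_self, mul_zero, thereAndBack_zero hQ] }
  have hΨ : Continuous Ψ := Path.continuous_uncurry_iff.mp hΦ
  refine (PairClass.mk_eq_of_homotopy (g := ⟨(loopMul z).comp
    ((doubleLoop hP hH).1.prodMk (doubleLoop hH hQ).1), fun y hy => ?_⟩) ⟨Ψ, hΨ⟩ ?_ ?_ ?_).symm
  · simp [(doubleLoop hP hH).2 y hy, (doubleLoop hH hQ).2 y hy, loopMul_refl]
  · intro y
    ext t
    rw [doubleLoop_apply]
    change (if (t : ℝ) ≤ 1 / 2 then thereAndBack P H ((2 + 2 * ((0 : I) : ℝ)) * t) y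
      else thereAndBack Q H ((2 + 2 * ((0 : I) : ℝ)) * (1 - t)) y) = _
    rw [Set.Icc.coe_zero, mul_zero, add_zero]
    unfold thereAndBack
    by_cases h : (t : ℝ) ≤ 1 / 2
    · rw [if_pos h, if_pos (by linarith), if_pos (by linarith)]
    · rw [if_neg h, if_pos (by linarith), if_neg (by linarith), mul_sub, mul_one]
  · intro y
    ext t
    change (if (t : ℝ) ≤ 1 / 2 then thereAndBack P H ((2 + 2 * ((1 : I) : ℝ)) * t) y
      else thereAndBack Q H ((2 + 2 * ((1 : I) : ℝ)) * (1 - t)) y) =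
      (((doubleLoop hP hH).1 y).trans ((doubleLoop hH hQ).1 y)) t
    rw [Path.trans_apply]
    by_cases h : (t : ℝ) ≤ 1 / 2
    · rw [if_pos h, dif_pos h, doubleLoop_apply]
      congr 1
      simp only [Set.Icc.coe_one]
      ring
    · rw [if_neg h, dif_neg h, doubleLoop_apply, ← thereAndBack_symm hQ hH]
      congr 1
      simp only [Set.Icc.coe_one]
      ring
  · intro s y hy
    ext t
    change (if (t : ℝ) ≤ 1 / 2 then thereAndBack P H _ y else thereAndBack Q H _ y) = z
    rw [thereAndBack_base hP hH _ hy, thereAndBack_base hQ hH _ hy, ite_self]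

end NullHomotopy

/-! ### The Mayer-Vietoris sequence of a bicollared cover -/

namespace BicollaredCover

variable {X U V A : Type*} [TopologicalSpace X] [TopologicalSpace U]
    [TopologicalSpace V] [TopologicalSpace A] {X₀ : Set X} {U₀ : Set U} {V₀ : Set V} {A₀ : Set A}
    {iU : C(U, X)} {iV : C(V, X)} {jU : C(A, U)} {jV : C(A, V)}
    (D : BicollaredCover X₀ U₀ V₀ A₀ iU iV jU jV)
    {Z : Type*} [TopologicalSpace Z] {z : Z}

theorem isNullHomotopy_inl (D : BicollaredCover X₀ U₀ V₀ A₀ iU iV jU jV)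
    {HU : C(I × U, Z)} {f : X → Z}
    (hU : IsNullHomotopy U₀ z HU (f ∘ iU)) :
    IsNullHomotopy A₀ z (HU.comp ((ContinuousMap.id I).prodMap jU)) (f ∘ iU ∘ jU) :=
  hU.comp jU D.mapsTo_jU

theorem isNullHomotopy_inr (D : BicollaredCover X₀ U₀ V₀ A₀ iU iV jU jV)
    {HV : C(I × V, Z)} {f : X → Z}
    (hV : IsNullHomotopy V₀ z HV (f ∘ iV)) :
    IsNullHomotopy A₀ z (HV.comp ((ContinuousMap.id I).prodMap jV)) (f ∘ iU ∘ jU) := by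
  have h : f ∘ iU ∘ jU = (f ∘ iV) ∘ jV := funext fun a => congrArg f (D.comm a)
  rw [h]
  exact hV.comp jV D.mapsTo_jV

/-- Away from `A` the map `g` can be contracted along `HU` and `HV`. The farther a point lies from
`A`, the farther back along its null-homotopy it is moved, so that only the loops `HU HV⁻¹` laid
across the bicollar survive. -/
theorem susp_doubleLoop (g : PairMap X₀ z) {HU : C(I × U, Z)} {HV : C(I × V, Z)}
    (hU : IsNullHomotopy U₀ z HU (g.1 ∘ iU)) (hV : IsNullHomotopy V₀ z HV (g.1 ∘ iV)) :
    D.susp (doubleLoopClass (D.isNullHomotopy_inl hU) (D.isNullHomotopy_inr hV)) =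
      (Quotient.mk _ g : PairClass X₀ z) := by
  -- After the deformation `p`, the map on the bicollar depends only on the retraction to `A`, as
  -- the suspension requires.
  let g' : PairMap X₀ z := ⟨g.1.comp ⟨fun x => D.p (1, x), by fun_prop⟩,
    fun x hx => g.2 _ (D.p_base 1 x hx)⟩
  have hg : (Quotient.mk _ g : PairClass X₀ z) = Quotient.mk _ g' :=
    PairClass.mk_eq_of_homotopy (g.1.comp D.p) (fun x => congrArg g.1 (D.p_zero x))
      (fun x => rfl) fun t y hy => g.2 _ (D.p_base t y hy)
  rw [hg]
  refine Eq.symm ?_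
  have hU1 : ∀ x h, HU (1, D.pU (1, ⟨x, h⟩)) = g'.1 x := fun x h => by
    rw [hU.one]
    exact congrArg g.1 (D.iU_pU 1 x h)
  have hV1 : ∀ x h, HV (1, D.pV (1, ⟨x, h⟩)) = g'.1 x := fun x h => by
    rw [hV.one]
    exact congrArg g.1 (D.iV_pV 1 x h)
  let b : C(I × X, ℝ) := ⟨fun q => D.c q.2, by fun_prop⟩
  -- Both null-homotopies are run backwards by `s * min 1 |c|`. On `A` nothing moves, so the halves
  -- fit together; at `s = 1` and `|c| ≥ 1` the basepoint is reached.
  let Φ : C(I × X, Z) := glue b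
    ⟨fun q => HU (toI (1 - q.1.1 * min 1 (D.c q.1.2)), D.pU (1, ⟨q.1.2, q.2⟩)), by fun_prop⟩
    ⟨fun q => HV (toI (1 - q.1.1 * min 1 (-D.c q.1.2)), D.pV (1, ⟨q.1.2, q.2⟩)), by fun_prop⟩
    (by
      rintro ⟨s, x⟩ h₁ h₂
      have h : D.c x = 0 := le_antisymm h₂ h₁
      have e1 : toI (1 - (s : ℝ) * min 1 (D.c x)) = 1 := by
        rw [h]; norm_num [toI_one]
      have e2 : toI (1 - (s : ℝ) * min 1 (-D.c x)) = 1 := by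
        rw [h]; norm_num [toI_one]
      change HU (toI (1 - (s : ℝ) * min 1 (D.c x)), D.pU (1, ⟨x, h₁⟩)) =
        HV (toI (1 - (s : ℝ) * min 1 (-D.c x)), D.pV (1, ⟨x, h₂⟩))
      rw [e1, e2, hU1, hV1])
  have Φ_nonneg : ∀ s x (h : 0 ≤ D.c x),
      Φ (s, x) = HU (toI (1 - s * min 1 (D.c x)), D.pU (1, ⟨x, h⟩)) :=
    fun s x h => glue_of_nonneg (b := b) h
  have Φ_nonpos : ∀ s x (h : D.c x ≤ 0),
      Φ (s, x) = HV (toI (1 - s * min 1 (-D.c x)), D.pV (1, ⟨x, h⟩)) :=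
    fun s x h => glue_of_nonpos (b := b) h
  refine PairClass.mk_eq_of_homotopy Φ (fun x => ?_) (fun x => ?_) (fun s x hx => ?_)
  · rcases le_total 0 (D.c x) with h | h
    · rw [Φ_nonneg _ _ h, Set.Icc.coe_zero, zero_mul, sub_zero, toI_one, hU1]
    · rw [Φ_nonpos _ _ h, Set.Icc.coe_zero, zero_mul, sub_zero, toI_one, hV1]
  · rcases le_total 0 (D.c x) with h | h
    · rw [Φ_nonneg _ _ h, Set.Icc.coe_one, one_mul]
      rcases le_total (D.c x) 1 with h' | h'
      · have h'' : |D.c x| ≤ 1 := by rwa [abs_of_nonneg h]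
        rw [D.suspendMap_collar _ _ h'', doubleLoop_apply, min_eq_right h',
          coe_toI (by linarith) (by linarith), D.pU_one x h h'']
        unfold thereAndBack
        rw [if_pos (by linarith), mul_div_cancel₀ _ two_ne_zero]
        rfl
      · rw [D.suspendMap_outside _ _ (by rwa [abs_of_nonneg h]), min_eq_left h', sub_self,
          toI_zero, hU.zero]
    -- Over `V` the loop time lies in the second half, where the double loop traverses `HV`
    -- backwards. Reversing it with `thereAndBack_symm` reduces to the first-half formula.
    · rw [Φ_nonpos _ _ h, Set.Icc.coe_one, one_mul]
      rcases le_total (-D.c x) 1 with h' | h'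
      · have h'' : |D.c x| ≤ 1 := by rwa [abs_of_nonpos h]
        rw [D.suspendMap_collar _ _ h'', doubleLoop_apply, min_eq_right h',
          coe_toI (by linarith) (by linarith), D.pV_one x h h'',
          ← sub_sub_cancel 2 (2 * ((1 - D.c x) / 2)),
          thereAndBack_symm (D.isNullHomotopy_inl hU) (D.isNullHomotopy_inr hV)]
        unfold thereAndBack
        rw [if_pos (by linarith)]
        change _ = HV (toI _, jV _)
        congr 3
        ring
      · rw [D.suspendMap_outside _ _ (by rwa [abs_of_nonpos h]), min_eq_left h', sub_self,
          toI_zero, hV.zero]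
  · rcases le_total 0 (D.c x) with h | h
    · rw [Φ_nonneg _ _ h, hU.base _ _ (D.pU_mem 1 x h hx)]
    · rw [Φ_nonpos _ _ h, hV.base _ _ (D.pV_mem 1 x h hx)]

/-- The null-homotopy over `U` of the suspension of a family of loops. -/
theorem exists_nullHomotopy_suspend_inl (w : PairMap A₀ (Path.refl z)) :
    ∃ N : C(I × U, Z), IsNullHomotopy U₀ z N ((D.suspendMap w).1 ∘ iU) ∧
      ∀ s a, N (s, jU a) = w.1 a (toI (s / 2)) := by
  let b : C(I × U, ℝ) := ⟨fun q => 1 - |D.c (iU q.2)|, by fun_prop⟩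
  -- Over `U` the loop time `(1 - c) / 2` does not exceed `1/2`. Scaling it by `s` pulls it back to
  -- the start of the loop, and on `A` this traces the first half of `w a`.
  let N : C(I × U, Z) := glue b
    ⟨fun q => w.1 (D.pA ⟨iU q.1.2, sub_nonneg.1 q.2⟩) (toI (q.1.1 * ((1 - D.c (iU q.1.2)) / 2))),
      by
        have h1 : Continuous fun q : {q : I × U // 0 ≤ b q} =>
          w.1 (D.pA ⟨iU q.1.2, sub_nonneg.1 q.2⟩) := by fun_prop
        have h2 : Continuous fun q : {q : I × U // 0 ≤ b q} =>
          toI (q.1.1 * ((1 - D.c (iU q.1.2)) / 2)) := by fun_prop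
        exact h1.eval h2⟩
    (.const _ z) (by
      rintro ⟨s, u⟩ h₁ h₂
      have h : |D.c (iU u)| = 1 := le_antisymm (sub_nonneg.1 h₁) (sub_nonpos.1 h₂)
      rw [abs_of_nonneg (D.nonneg_iU u)] at h
      have h' : toI ((s : ℝ) * ((1 - D.c (iU u)) / 2)) = 0 := by rw [h]; norm_num [toI_zero]
      exact (congrArg (w.1 _) h').trans (Path.source _))
  have N_collar : ∀ s u (h : |D.c (iU u)| ≤ 1), N (s, u) =
      w.1 (D.pA ⟨iU u, h⟩) (toI (s * ((1 - D.c (iU u)) / 2))) :=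
    fun s u h => glue_of_nonneg (b := b) (y := (s, u)) (sub_nonneg.2 h)
  have N_outside : ∀ s u, 1 ≤ |D.c (iU u)| → N (s, u) = z :=
    fun s u h => glue_of_nonpos (b := b) (y := (s, u)) (sub_nonpos.2 h)
  refine ⟨N, ⟨fun u => ?_, fun u => ?_, fun s u hu => ?_⟩, fun s a => ?_⟩
  · rcases le_total |D.c (iU u)| 1 with h | h
    · rw [N_collar _ _ h, Set.Icc.coe_zero, zero_mul, toI_zero, Path.source]
    · exact N_outside _ _ h
  · rcases le_total |D.c (iU u)| 1 with h | h
    · rw [N_collar _ _ h, Set.Icc.coe_one, one_mul, Function.comp, D.suspendMap_collar _ _ h]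
    · rw [N_outside _ _ h, Function.comp, D.suspendMap_outside _ _ h]
  · rcases le_total |D.c (iU u)| 1 with h | h
    · rw [N_collar _ _ h, w.2 _ (D.pA_mem _ h ((D.memU u).1 hu))]
      rfl
    · exact N_outside _ _ h
  · have h : |D.c (iU (jU a))| ≤ 1 := by rw [D.c_iA]; norm_num
    rw [N_collar _ _ h, D.pA_iA, D.c_iA, sub_zero, mul_one_div]

/-- The null-homotopy over `V` of the suspension of a family of loops. -/
theorem exists_nullHomotopy_suspend_inr (w : PairMap A₀ (Path.refl z)) :
    ∃ N : C(I × V, Z), IsNullHomotopy V₀ z N ((D.suspendMap w).1 ∘ iV) ∧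
      ∀ s a, N (s, jV a) = w.1 a (toI (1 - s / 2)) := by
  let b : C(I × V, ℝ) := ⟨fun q => 1 - |D.c (iV q.2)|, by fun_prop⟩
  -- Over `V` the loop time is at least `1/2`, so it is pulled to the end of the loop instead: it
  -- equals `1 - (1 + c) / 2`, and the subtracted part is scaled by `s`.
  let N : C(I × V, Z) := glue b
    ⟨fun q => w.1 (D.pA ⟨iV q.1.2, sub_nonneg.1 q.2⟩)
        (toI (1 - q.1.1 * ((1 + D.c (iV q.1.2)) / 2))),
      by
        have h1 : Continuous fun q : {q : I × V // 0 ≤ b q} =>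
          w.1 (D.pA ⟨iV q.1.2, sub_nonneg.1 q.2⟩) := by fun_prop
        have h2 : Continuous fun q : {q : I × V // 0 ≤ b q} =>
          toI (1 - q.1.1 * ((1 + D.c (iV q.1.2)) / 2)) := by fun_prop
        exact h1.eval h2⟩
    (.const _ z) (by
      rintro ⟨s, u⟩ h₁ h₂
      have h : |D.c (iV u)| = 1 := le_antisymm (sub_nonneg.1 h₁) (sub_nonpos.1 h₂)
      rw [abs_of_nonpos (D.nonpos_iV u)] at h
      have h' : toI (1 - (s : ℝ) * ((1 + D.c (iV u)) / 2)) = 1 := by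
        rw [show 1 + D.c (iV u) = 0 by linarith]; norm_num [toI_one]
      exact (congrArg (w.1 _) h').trans (Path.target _))
  have N_collar : ∀ s u (h : |D.c (iV u)| ≤ 1), N (s, u) =
      w.1 (D.pA ⟨iV u, h⟩) (toI (1 - s * ((1 + D.c (iV u)) / 2))) :=
    fun s u h => glue_of_nonneg (b := b) (y := (s, u)) (sub_nonneg.2 h)
  have N_outside : ∀ s u, 1 ≤ |D.c (iV u)| → N (s, u) = z :=
    fun s u h => glue_of_nonpos (b := b) (y := (s, u)) (sub_nonpos.2 h)
  refine ⟨N, ⟨fun u => ?_, fun u => ?_, fun s u hu => ?_⟩, fun s a => ?_⟩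
  · rcases le_total |D.c (iV u)| 1 with h | h
    · rw [N_collar _ _ h, Set.Icc.coe_zero, zero_mul, sub_zero, toI_one, Path.target]
    · exact N_outside _ _ h
  · rcases le_total |D.c (iV u)| 1 with h | h
    · rw [N_collar _ _ h, Set.Icc.coe_one, one_mul, Function.comp, D.suspendMap_collar _ _ h]
      congr 2
      ring
    · rw [N_outside _ _ h, Function.comp, D.suspendMap_outside _ _ h]
  · rcases le_total |D.c (iV u)| 1 with h | h
    · rw [N_collar _ _ h, w.2 _ (D.pA_mem _ h ((D.memV u).1 hu))]
      rfl
    · exact N_outside _ _ h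
  · have hc : D.c (iV (jV a)) = 0 := by rw [← D.comm]; exact D.c_iA a
    have h : |D.c (iV (jV a))| ≤ 1 := by rw [hc]; norm_num
    have ha : D.pA ⟨iV (jV a), h⟩ = a := by
      have h' : |D.c (iU (jU a))| ≤ 1 := by rw [D.comm]; exact h
      exact (congrArg D.pA (Subtype.ext (D.comm a).symm)).trans (D.pA_iA a h')
    rw [N_collar _ _ h, ha, hc, add_zero, mul_one_div]

/-- Let `P` and `Q` be the standard null-homotopies of the suspension over `U` and `V`, and `H` one
over all of `X`. Over `A` the family `w` is `P Q⁻¹`, which is `P H⁻¹ + H Q⁻¹`; the first summand is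
defined over all of `U` and the second over all of `V`. -/
theorem exists_of_susp_eq_const (w : LoopClass A₀ z)
    (hw : D.susp w = PairClass.const X₀ z) :
    ∃ (a : LoopClass U₀ z) (b : LoopClass V₀ z),
      w = PairClass.pre jU D.mapsTo_jU a + PairClass.pre jV D.mapsTo_jV b := by
  induction w using Quotient.inductionOn with | h w =>
  obtain ⟨H, H0, H1, HX⟩ := PairClass.exists_homotopy_of_mk_eq hw.symm
  have hH : IsNullHomotopy X₀ z H (D.suspendMap w).1 := ⟨H0, H1, HX⟩
  obtain ⟨P, hP, hPA⟩ := D.exists_nullHomotopy_suspend_inl w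
  obtain ⟨Q, hQ, hQA⟩ := D.exists_nullHomotopy_suspend_inr w
  refine ⟨doubleLoopClass hP (hH.comp iU D.mapsTo_iU),
    doubleLoopClass (hH.comp iV D.mapsTo_iV) hQ, ?_⟩
  have hA := hH.comp (iU.comp jU) (D.mapsTo_iU.comp D.mapsTo_jU)
  refine Eq.trans ?_ ((doubleLoopClass_add (D.isNullHomotopy_inl hP) hA
    (D.isNullHomotopy_inr hQ)).symm.trans ?_)
  -- Over `A`, `P` is the first half of the loop and `Q` the second half reversed, so their double
  -- loop is `w` on the nose.
  · refine congrArg (Quotient.mk _) (Subtype.ext (ContinuousMap.ext fun a => ?_))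
    ext t
    rw [doubleLoop_apply]
    unfold thereAndBack
    split_ifs with h
    · change _ = P (toI (2 * (t : ℝ)), jU a)
      rw [hPA, coe_toI (mul_nonneg zero_le_two t.2.1) h, mul_div_cancel_left₀ _ two_ne_zero, toI_coe]
    · change _ = Q (toI (2 - 2 * (t : ℝ)), jV a)
      have ht : (t : ℝ) ≤ 1 := t.2.2
      rw [hQA, coe_toI (by linarith) (by linarith), sub_div,
        mul_div_cancel_left₀ _ two_ne_zero, div_self two_ne_zero, sub_sub_cancel, toI_coe]
  · refine congrArg₂ (· + ·) rfl ?_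
    refine congrArg (Quotient.mk _) (Subtype.ext (ContinuousMap.ext fun a => ?_))
    ext t
    rw [doubleLoop_apply]
    change _ = thereAndBack _ _ (2 * (t : ℝ)) (jV a)
    unfold thereAndBack
    split_ifs with h
    · exact congrArg (fun x => H (_, x)) (D.comm a)
    · rfl

end BicollaredCover

/-! ### Exactness of the Mayer–Vietoris sequence -/

namespace BicollaredCover

variable {X U V A : Type*} [TopologicalSpace X] [TopologicalSpace U]
    [TopologicalSpace V] [TopologicalSpace A] {X₀ : Set X} {U₀ : Set U} {V₀ : Set V} {A₀ : Set A}
    {iU : C(U, X)} {iV : C(V, X)} {jU : C(A, U)} {jV : C(A, V)}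
    (D : BicollaredCover X₀ U₀ V₀ A₀ iU iV jU jV)
    {Z : Type*} [TopologicalSpace Z] {z : Z}

/-- A family of loops over `U` is itself a null-homotopy over `U` of the constant map, since loops
begin and end at the basepoint. Together with the constant null-homotopy over `V`, `susp_doubleLoop`
identifies the suspension with the constant map. -/
theorem susp_pre_inl (a : LoopClass U₀ z) :
    D.susp (PairClass.pre jU D.mapsTo_jU a) = PairClass.const X₀ z := by
  induction a using Quotient.inductionOn with | h f =>
  let HU : C(I × U, Z) := ⟨fun q => f.1 q.2 q.1, by
    have h : Continuous fun q : I × U => f.1 q.2 := by fun_prop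
    exact h.eval continuous_fst⟩
  let g : PairMap X₀ z := ⟨.const X z, fun _ _ => rfl⟩
  have hU : IsNullHomotopy U₀ z HU (g.1 ∘ iU) :=
    ⟨fun u => (f.1 u).source, fun u => (f.1 u).target, fun t u hu => by
      change f.1 u t = z
      rw [f.2 u hu]
      rfl⟩
  have hV : IsNullHomotopy V₀ z (.const _ z) (g.1 ∘ iV) :=
    ⟨fun _ => rfl, fun _ => rfl, fun _ _ _ => rfl⟩
  refine Eq.trans (congrArg D.susp ?_) (D.susp_doubleLoop g hU hV)
  -- The double loop spends its second half at the basepoint, so it is literally the concatenation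
  -- with the constant loop.
  refine Eq.trans (add_zero _).symm ?_
  refine congrArg (Quotient.mk _) (Subtype.ext (ContinuousMap.ext fun a => ?_))
  ext t
  rw [doubleLoop_apply]
  change ((f.1 (jU a)).trans (Path.refl z)) t = _
  rw [Path.trans_apply]
  unfold thereAndBack
  by_cases h : (t : ℝ) ≤ 1 / 2
  · rw [dif_pos h, if_pos (by linarith)]
    change _ = f.1 (jU a) (toI (2 * (t : ℝ)))
    congr 1
    exact Subtype.ext (coe_toI (mul_nonneg zero_le_two t.2.1) (by linarith)).symm
  · rw [dif_neg h, if_neg (by linarith)]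
    rfl

/-- The double loop runs through the null-homotopy over `V` backwards, so the method of
`susp_pre_inl` yields the inverse loops. The sign is kept because `susp` is additive only for double
loops. -/
theorem susp_neg_pre_inr (b : LoopClass V₀ z) :
    D.susp (-PairClass.pre jV D.mapsTo_jV b) = PairClass.const X₀ z := by
  induction b using Quotient.inductionOn with | h f =>
  let HV : C(I × V, Z) := ⟨fun q => f.1 q.2 q.1, by
    have h : Continuous fun q : I × V => f.1 q.2 := by fun_prop
    exact h.eval continuous_fst⟩
  let g : PairMap X₀ z := ⟨.const X z, fun _ _ => rfl⟩
  have hV : IsNullHomotopy V₀ z HV (g.1 ∘ iV) :=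
    ⟨fun u => (f.1 u).source, fun u => (f.1 u).target, fun t u hu => by
      change f.1 u t = z
      rw [f.2 u hu]
      rfl⟩
  have hU : IsNullHomotopy U₀ z (.const _ z) (g.1 ∘ iU) :=
    ⟨fun _ => rfl, fun _ => rfl, fun _ _ _ => rfl⟩
  refine Eq.trans (congrArg D.susp ?_) (D.susp_doubleLoop g hU hV)
  refine Eq.trans (zero_add _).symm ?_
  refine congrArg (Quotient.mk _) (Subtype.ext (ContinuousMap.ext fun a => ?_))
  ext t
  rw [doubleLoop_apply]
  change ((Path.refl z).trans (f.1 (jV a)).symm) t = _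
  rw [Path.trans_apply]
  unfold thereAndBack
  have ht : (t : ℝ) ≤ 1 := t.2.2
  by_cases h : (t : ℝ) ≤ 1 / 2
  · rw [dif_pos h, if_pos (by linarith)]
    rfl
  · rw [dif_neg h, if_neg (by linarith)]
    change _ = f.1 (jV a) (toI (2 - 2 * (t : ℝ)))
    rw [Path.symm_apply]
    refine congrArg (f.1 (jV a)) (Subtype.ext ?_)
    rw [coe_toI (by linarith) (by linarith)]
    simp only [unitInterval.coe_symm_eq]
    ring

/-- Maps on `U` and `V` whose restrictions to `A` are homotopic come from a map on `X`. -/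
theorem exists_of_pre_eq (a : PairClass U₀ z) (b : PairClass V₀ z)
    (h : PairClass.pre jU D.mapsTo_jU a = PairClass.pre jV D.mapsTo_jV b) :
    ∃ g : PairClass X₀ z, PairClass.pre iU D.mapsTo_iU g = a ∧
      PairClass.pre iV D.mapsTo_iV g = b := by
  induction a using Quotient.inductionOn with | h f =>
  induction b using Quotient.inductionOn with | h g =>
  obtain ⟨K, K0, K1, KA⟩ := PairClass.exists_homotopy_of_mk_eq h
  replace K0 : ∀ a, K (0, a) = f.1 (jU a) := K0
  replace K1 : ∀ a, K (1, a) = g.1 (jV a) := K1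
  let b : C(I × V, ℝ) := ⟨fun q => 1 - |D.c (iV q.2)|, by fun_prop⟩
  -- `L` deforms `g`, already pushed by `pV`, within `V` so that its values over `A` become those of
  -- `f`. The homotopy `K` is undone fully at `c = 0` and not at all at `c = -1`, where `L` joins
  -- the unchanged map.
  let L : C(I × V, Z) := glue b
    ⟨fun q => K (toI (1 - q.1.1 * (1 + D.c (iV q.1.2))), D.pA ⟨iV q.1.2, sub_nonneg.1 q.2⟩),
      by fun_prop⟩
    ⟨fun q => g.1 (D.pV (1, ⟨iV q.1.2, D.nonpos_iV _⟩)), by fun_prop⟩ (by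
      rintro ⟨s, v⟩ h₁ h₂
      have h : |D.c (iV v)| = 1 := le_antisymm (sub_nonneg.1 h₁) (sub_nonpos.1 h₂)
      have hc := h
      rw [abs_of_nonpos (D.nonpos_iV v)] at hc
      change K (toI (1 - s * (1 + D.c (iV v))), D.pA ⟨iV v, h.le⟩) =
        g.1 (D.pV (1, ⟨iV v, D.nonpos_iV _⟩))
      have h' : toI (1 - (s : ℝ) * (1 + D.c (iV v))) = 1 := by
        rw [show 1 + D.c (iV v) = 0 by linarith]; norm_num [toI_one]
      rw [h', K1, D.pV_one _ _ h.le])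
  have L_collar : ∀ s v (h : |D.c (iV v)| ≤ 1), L (s, v) =
      K (toI (1 - s * (1 + D.c (iV v))), D.pA ⟨iV v, h⟩) :=
    fun s v h => glue_of_nonneg (b := b) (y := (s, v)) (sub_nonneg.2 h)
  have L_outside : ∀ s v, 1 ≤ |D.c (iV v)| → L (s, v) =
      g.1 (D.pV (1, ⟨iV v, D.nonpos_iV _⟩)) :=
    fun s v h => glue_of_nonpos (b := b) (y := (s, v)) (sub_nonpos.2 h)
  have L0 : ∀ v, L (0, v) = g.1 (D.pV (1, ⟨iV v, D.nonpos_iV _⟩)) := by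
    intro v
    rcases le_total |D.c (iV v)| 1 with h | h
    · rw [L_collar _ _ h, Set.Icc.coe_zero, zero_mul, sub_zero, toI_one, K1, D.pV_one _ _ h]
    · exact L_outside _ _ h
  have LV : ∀ s, ∀ v ∈ V₀, L (s, v) = z := by
    intro s v hv
    rcases le_total |D.c (iV v)| 1 with h | h
    · rw [L_collar _ _ h]
      exact KA _ _ (D.pA_mem _ h ((D.memV v).1 hv))
    · rw [L_outside _ _ h]
      exact g.2 _ (D.pV_mem 1 _ _ ((D.memV v).1 hv))
  -- At time `0` the deformation is the identity, so `D.pV (0, ·)` is just the continuous inverse of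
  -- `iV` on its range.
  let k : C(X, Z) := glue D.c ⟨fun x => f.1 (D.pU (1, x)), by fun_prop⟩
    ⟨fun x => L (1, D.pV (0, x)), by fun_prop⟩ (by
      intro x h₁ h₂
      have hc : D.c x = 0 := le_antisymm h₂ h₁
      have hx : iV (D.pV (0, ⟨x, h₂⟩)) = x := by rw [D.iV_pV, D.p_zero]
      have h' : |D.c x| ≤ 1 := by rw [hc]; norm_num
      have h : |D.c (iV (D.pV (0, ⟨x, h₂⟩)))| ≤ 1 := by rwa [hx]
      change f.1 (D.pU (1, ⟨x, h₁⟩)) = L (1, D.pV (0, ⟨x, h₂⟩))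
      have h0 : toI (1 - ((1 : I) : ℝ) * (1 + D.c (iV (D.pV (0, ⟨x, h₂⟩))))) = 0 := by
        rw [hx, hc]; norm_num [toI_zero]
      rw [L_collar _ _ h, h0, K0, D.pU_one _ _ h']
      exact congrArg (fun y => f.1 (jU (D.pA y))) (Subtype.ext hx.symm))
  have kU : ∀ u, k (iU u) = f.1 (D.pU (1, ⟨iU u, D.nonneg_iU u⟩)) :=
    fun u => glue_of_nonneg (b := D.c) (D.nonneg_iU u)
  have kV : ∀ v, k (iV v) = L (1, v) := fun v =>
    (glue_of_nonpos (b := D.c) (D.nonpos_iV v)).trans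
      (congrArg (fun v => L (1, v)) (D.pV_zero v))
  have kX : ∀ x ∈ X₀, k x = z := by
    intro x hx
    rcases le_total 0 (D.c x) with hc | hc
    · obtain ⟨u, rfl⟩ := (D.rangeU x).2 hc
      rw [kU]
      exact f.2 _ (D.pU_mem 1 _ _ hx)
    · obtain ⟨v, rfl⟩ := (D.rangeV x).2 hc
      rw [kV]
      exact LV 1 v ((D.memV v).2 hx)
  refine ⟨Quotient.mk _ ⟨k, kX⟩, ?_, ?_⟩
  · refine Eq.symm (PairClass.mk_eq_of_homotopy (g := ⟨k.comp iU, fun u hu => kX _ ?_⟩)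
      ⟨fun q => f.1 (D.pU (q.1, ⟨iU q.2, D.nonneg_iU q.2⟩)), by fun_prop⟩ (fun u => ?_)
      (fun u => (kU u).symm) (fun s u hu => f.2 _ (D.pU_mem s _ _ ((D.memU u).1 hu))))
    · exact (D.memU u).1 hu
    · exact congrArg f.1 (D.pU_zero u)
  · have h1 : (Quotient.mk _ g : PairClass V₀ z) =
        Quotient.mk _ ⟨⟨fun v => L (0, v), by fun_prop⟩, LV 0⟩ :=
      PairClass.mk_eq_of_homotopy
        ⟨fun q => g.1 (D.pV (q.1, ⟨iV q.2, D.nonpos_iV q.2⟩)), by fun_prop⟩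
        (fun v => congrArg g.1 (D.pV_zero v)) (fun v => (L0 v).symm)
        (fun s v hv => g.2 _ (D.pV_mem s _ _ ((D.memV v).1 hv)))
    rw [h1]
    exact Eq.symm (PairClass.mk_eq_of_homotopy (g := ⟨k.comp iV, fun v hv => kX _
      ((D.memV v).1 hv)⟩) L (fun v => rfl) (fun v => (kV v).symm) LV)

variable (F : OmegaSpectrum.{v}) (n : ℤ)

/-- The Mayer-Vietoris connecting homomorphism. -/
def connecting : F.coh n A A₀ →+ F.coh (n + 1) X X₀ :=
  AddMonoidHom.mk' (fun a => D.susp (F.toLoop n A₀ a)) fun a b => by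
    -- By naturality the sum in degree `n + 1` is computed after looping the next structure map, on
    -- families of double loops, where `susp_add` applies.
    have h : ∀ a : LoopClass A₀ (F.pt (n + 1)), F.toLoop (n + 1) X₀ (D.susp a) =
        D.susp (a.post (loopMap (F.equiv (n + 1)).toFun (F.equiv (n + 1)).map_pt)
          (loopMap_refl _ _)) := fun a => D.susp_post _ _ a
    apply (F.toLoop (n + 1) X₀).injective
    rw [F.toLoop_add n, h, LoopClass.post_loopMap_add, susp_add]
    refine Eq.trans ?_ (F.toLoop_add (n + 1) X₀ _ _).symm
    rw [h, h]

theorem connecting_apply (a : F.coh n A A₀) : D.connecting F n a = D.susp (F.toLoop n A₀ a) := rfl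

theorem connecting_toLoop_symm (a : LoopClass A₀ (F.pt (n + 1))) :
    D.connecting F n ((F.toLoop n A₀).symm a) = D.susp a := by
  rw [connecting_apply, Equiv.apply_symm_apply]

theorem isMayerVietorisConnecting_connecting :
    F.IsMayerVietorisConnecting n X₀ U₀ V₀ A₀ iU iV jU jV (D.connecting F n) := by
  intro g HU HV HU0 HU1 HUb HV0 HV1 HVb w hw
  have hU : IsNullHomotopy U₀ (F.pt (n + 1)) HU (g.1 ∘ iU) := ⟨HU0, HU1, HUb⟩
  have hV : IsNullHomotopy V₀ (F.pt (n + 1)) HV (g.1 ∘ iV) := ⟨HV0, HV1, HVb⟩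
  refine (D.connecting_toLoop_symm F n (Quotient.mk _ w)).trans
    (Eq.trans ?_ (D.susp_doubleLoop g hU hV))
  refine congrArg D.susp (congrArg (Quotient.mk _) (Subtype.ext (ContinuousMap.ext fun a => ?_)))
  ext t
  rw [hw, doubleLoop_apply]
  unfold thereAndBack
  by_cases h : (t : ℝ) ≤ 1 / 2
  · rw [if_pos h, if_pos (by linarith)]
    rfl
  · rw [if_neg h, if_neg (by linarith)]
    rfl

/-- The restriction `hⁿ(X) → hⁿ(U) ⊕ hⁿ(V)`. -/
def restrict : F.coh n X X₀ →+ F.coh n U U₀ × F.coh n V V₀ :=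
  (F.pullback n iU D.mapsTo_iU).prod (F.pullback n iV D.mapsTo_iV)

/-- The difference of the restrictions `hⁿ(U) ⊕ hⁿ(V) → hⁿ(A)`. -/
def difference : F.coh n U U₀ × F.coh n V V₀ →+ F.coh n A A₀ :=
  (F.pullback n jU D.mapsTo_jU).comp (AddMonoidHom.fst _ _) -
    (F.pullback n jV D.mapsTo_jV).comp (AddMonoidHom.snd _ _)

theorem difference_apply (a : F.coh n U U₀) (b : F.coh n V V₀) :
    D.difference F n (a, b) = F.pullback n jU D.mapsTo_jU a - F.pullback n jV D.mapsTo_jV b := rfl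

theorem exact_restrict_difference :
    Function.Exact (D.restrict F n) (D.difference F n) := by
  rintro ⟨a, b⟩
  rw [difference_apply, sub_eq_zero]
  constructor
  · intro h
    obtain ⟨g, hga, hgb⟩ := D.exists_of_pre_eq a b h
    exact ⟨g, Prod.ext hga hgb⟩
  · rintro ⟨g, hg⟩
    obtain ⟨rfl, rfl⟩ := Prod.ext_iff.1 hg
    refine (F.pullback_comp_apply n iU D.mapsTo_iU jU D.mapsTo_jU g).trans
      (Eq.trans ?_ (F.pullback_comp_apply n iV D.mapsTo_iV jV D.mapsTo_jV g).symm)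
    exact F.pullback_congr n _ _ D.comm g

theorem exact_difference_connecting :
    Function.Exact (D.difference F n) (D.connecting F n) := by
  intro w
  constructor
  · intro h
    rw [connecting_apply, F.coh_zero] at h
    obtain ⟨a, b, hab⟩ := D.exists_of_susp_eq_const _ h
    -- The splitting is a sum whereas the map of the sequence is a difference; hence the sign on the
    -- second component.
    refine ⟨((F.toLoopHom n U₀).symm a, -(F.toLoopHom n V₀).symm b), ?_⟩
    rw [difference_apply, map_neg, sub_neg_eq_add]
    apply (F.toLoopHom n A₀).injective
    rw [map_add]
    refine Eq.trans ?_ hab.symm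
    refine congrArg₂ (· + ·) ?_ ?_
    · refine (F.toLoop_pullback n jU D.mapsTo_jU _).trans (congrArg _ ?_)
      exact (F.toLoop n U₀).apply_symm_apply a
    · refine (F.toLoop_pullback n jV D.mapsTo_jV _).trans (congrArg _ ?_)
      exact (F.toLoop n V₀).apply_symm_apply b
  · rintro ⟨⟨a, b⟩, rfl⟩
    rw [difference_apply, sub_eq_add_neg, map_add]
    have ha : D.connecting F n (F.pullback n jU D.mapsTo_jU a) = 0 := by
      rw [connecting_apply, F.toLoop_pullback, F.coh_zero]
      exact D.susp_pre_inl _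
    have hb : D.connecting F n (-F.pullback n jV D.mapsTo_jV b) = 0 := by
      rw [connecting_apply, F.coh_zero]
      have h : F.toLoop n A₀ (-F.pullback n jV D.mapsTo_jV b) =
          -PairClass.pre jV D.mapsTo_jV (F.toLoop n V₀ b) :=
        ((F.toLoopHom n A₀).map_neg _).trans
          (congrArg Neg.neg (F.toLoop_pullback n jV D.mapsTo_jV b))
      rw [h]
      exact D.susp_neg_pre_inr _
    rw [ha, hb, add_zero]

/-- Vanishing on `U` and on `V` provides two null-homotopies, and the loops they form over `A` are a
preimage by `susp_doubleLoop`. Conversely, suspensions carry explicit null-homotopies over `U` and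
`V`. -/
theorem exact_connecting_restrict :
    Function.Exact (D.connecting F n) (D.restrict F (n + 1)) := by
  intro g
  induction g using Quotient.inductionOn with | h g =>
  constructor
  · intro h
    obtain ⟨h1, h2⟩ := Prod.ext_iff.1 h
    obtain ⟨P, hP0, hP1, hPb⟩ := PairClass.exists_homotopy_of_mk_eq
      (((F.coh_zero (n + 1)).symm.trans h1.symm :
        PairClass.const U₀ (F.pt (n + 1)) = PairClass.pre iU D.mapsTo_iU (Quotient.mk _ g)))
    obtain ⟨Q, hQ0, hQ1, hQb⟩ := PairClass.exists_homotopy_of_mk_eq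
      (((F.coh_zero (n + 1)).symm.trans h2.symm :
        PairClass.const V₀ (F.pt (n + 1)) = PairClass.pre iV D.mapsTo_iV (Quotient.mk _ g)))
    have hU : IsNullHomotopy U₀ (F.pt (n + 1)) P (g.1 ∘ iU) := ⟨hP0, hP1, hPb⟩
    have hV : IsNullHomotopy V₀ (F.pt (n + 1)) Q (g.1 ∘ iV) := ⟨hQ0, hQ1, hQb⟩
    refine ⟨(F.toLoop n A₀).symm
      (doubleLoopClass (D.isNullHomotopy_inl hU) (D.isNullHomotopy_inr hV)), ?_⟩
    rw [connecting_apply, Equiv.apply_symm_apply]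
    exact D.susp_doubleLoop g hU hV
  · rintro ⟨w, hw⟩
    rw [← hw, connecting_apply]
    induction F.toLoop n A₀ w using Quotient.inductionOn with | h w =>
    obtain ⟨P, hP, -⟩ := D.exists_nullHomotopy_suspend_inl w
    obtain ⟨Q, hQ, -⟩ := D.exists_nullHomotopy_suspend_inr w
    refine Prod.ext ?_ ?_
    · exact Eq.symm ((F.coh_zero (n + 1)).trans
        (PairClass.mk_eq_of_homotopy P hP.zero hP.one hP.base))
    · exact Eq.symm ((F.coh_zero (n + 1)).trans
        (PairClass.mk_eq_of_homotopy Q hQ.zero hQ.one hQ.base))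

end BicollaredCover

/-! ### Continuous maps into `EΓ` -/

namespace MilnorE

variable {Γ : Type*} {Y : Type*} [TopologicalSpace Y]

theorem label_ne_none {x : MilnorE Γ} {i : ℕ} (h : x.weight i ≠ 0) : x.label i ≠ none :=
  fun h' => h ((x.label_eq_none i).1 h')

theorem label_smul [Group Γ] (g : Γ) (x : MilnorE Γ) (i : ℕ) :
    (g • x).label i = (x.label i).map (g * ·) := rfl

theorem relabel_id (x : MilnorE Γ) : relabel id x = x := by
  ext1
  · rfl
  · funext i
    exact Option.map_id_apply

theorem relabel_relabel {Γ' Γ'' : Type*} (f : Γ → Γ') (f' : Γ' → Γ'') (x : MilnorE Γ) :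
    relabel f' (relabel f x) = relabel (f' ∘ f) x := by
  ext1
  · rfl
  · funext i
    exact Option.map_map f' f _

section Continuity

variable [TopologicalSpace Γ]

theorem continuous_weight (i : ℕ) : Continuous fun x : MilnorE Γ => x.weight i :=
  continuous_iff_le_induced.2 (inf_le_left.trans (iInf_le _ i))

theorem isOpen_label (i : ℕ) {O : Set Γ} (hO : IsOpen O) :
    IsOpen {x : MilnorE Γ | ∃ g ∈ O, x.label i = some g} :=
  (inf_le_right : (_ ⊓ _ : TopologicalSpace (MilnorE Γ)) ≤ _) _
    (TopologicalSpace.isOpen_generateFrom_of_mem ⟨i, O, hO, rfl⟩)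

/-- Near `y`, the `i`-th label of `f` is defined and continuous at `y`. -/
def LabelAt (f : Y → MilnorE Γ) (i : ℕ) (y : Y) : Prop :=
  ∃ g : Y → Γ, ContinuousAt g y ∧ ∀ᶠ y' in nhds y, (f y').label i = some (g y')

theorem labelAt_of_continuous {f : Y → MilnorE Γ} (hf : Continuous f) {i : ℕ} {y : Y}
    (h : (f y).weight i ≠ 0) : LabelAt f i y := by
  obtain ⟨g₀, hg₀⟩ := Option.ne_none_iff_exists'.1 (label_ne_none h)
  refine ⟨fun y' => ((f y').label i).getD g₀, ?_, ?_⟩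
  · intro O hO
    change O ∈ nhds (((f y).label i).getD g₀) at hO
    rw [hg₀, Option.getD_some] at hO
    obtain ⟨O', hO', hO'_open, hg⟩ := mem_nhds_iff.1 hO
    rw [Filter.mem_map]
    filter_upwards [((isOpen_label i hO'_open).preimage hf).mem_nhds ⟨g₀, hg, hg₀⟩]
    rintro y' ⟨g', hg', h'⟩
    change ((f y').label i).getD g₀ ∈ O
    rw [h']
    exact hO' hg'
  · filter_upwards [(((continuous_weight i).comp hf).continuousAt).eventually_ne h] with y' hy'
    obtain ⟨g', hg'⟩ := Option.ne_none_iff_exists'.1 (label_ne_none hy')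
    rw [hg', Option.getD_some]

/-- The topology of `EΓ` is the coarsest one with continuous weights and labels, so continuity is
tested one index at a time, and for labels only at points where the weight is nonzero. -/
theorem continuous_of_labelAt {f : Y → MilnorE Γ} (hw : ∀ i, Continuous fun y => (f y).weight i)
    (hl : ∀ i y, (f y).weight i ≠ 0 → LabelAt f i y) : Continuous f := by
  refine continuous_inf_rng.2 ⟨continuous_iInf_rng.2 fun i => continuous_induced_rng.2 (hw i),
    continuous_generateFrom_iff.2 ?_⟩
  rintro _ ⟨i, O, hO, rfl⟩
  refine isOpen_iff_mem_nhds.2 ?_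
  rintro y ⟨g₀, hg₀, h₀⟩
  obtain ⟨g, hg, h⟩ := hl i y (fun h' => by
    rw [((f y).label_eq_none i).2 h'] at h₀
    exact Option.some_ne_none _ h₀.symm)
  have hgy : g y = g₀ := Option.some_injective _ (h.self_of_nhds.symm.trans h₀)
  filter_upwards [h, hg (hO.mem_nhds (hgy ▸ hg₀))] with y' h' hy'
  exact ⟨g y', hy', h'⟩

theorem LabelAt.congr {f f' : Y → MilnorE Γ} {i j : ℕ} {y : Y} (h : LabelAt f i y)
    (hff' : ∀ᶠ y' in nhds y, (f' y').label j = (f y').label i) : LabelAt f' j y := by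
  obtain ⟨g, hg, h⟩ := h
  refine ⟨g, hg, ?_⟩
  filter_upwards [h, hff'] with y' h1 h2
  rw [h2, h1]

instance [Group Γ] [ContinuousConstSMul Γ Γ] : ContinuousConstSMul Γ (MilnorE Γ) :=
  ⟨fun g => continuous_relabel (continuous_const_smul g)⟩

end Continuity

/-- The point of `EΓ` with weights `w` and labels `l`. -/
def mk' (w : ℕ →₀ ℝ) (nonneg : ∀ i, 0 ≤ w i) (sum_eq_one : (w.sum fun _ t => t) = 1)
    (l : ℕ → Option Γ) (hl : ∀ i, w i ≠ 0 → l i ≠ none) : MilnorE Γ where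
  weight := w
  nonneg := nonneg
  sum_eq_one := sum_eq_one
  label i := if w i = 0 then none else l i
  label_eq_none i := by
    by_cases h : w i = 0
    · simp [h]
    · simp [h, hl i h]

theorem ext_of_ne_zero {x y : MilnorE Γ} (hw : ∀ i, x.weight i = y.weight i)
    (hl : ∀ i, x.weight i ≠ 0 → x.label i = y.label i) : x = y := by
  have hw' : x.weight = y.weight := Finsupp.ext hw
  refine MilnorE.ext hw' (funext fun i => ?_)
  by_cases h : x.weight i = 0
  · rw [(x.label_eq_none i).2 h, (y.label_eq_none i).2 (by rw [← hw, h])]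
  · exact hl i h

/-! ### Interleaving two points of `EΓ` -/

/-- The weights `(1 - s) w` at the even and `s w'` at the odd indices. -/
def weave (s : ℝ) (w w' : ℕ →₀ ℝ) : ℕ →₀ ℝ :=
  ((1 - s) • w).mapDomain (fun i => 2 * i) + (s • w').mapDomain (fun i => 2 * i + 1)

theorem weave_even (s : ℝ) (w w' : ℕ →₀ ℝ) (i : ℕ) : weave s w w' (2 * i) = (1 - s) * w i := by
  rw [weave, Finsupp.add_apply, Finsupp.mapDomain_apply (f := fun i => 2 * i)
    (fun a b h => by simpa using h), Finsupp.mapDomain_of_notMem_range]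
  · simp
  · rintro ⟨j, hj⟩
    simp only at hj
    omega

theorem weave_odd (s : ℝ) (w w' : ℕ →₀ ℝ) (i : ℕ) : weave s w w' (2 * i + 1) = s * w' i := by
  rw [weave, Finsupp.add_apply, Finsupp.mapDomain_apply (f := fun i => 2 * i + 1)
    (fun a b h => by simpa using h), Finsupp.mapDomain_of_notMem_range]
  · simp
  · rintro ⟨j, hj⟩
    simp only at hj
    omega

theorem sum_weave (s : ℝ) {w w' : ℕ →₀ ℝ} (hw : (w.sum fun _ t => t) = 1)
    (hw' : (w'.sum fun _ t => t) = 1) : ((weave s w w').sum fun _ t => t) = 1 := by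
  have h : ∀ (c : ℝ) (w : ℕ →₀ ℝ), (w.sum fun _ t => t) = 1 →
      ((c • w).sum fun _ t => t) = c := fun c w hw => by
    rw [Finsupp.sum_smul_index (fun _ => rfl), ← Finsupp.mul_sum, hw, mul_one]
  rw [weave, Finsupp.sum_add_index' (fun _ => rfl) (fun _ _ _ => rfl),
    Finsupp.sum_mapDomain_index (fun _ => rfl) (fun _ _ _ => rfl),
    Finsupp.sum_mapDomain_index (fun _ => rfl) (fun _ _ _ => rfl), h _ _ hw, h _ _ hw']
  ring

theorem weave_nonneg {s : ℝ} (h0 : 0 ≤ s) (h1 : s ≤ 1) {w w' : ℕ →₀ ℝ} (hw : ∀ i, 0 ≤ w i)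
    (hw' : ∀ i, 0 ≤ w' i) (i : ℕ) : 0 ≤ weave s w w' i := by
  obtain ⟨j, rfl | rfl⟩ := Nat.even_or_odd' i
  · rw [weave_even]
    exact mul_nonneg (sub_nonneg.2 h1) (hw j)
  · rw [weave_odd]
    exact mul_nonneg h0 (hw' j)

/-- The labels `l` at the even and `l'` at the odd indices. -/
def weaveLabel {α : Type*} (l l' : ℕ → α) (i : ℕ) : α := if i % 2 = 0 then l (i / 2) else l' (i / 2)

theorem weaveLabel_even {α : Type*} (l l' : ℕ → α) (i : ℕ) : weaveLabel l l' (2 * i) = l i := by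
  simp [weaveLabel]

theorem weaveLabel_odd {α : Type*} (l l' : ℕ → α) (i : ℕ) :
    weaveLabel l l' (2 * i + 1) = l' i := by
  rw [weaveLabel, if_neg (by omega)]
  congr 1
  omega

/-- The point `(1 - s) x + s y`, with `x` moved to the even and `y` to the odd indices. -/
def interleave (s : I) (x y : MilnorE Γ) : MilnorE Γ :=
  mk' (weave s x.weight y.weight) (weave_nonneg s.2.1 s.2.2 x.nonneg y.nonneg)
    (sum_weave s x.sum_eq_one y.sum_eq_one) (weaveLabel x.label y.label) (by
      intro i hi
      obtain ⟨j, rfl | rfl⟩ := Nat.even_or_odd' i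
      · rw [weave_even] at hi
        rw [weaveLabel_even]
        exact label_ne_none (right_ne_zero_of_mul hi)
      · rw [weave_odd] at hi
        rw [weaveLabel_odd]
        exact label_ne_none (right_ne_zero_of_mul hi))

theorem interleave_weight_even (s : I) (x y : MilnorE Γ) (i : ℕ) :
    (interleave s x y).weight (2 * i) = (1 - s) * x.weight i := weave_even _ _ _ _

theorem interleave_weight_odd (s : I) (x y : MilnorE Γ) (i : ℕ) :
    (interleave s x y).weight (2 * i + 1) = s * y.weight i := weave_odd _ _ _ _

theorem interleave_label_even {s : I} {x y : MilnorE Γ} {i : ℕ}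
    (h : (interleave s x y).weight (2 * i) ≠ 0) :
    (interleave s x y).label (2 * i) = x.label i := (if_neg h).trans (weaveLabel_even _ _ _)

theorem interleave_label_odd {s : I} {x y : MilnorE Γ} {i : ℕ}
    (h : (interleave s x y).weight (2 * i + 1) ≠ 0) :
    (interleave s x y).label (2 * i + 1) = y.label i := (if_neg h).trans (weaveLabel_odd _ _ _)

/-- At `s = 0` the odd indices carry no weight. This is where the second point can be exchanged for
another. -/
theorem interleave_zero (x y y' : MilnorE Γ) : interleave 0 x y = interleave 0 x y' := by
  refine ext_of_ne_zero (fun i => ?_) (fun i hi => ?_)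
  · obtain ⟨j, rfl | rfl⟩ := Nat.even_or_odd' i
    · rw [interleave_weight_even, interleave_weight_even]
    · simp [interleave_weight_odd]
  · obtain ⟨j, rfl | rfl⟩ := Nat.even_or_odd' i
    · rw [interleave_label_even hi, interleave_label_even]
      rwa [interleave_weight_even] at hi ⊢
    · simp [interleave_weight_odd] at hi

theorem interleave_smul [Group Γ] (g : Γ) (s : I) (x y : MilnorE Γ) :
    interleave s (g • x) (g • y) = g • interleave s x y := by
  refine ext_of_ne_zero (fun i => rfl) (fun i hi => ?_)
  rw [label_smul]
  obtain ⟨j, rfl | rfl⟩ := Nat.even_or_odd' i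
  · rw [interleave_label_even hi, interleave_label_even (x := x) (y := y) hi, label_smul]
  · rw [interleave_label_odd hi, interleave_label_odd (x := x) (y := y) hi, label_smul]

theorem continuous_interleave [TopologicalSpace Γ] :
    Continuous fun q : I × (MilnorE Γ × MilnorE Γ) => interleave q.1 q.2.1 q.2.2 := by
  have c1 : Continuous fun q : I × (MilnorE Γ × MilnorE Γ) => q.2.1 := by fun_prop
  have c2 : Continuous fun q : I × (MilnorE Γ × MilnorE Γ) => q.2.2 := by fun_prop
  have hw : ∀ i, Continuous fun q : I × (MilnorE Γ × MilnorE Γ) =>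
      (interleave q.1 q.2.1 q.2.2).weight i := by
    intro i
    obtain ⟨j, rfl | rfl⟩ := Nat.even_or_odd' i
    · simp_rw [interleave_weight_even]
      exact (by fun_prop : Continuous fun q : I × (MilnorE Γ × MilnorE Γ) =>
        1 - (q.1 : ℝ)).mul ((continuous_weight j).comp c1)
    · simp_rw [interleave_weight_odd]
      exact (by fun_prop : Continuous fun q : I × (MilnorE Γ × MilnorE Γ) =>
        (q.1 : ℝ)).mul ((continuous_weight j).comp c2)
  refine continuous_of_labelAt hw fun i q hq => ?_
  have hq' := (hw i).continuousAt.eventually_ne hq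
  obtain ⟨j, rfl | rfl⟩ := Nat.even_or_odd' i
  · rw [interleave_weight_even] at hq
    refine (labelAt_of_continuous c1 (right_ne_zero_of_mul hq)).congr ?_
    filter_upwards [hq'] with q' h
    exact interleave_label_even h
  · rw [interleave_weight_odd] at hq
    refine (labelAt_of_continuous c2 (right_ne_zero_of_mul hq)).congr ?_
    filter_upwards [hq'] with q' h
    exact interleave_label_odd h

/-! ### Moving all indices to odd indices -/

/-- The fraction of the `i`-th weight that has returned from the index `2 i + 1` at time `s`. -/
def stage (s : I) (i : ℕ) : ℝ := max 0 (min 1 ((i + 2) * ((i + 1) * s - i)))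

theorem stage_nonneg (s : I) (i : ℕ) : 0 ≤ stage s i := le_max_left _ _

theorem stage_le_one (s : I) (i : ℕ) : stage s i ≤ 1 := max_le zero_le_one (min_le_left _ _)

theorem continuous_stage (i : ℕ) : Continuous fun s => stage s i := by
  unfold stage
  fun_prop

theorem stage_zero (i : ℕ) : stage 0 i = 0 := by
  refine max_eq_left (min_le_of_right_le ?_)
  rw [Set.Icc.coe_zero, mul_zero, zero_sub]
  exact mul_nonpos_of_nonneg_of_nonpos (by positivity) (neg_nonpos.2 (Nat.cast_nonneg i))

theorem stage_one (i : ℕ) : stage 1 i = 1 := by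
  rw [stage, min_eq_left, max_eq_right zero_le_one]
  rw [Set.Icc.coe_one]
  linarith [(Nat.cast_nonneg i : (0 : ℝ) ≤ i)]

/-- Index `i` returns during the time interval from `i / (i + 1)` to `(i + 1) / (i + 2)`; this is
the origin of the constants in `stage`. The intervals are consecutive, so once `j` has started every
smaller index has finished. -/
theorem stage_eq_one {s : I} {i j : ℕ} (h : stage s j ≠ 0) (hij : i < j) : stage s i = 1 := by
  have hi : (0 : ℝ) ≤ i := Nat.cast_nonneg i
  have hij' : (i : ℝ) + 1 ≤ j := by exact_mod_cast hij
  have hj : 0 < ((j : ℝ) + 1) * s - j := by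
    by_contra! h'
    refine h (max_eq_left (min_le_of_right_le ?_))
    exact mul_nonpos_of_nonneg_of_nonpos (by positivity) h'
  have h1 : ((i : ℝ) + 1) ≤ (i + 2) * s := by
    have h2 : (j : ℝ) * (1 - s) < s := by linarith
    have h3 : (i + 1 : ℝ) * (1 - s) ≤ j * (1 - s) :=
      mul_le_mul_of_nonneg_right hij' (sub_nonneg.2 s.2.2)
    linarith
  have h4 : (1 : ℝ) ≤ (i + 2) * ((i + 1) * s - i) := by
    have := mul_le_mul_of_nonneg_left h1 (by positivity : (0 : ℝ) ≤ i + 1)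
    linarith
  rw [stage, min_eq_left h4, max_eq_right zero_le_one]

/-- The part of the weights at its place at time `s`. -/
def stayWeight (s : I) (x : MilnorE Γ) : ℕ →₀ ℝ :=
  Finsupp.onFinset x.weight.support (fun i => stage s i * x.weight i) fun _ h =>
    Finsupp.mem_support_iff.2 (right_ne_zero_of_mul h)

/-- The part of the weights that is moved at time `s`. -/
def moveWeight (s : I) (x : MilnorE Γ) : ℕ →₀ ℝ :=
  Finsupp.onFinset x.weight.support (fun i => (1 - stage s i) * x.weight i) fun _ h =>
    Finsupp.mem_support_iff.2 (right_ne_zero_of_mul h)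

/-- The weights of `spread s x`. -/
def spreadWeight (s : I) (x : MilnorE Γ) : ℕ →₀ ℝ :=
  stayWeight s x + (moveWeight s x).mapDomain (fun i => 2 * i + 1)

theorem spreadWeight_even (s : I) (x : MilnorE Γ) (i : ℕ) :
    spreadWeight s x (2 * i) = stage s (2 * i) * x.weight (2 * i) := by
  rw [spreadWeight, Finsupp.add_apply, Finsupp.mapDomain_of_notMem_range, add_zero]
  · rfl
  · rintro ⟨j, hj⟩
    simp only at hj
    omega

theorem spreadWeight_odd (s : I) (x : MilnorE Γ) (i : ℕ) :
    spreadWeight s x (2 * i + 1) =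
      stage s (2 * i + 1) * x.weight (2 * i + 1) + (1 - stage s i) * x.weight i := by
  rw [spreadWeight, Finsupp.add_apply, Finsupp.mapDomain_apply (f := fun i => 2 * i + 1)
    (fun a b h => by simpa using h)]
  rfl

theorem stay_nonneg (s : I) (x : MilnorE Γ) (i : ℕ) : 0 ≤ stage s i * x.weight i :=
  mul_nonneg (stage_nonneg s i) (x.nonneg i)

theorem move_nonneg (s : I) (x : MilnorE Γ) (i : ℕ) : 0 ≤ (1 - stage s i) * x.weight i :=
  mul_nonneg (sub_nonneg.2 (stage_le_one s i)) (x.nonneg i)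

theorem spreadWeight_nonneg (s : I) (x : MilnorE Γ) (i : ℕ) : 0 ≤ spreadWeight s x i := by
  obtain ⟨j, rfl | rfl⟩ := Nat.even_or_odd' i
  · rw [spreadWeight_even]
    exact stay_nonneg s x _
  · rw [spreadWeight_odd]
    exact add_nonneg (stay_nonneg s x _) (move_nonneg s x _)

theorem sum_spreadWeight (s : I) (x : MilnorE Γ) :
    ((spreadWeight s x).sum fun _ t => t) = 1 := by
  rw [spreadWeight, Finsupp.sum_add_index' (fun _ => rfl) (fun _ _ _ => rfl),
    Finsupp.sum_mapDomain_index (fun _ => rfl) (fun _ _ _ => rfl), stayWeight, moveWeight,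
    Finsupp.onFinset_sum _ (fun _ => rfl), Finsupp.onFinset_sum _ (fun _ => rfl),
    ← Finset.sum_add_distrib]
  refine Eq.trans ?_ x.sum_eq_one
  exact Finset.sum_congr rfl fun i _ => by ring

/-- A homotopy of maps `EΓ → EΓ` from the map that moves every index `i` to `2 i + 1` to the
identity. The indices move back one after the other. -/
def spread (s : I) (x : MilnorE Γ) : MilnorE Γ :=
  mk' (spreadWeight s x) (spreadWeight_nonneg s x) (sum_spreadWeight s x)
    (fun i => if stage s i * x.weight i ≠ 0 then x.label i else x.label (i / 2)) (by
      intro i hi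
      split_ifs with h
      · exact label_ne_none (right_ne_zero_of_mul h)
      · rw [not_not] at h
        obtain ⟨j, rfl | rfl⟩ := Nat.even_or_odd' i
        · exact absurd ((spreadWeight_even s x j).trans h) hi
        · rw [spreadWeight_odd, h, zero_add] at hi
          rw [show (2 * j + 1) / 2 = j by omega]
          exact label_ne_none (right_ne_zero_of_mul hi))

theorem spread_label_stay {s : I} {x : MilnorE Γ} {i : ℕ} (h : stage s i * x.weight i ≠ 0) :
    (spread s x).label i = x.label i := by
  have h' : spreadWeight s x i ≠ 0 := by
    have h1 := lt_of_le_of_ne (stay_nonneg s x i) h.symm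
    obtain ⟨j, rfl | rfl⟩ := Nat.even_or_odd' i
    · rwa [spreadWeight_even]
    · rw [spreadWeight_odd]
      exact (add_pos_of_pos_of_nonneg h1 (move_nonneg s x j)).ne'
  exact (if_neg h').trans (if_pos h)

/-- The place `2 i + 1` could be claimed both by the moved index `i` and by the returned index `2 i
+ 1`, with different labels. Since `i < 2 i + 1`, the second has not begun to return while the first
is still away, so no conflict arises. -/
theorem spread_label_move {s : I} {x : MilnorE Γ} {i : ℕ} (h : (1 - stage s i) * x.weight i ≠ 0) :
    (spread s x).label (2 * i + 1) = x.label i := by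
  have h1 : stage s (2 * i + 1) = 0 := by
    by_contra h2
    rw [stage_eq_one h2 (by omega : i < 2 * i + 1), sub_self, zero_mul] at h
    exact h rfl
  have h' : spreadWeight s x (2 * i + 1) ≠ 0 := by
    rwa [spreadWeight_odd, h1, zero_mul, zero_add]
  refine (if_neg h').trans ((if_neg ?_).trans ?_)
  · rw [h1, zero_mul, not_not]
  · rw [show (2 * i + 1) / 2 = i by omega]

theorem spread_cases {s : I} {x : MilnorE Γ} {i : ℕ} (h : (spread s x).weight i ≠ 0) :
    stage s i * x.weight i ≠ 0 ∨ ∃ j, i = 2 * j + 1 ∧ (1 - stage s j) * x.weight j ≠ 0 := by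
  obtain ⟨j, rfl | rfl⟩ := Nat.even_or_odd' i
  · left
    rwa [← spreadWeight_even]
  · by_contra! h'
    refine h ((spreadWeight_odd s x j).trans ?_)
    rw [h'.1, h'.2 j rfl, add_zero]

/-- Infinitely many moves accumulate at `s = 1`, but each index depends on at most two of them. The
coarse topology asks for nothing uniform in the index. -/
theorem continuous_spread [TopologicalSpace Γ] :
    Continuous fun q : I × MilnorE Γ => spread q.1 q.2 := by
  have hs : ∀ i, Continuous fun q : I × MilnorE Γ => stage q.1 i * q.2.weight i := fun i =>
    ((continuous_stage i).comp continuous_fst).mul ((continuous_weight i).comp continuous_snd)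
  have hm : ∀ i, Continuous fun q : I × MilnorE Γ => (1 - stage q.1 i) * q.2.weight i := fun i =>
    (continuous_const.sub ((continuous_stage i).comp continuous_fst)).mul
      ((continuous_weight i).comp continuous_snd)
  refine continuous_of_labelAt (fun i => ?_) fun i q hq => ?_
  · obtain ⟨j, rfl | rfl⟩ := Nat.even_or_odd' i
    · exact (hs _).congr fun q => (spreadWeight_even q.1 q.2 j).symm
    · exact ((hs _).add (hm _)).congr fun q => (spreadWeight_odd q.1 q.2 j).symm
  · rcases spread_cases hq with h | ⟨j, rfl, h⟩
    · refine (labelAt_of_continuous continuous_snd (right_ne_zero_of_mul h)).congr ?_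
      filter_upwards [(hs i).continuousAt.eventually_ne h] with q' h'
      exact spread_label_stay h'
    · refine (labelAt_of_continuous continuous_snd (right_ne_zero_of_mul h)).congr ?_
      filter_upwards [(hm j).continuousAt.eventually_ne h] with q' h'
      exact spread_label_move h'

theorem spread_zero (x y : MilnorE Γ) : spread 0 x = interleave 1 y x := by
  refine ext_of_ne_zero (fun i => ?_) (fun i hi => ?_)
  · obtain ⟨j, rfl | rfl⟩ := Nat.even_or_odd' i
    · rw [interleave_weight_even]
      exact (spreadWeight_even 0 x j).trans (by simp [stage_zero])
    · rw [interleave_weight_odd]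
      exact (spreadWeight_odd 0 x j).trans (by simp [stage_zero])
  · rcases spread_cases hi with h | ⟨j, rfl, h⟩
    · simp [stage_zero] at h
    · rw [spread_label_move h, interleave_label_odd]
      rw [interleave_weight_odd]
      simpa [stage_zero] using h

theorem spread_one (x : MilnorE Γ) : spread 1 x = x := by
  refine ext_of_ne_zero (fun i => ?_) (fun i hi => ?_)
  · obtain ⟨j, rfl | rfl⟩ := Nat.even_or_odd' i
    · exact (spreadWeight_even 1 x j).trans (by simp [stage_one])
    · exact (spreadWeight_odd 1 x j).trans (by simp [stage_one])
  · rcases spread_cases hi with h | ⟨j, rfl, h⟩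
    · exact spread_label_stay h
    · simp [stage_one] at h

theorem spread_smul [Group Γ] (g : Γ) (s : I) (x : MilnorE Γ) :
    spread s (g • x) = g • spread s x := by
  refine ext_of_ne_zero (fun i => rfl) (fun i hi => ?_)
  rw [label_smul]
  rcases spread_cases hi with h | ⟨j, rfl, h⟩
  · rw [spread_label_stay h, spread_label_stay (by exact h), label_smul]
  · rw [spread_label_move h, spread_label_move (by exact h), label_smul]

/-! ### Equivariant maps into `EΓ` are homotopic -/

/-- Equivariance of maps `EΓ × EΓ → EΓ`. -/
def IsEquivariant (Γ : Type*) [Group Γ] [TopologicalSpace Γ]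
    (f : C(MilnorE Γ × MilnorE Γ, MilnorE Γ)) : Prop :=
  ∀ (g : Γ) (q : MilnorE Γ × MilnorE Γ), f (g • q) = g • f q

theorem homotopicWith_of_homotopy [Group Γ] [TopologicalSpace Γ]
    (H : C(I × (MilnorE Γ × MilnorE Γ), MilnorE Γ))
    (hH : ∀ (g : Γ) s q, H (s, g • q) = g • H (s, q))
    (f₀ f₁ : C(MilnorE Γ × MilnorE Γ, MilnorE Γ)) (h0 : ∀ q, H (0, q) = f₀ q)
    (h1 : ∀ q, H (1, q) = f₁ q) : ContinuousMap.HomotopicWith f₀ f₁ (IsEquivariant Γ) :=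
  ⟨⟨⟨H, h0, h1⟩, fun s g q => hH g s q⟩⟩

/-- The two projections `EΓ × EΓ → EΓ` are equivariantly homotopic. -/
theorem exists_homotopy (Γ : Type*) [Group Γ] [TopologicalSpace Γ] :
    ∃ C : C(I × (MilnorE Γ × MilnorE Γ), MilnorE Γ),
      (∀ x y, C (0, x, y) = x) ∧ (∀ x y, C (1, x, y) = y) ∧
      ∀ (g : Γ) s x y, C (s, g • x, g • y) = g • C (s, x, y) := by
  let π₁ : C(I × (MilnorE Γ × MilnorE Γ), MilnorE Γ) := ContinuousMap.fst.comp .snd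
  let π₂ : C(I × (MilnorE Γ × MilnorE Γ), MilnorE Γ) := ContinuousMap.snd.comp .snd
  let S : C(I × MilnorE Γ, MilnorE Γ) := ⟨_, continuous_spread⟩
  let J : C(I × (MilnorE Γ × MilnorE Γ), MilnorE Γ) := ⟨_, continuous_interleave⟩
  let S₁ := S.comp (ContinuousMap.fst.prodMk π₁)
  let S₂ := S.comp (ContinuousMap.fst.prodMk π₂)
  let J₁ := J.comp (ContinuousMap.fst.prodMk (π₂.prodMk π₁))
  let J₂ := J.comp (ContinuousMap.fst.prodMk (π₂.prodMk π₂))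
  let slice : C(I × (MilnorE Γ × MilnorE Γ), MilnorE Γ) → I →
      C(MilnorE Γ × MilnorE Γ, MilnorE Γ) := fun H s =>
    ⟨fun q => H (s, q), H.continuous.comp (continuous_const.prodMk continuous_id)⟩
  have e1 : ∀ (g : Γ) s q, S₁ (s, g • q) = g • S₁ (s, q) := fun g s q => spread_smul g s q.1
  have e2 : ∀ (g : Γ) s q, S₂ (s, g • q) = g • S₂ (s, q) := fun g s q => spread_smul g s q.2
  have e3 : ∀ (g : Γ) s q, J₁ (s, g • q) = g • J₁ (s, q) :=
    fun g s q => interleave_smul g s q.2 q.1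
  have e4 : ∀ (g : Γ) s q, J₂ (s, g • q) = g • J₂ (s, q) :=
    fun g s q => interleave_smul g s q.2 q.2
  have a1 : ∀ q, S₁ (0, q) = slice J₁ 1 q := fun q => spread_zero q.1 q.2
  have a2 : ∀ q, S₂ (0, q) = slice J₂ 1 q := fun q => spread_zero q.2 q.2
  have a3 : ∀ q, J₂ (0, q) = slice J₁ 0 q := fun q => interleave_zero q.2 q.2 q.1
  have b1 : ∀ q, S₁ (1, q) = ContinuousMap.fst q := fun q => spread_one q.1
  have b2 : ∀ q, S₂ (1, q) = ContinuousMap.snd q := fun q => spread_one q.2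
  have h1 := homotopicWith_of_homotopy S₁ e1 _ _ a1 b1
  have h2 := homotopicWith_of_homotopy J₁ e3 (slice J₁ 0) (slice J₁ 1) (fun _ => rfl)
    (fun _ => rfl)
  have h3 := homotopicWith_of_homotopy J₂ e4 _ (slice J₂ 1) a3 (fun _ => rfl)
  have h4 := homotopicWith_of_homotopy S₂ e2 _ _ a2 b2
  -- From `x` to `x` on the odd indices, to `y` on the even indices, to `y` on the odd indices, and
  -- back to `y`. Disjoint supports make the two middle passages honest convex combinations.
  obtain ⟨H⟩ := ((h1.symm.trans h2.symm).trans h3).trans h4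
  exact ⟨H.toContinuousMap, fun x y => H.apply_zero (x, y), fun x y => H.apply_one (x, y),
    fun g s x y => H.prop s g (x, y)⟩

end MilnorE

/-! ### Equivariant maps from `EΓ` to the real line -/

namespace MilnorE

variable {Γ : Type*}

theorem sum_weight_le_one (x : MilnorE Γ) (s : Finset ℕ) : ∑ i ∈ s, x.weight i ≤ 1 := by
  classical
  rw [← x.sum_eq_one, Finsupp.sum]
  calc ∑ i ∈ s, x.weight i ≤ ∑ i ∈ s ∪ x.weight.support, x.weight i :=
        Finset.sum_le_sum_of_subset_of_nonneg Finset.subset_union_left fun i _ _ => x.nonneg i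
    _ = ∑ i ∈ x.weight.support, x.weight i :=
        (Finset.sum_subset Finset.subset_union_right fun i _ hi =>
          Finsupp.notMem_support_iff.1 hi).symm

theorem exists_sum_range_eq_one (x : MilnorE Γ) (k : ℕ) :
    ∃ m > k, ∑ i ∈ Finset.range m, x.weight i = 1 := by
  obtain ⟨m, hm⟩ := x.weight.support.exists_nat_subset_range
  refine ⟨max m (k + 1), lt_of_lt_of_le (Nat.lt_succ_self k) (le_max_right _ _), ?_⟩
  rw [← x.sum_eq_one, Finsupp.sum]
  exact (Finset.sum_subset (hm.trans (Finset.range_subset_range.2 (le_max_left _ _)))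
    fun i _ hi => Finsupp.notMem_support_iff.1 hi).symm

/-- The weights lowered by a small constant. -/
def lowered (x : MilnorE Γ) (i : ℕ) : ℝ := max 0 (x.weight i - (1 / 2) ^ (i + 2))

/-- Locally finite weights: `lowered x i` minus the sum of its predecessors. -/
def partition (x : MilnorE Γ) (i : ℕ) : ℝ :=
  max 0 (lowered x i - ∑ j ∈ Finset.range i, lowered x j)

theorem lowered_nonneg (x : MilnorE Γ) (i : ℕ) : 0 ≤ lowered x i := le_max_left _ _

theorem lowered_le (x : MilnorE Γ) (i : ℕ) : lowered x i ≤ x.weight i :=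
  max_le (x.nonneg i) (sub_le_self _ (by positivity))

theorem lowered_eq_zero {x : MilnorE Γ} {i : ℕ} (h : x.weight i ≤ (1 / 2) ^ (i + 2)) :
    lowered x i = 0 := max_eq_left (sub_nonpos.2 h)

theorem partition_nonneg (x : MilnorE Γ) (i : ℕ) : 0 ≤ partition x i := le_max_left _ _

theorem partition_eq_zero_of_lowered {x : MilnorE Γ} {i : ℕ} (h : lowered x i = 0) :
    partition x i = 0 := by
  refine max_eq_left ?_
  rw [h, zero_sub]
  exact neg_nonpos.2 (Finset.sum_nonneg fun j _ => lowered_nonneg x j)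

theorem weight_ne_zero_of_partition {x : MilnorE Γ} {i : ℕ} (h : partition x i ≠ 0) :
    x.weight i ≠ 0 := fun h' => h (partition_eq_zero_of_lowered (lowered_eq_zero (by
      rw [h']; positivity)))

/-- The thresholds `(1 / 2) ^ (i + 2)` add up to at most `1/2`, while the weights add up to `1`. -/
theorem exists_lowered_ne_zero (x : MilnorE Γ) : ∃ i, lowered x i ≠ 0 := by
  by_contra! h
  have h1 : ∀ i, x.weight i ≤ (1 / 4) * (1 / 2) ^ i := fun i => by
    have := (le_max_right _ _).trans (h i).le
    rw [pow_add] at this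
    linarith
  obtain ⟨m, -, hm⟩ := x.exists_sum_range_eq_one 0
  have h2 : (1 : ℝ) ≤ ∑ i ∈ Finset.range m, (1 / 4) * (1 / 2) ^ i :=
    hm.symm.le.trans (Finset.sum_le_sum fun i _ => h1 i)
  rw [← Finset.mul_sum] at h2
  have h3 : ∑ i ∈ Finset.range m, ((1 : ℝ) / 2) ^ i ≤ 2 := sum_geometric_two_le m
  linarith

/-- At the first index with nonzero lowered weight, nothing is subtracted. -/
theorem exists_partition_pos (x : MilnorE Γ) : ∃ i, 0 < partition x i := by
  classical
  let k := Nat.find x.exists_lowered_ne_zero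
  have hk : lowered x k ≠ 0 := Nat.find_spec x.exists_lowered_ne_zero
  have h : ∑ j ∈ Finset.range k, lowered x j = 0 := Finset.sum_eq_zero fun j hj =>
    not_not.1 (Nat.find_min x.exists_lowered_ne_zero (Finset.mem_range.1 hj))
  refine ⟨k, lt_max_of_lt_right ?_⟩
  rw [h, sub_zero]
  exact lt_of_le_of_ne (lowered_nonneg x k) hk.symm

theorem finite_support_partition (x : MilnorE Γ) : (Function.support (partition x)).Finite :=
  x.weight.support.finite_toSet.subset fun _ hi =>
    Finset.mem_coe.2 (Finsupp.mem_support_iff.2 (weight_ne_zero_of_partition hi))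

theorem finsum_partition_pos (x : MilnorE Γ) : 0 < ∑ᶠ i, partition x i := by
  obtain ⟨k, hk⟩ := x.exists_partition_pos
  exact hk.trans_le (single_le_finsum k x.finite_support_partition (partition_nonneg x))

section Continuity

variable [TopologicalSpace Γ]

theorem continuous_lowered (i : ℕ) : Continuous fun x : MilnorE Γ => lowered x i :=
  continuous_const.max ((continuous_weight i).sub continuous_const)

theorem continuous_partition (i : ℕ) : Continuous fun x : MilnorE Γ => partition x i :=
  continuous_const.max ((continuous_lowered i).sub
    (continuous_finsetSum _ fun j _ => continuous_lowered j))

/-- The weights themselves need not be locally finite in this topology. Near `x`, however, some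
lowered weight `k` stays above a fixed bound, while finitely many weights already sum to almost `1`.
All later weights are then smaller than the subtracted lowered weight at `k`, so their `partition`
values vanish. -/
theorem locallyFinite_partition :
    LocallyFinite fun i => Function.support fun x : MilnorE Γ => partition x i := by
  intro x
  obtain ⟨k, hk⟩ := x.exists_lowered_ne_zero
  have hk' : 0 < lowered x k := lt_of_le_of_ne (lowered_nonneg x k) hk.symm
  obtain ⟨m, hkm, hm⟩ := x.exists_sum_range_eq_one k
  refine ⟨{y | lowered x k / 2 < lowered y k} ∩
    {y | 1 - lowered x k / 2 < ∑ i ∈ Finset.range m, y.weight i}, Filter.inter_mem ?_ ?_, ?_⟩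
  · exact (isOpen_lt continuous_const (continuous_lowered k)).mem_nhds (half_lt_self hk')
  · refine (isOpen_lt continuous_const
      (continuous_finsetSum _ fun i _ => continuous_weight i)).mem_nhds ?_
    change _ < ∑ i ∈ Finset.range m, x.weight i
    rw [hm]
    linarith
  · refine (Set.finite_lt_nat m).subset ?_
    rintro i ⟨y, hy, hy1, hy2⟩
    by_contra! hi
    refine hy (max_eq_left (sub_nonpos.2 ?_))
    have hi' : m ≤ i := not_lt.1 hi
    have h1 : y.weight i + ∑ j ∈ Finset.range m, y.weight j ≤ 1 := by
      rw [← Finset.sum_insert (by simpa using hi')]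
      exact y.sum_weight_le_one _
    have h2 : lowered y k ≤ ∑ j ∈ Finset.range i, lowered y j :=
      Finset.single_le_sum (fun j _ => lowered_nonneg y j)
        (Finset.mem_range.2 (hkm.trans_le hi'))
    have h3 := lowered_le y i
    change 1 - lowered x k / 2 < ∑ i ∈ Finset.range m, y.weight i at hy2
    change lowered x k / 2 < lowered y k at hy1
    linarith

end Continuity

/-- The value of `l` at the `i`-th label. -/
def labelValue (l : Γ → ℝ) (x : MilnorE Γ) (i : ℕ) : ℝ := (x.label i).elim 0 l

/-- The average of the values of `l` at the labels. -/
def average (l : Γ → ℝ) (x : MilnorE Γ) : ℝ :=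
  (∑ᶠ i, partition x i * labelValue l x i) / ∑ᶠ i, partition x i

theorem continuous_average [TopologicalSpace Γ] {l : Γ → ℝ} (hl : Continuous l) :
    Continuous (average l) := by
  refine Continuous.div (continuous_finsum (fun i => ?_) ?_)
    (continuous_finsum continuous_partition locallyFinite_partition)
    fun x => x.finsum_partition_pos.ne'
  · refine continuous_iff_continuousAt.2 fun x => ?_
    by_cases hx : x.weight i = 0
    -- Where the weight vanishes the label is undefined and nearby values of `l` are uncontrolled.
    -- The threshold makes `partition` zero on a whole neighbourhood, so the product is locally
    -- zero.
    · have h : (fun y : MilnorE Γ => partition y i * labelValue l y i) =ᶠ[nhds x] fun _ => 0 := by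
        have h' : x.weight i < (1 / 2) ^ (i + 2) := by rw [hx]; positivity
        filter_upwards [(isOpen_lt (continuous_weight i) continuous_const).mem_nhds h'] with y hy
        rw [partition_eq_zero_of_lowered (lowered_eq_zero (le_of_lt hy)), zero_mul]
      exact continuousAt_const.congr h.symm
    · refine (continuous_partition i).continuousAt.mul ?_
      obtain ⟨g, hg, h⟩ := labelAt_of_continuous continuous_id hx
      refine (hl.continuousAt.comp hg).congr ?_
      filter_upwards [h] with y hy
      change _ = (y.label i).elim 0 l
      change y.label i = some (g y) at hy
      rw [hy]
      rfl
  · exact locallyFinite_partition.subset fun i x hx => left_ne_zero_of_mul hx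

/-- Affine maps commute with weighted averages, and the weights are invariant under the action. -/
theorem average_smul [Group Γ] {l : Γ → ℝ} {g : Γ} {a b : ℝ} (h : ∀ g', l (g * g') = a + b * l g')
    (x : MilnorE Γ) : average l (g • x) = a + b * average l x := by
  have hf := x.finite_support_partition
  have hp : ∀ i, partition (g • x) i * labelValue l (g • x) i =
      partition x i * a + b * (partition x i * labelValue l x i) := by
    intro i
    change partition x i * labelValue l (g • x) i = _
    by_cases hi : partition x i = 0
    · rw [hi]; ring
    · obtain ⟨g', hg'⟩ := Option.ne_none_iff_exists'.1
        (label_ne_none (weight_ne_zero_of_partition hi))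
      have h1 : labelValue l x i = l g' := by rw [labelValue, hg']; rfl
      have h2 : labelValue l (g • x) i = l (g * g') := by
        rw [labelValue, label_smul, hg']; rfl
      rw [h1, h2, h]
      ring
  have hpos := x.finsum_partition_pos.ne'
  unfold average
  simp_rw [hp]
  rw [finsum_add_distrib (hf.subset fun i hi => left_ne_zero_of_mul hi)
    (hf.subset fun i hi => left_ne_zero_of_mul (right_ne_zero_of_mul hi)), ← finsum_mul, ← mul_finsum]
  change _ / (∑ᶠ i, partition x i) = _
  field_simp

end MilnorE

/-! ### A map from `E(G × ℤ₂^R) × ℝ` to `E(G × (ℤ ⋊ ℤ₂^R))` -/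

section Sigma

variable {G : Type*}

/-- The element `(g, (ε ⌊ε x + a⌋, ε))` of `G × (ℤ ⋊ ℤ₂^R)`. -/
def lineLabel (a : ℝ) (x : ℝ) (γ : G × ℤˣ) : G × LineGroup :=
  (γ.1, ⟨Multiplicative.ofAdd ((γ.2 : ℤ) * ⌊((γ.2 : ℤ) : ℝ) * x + a⌋), γ.2⟩)

/-- Because `u² = 1`, replacing `x` by `m + u x` and `ε` by `u ε` shifts `ε x + a` by the integer `u
ε m`, which passes through the floor. The signs `ε` inside and outside the floor are chosen so that
this also works for reflections. -/
theorem lineLabel_mul [Group G] (a x : ℝ) (g : G) (m : ℤ) (u : ℤˣ) (γ : G × ℤˣ) :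
    lineLabel a (m + ((u : ℤ) : ℝ) * x) ((g, u) * γ) =
      (g, ⟨Multiplicative.ofAdd m, u⟩) * lineLabel a x γ := by
  obtain ⟨g', ε⟩ := γ
  refine Prod.ext rfl (SemidirectProduct.ext ?_ rfl)
  change Multiplicative.ofAdd (((u * ε : ℤˣ) : ℤ) *
    ⌊((((u * ε : ℤˣ) : ℤ)) : ℝ) * (m + ((u : ℤ) : ℝ) * x) + a⌋) =
    Multiplicative.ofAdd m *
      Multiplicative.ofAdd ((ε : ℤ) * ⌊((ε : ℤ) : ℝ) * x + a⌋) ^ (u : ℤ)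
  have hu : ((u : ℤ) : ℝ) * ((u : ℤ) : ℝ) = 1 := by
    have := Int.units_coe_mul_self u
    exact_mod_cast this
  have h : ((((u * ε : ℤˣ) : ℤ)) : ℝ) * (m + ((u : ℤ) : ℝ) * x) + a =
      (((ε : ℤ) : ℝ) * x + a) + ((((u : ℤ) * (ε : ℤ) * m : ℤ)) : ℝ) := by
    push_cast
    linear_combination ((ε : ℤ) : ℝ) * x * hu
  rw [h, Int.floor_add_intCast, ← ofAdd_zsmul, ← ofAdd_add, Units.val_mul, smul_eq_mul]
  congr 1
  have hu' := Int.units_coe_mul_self u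
  have hε := Int.units_coe_mul_self ε
  linear_combination (m * ε * ε) * hu' + m * hε

/-- The sign is locally constant, and the floor jumps only where its argument is an integer. -/
theorem continuousAt_lineLabel [TopologicalSpace G] {a x : ℝ} {γ : G × ℤˣ}
    (h : ∀ k : ℤ, ((γ.2 : ℤ) : ℝ) * x + a ≠ k) :
    ContinuousAt (fun q : ℝ × (G × ℤˣ) => lineLabel a q.1 q.2) (x, γ) := by
  have h1 : Continuous fun q : ℝ × (G × ℤˣ) => (((q.2.2 : ℤˣ) : ℤ) : ℝ) * q.1 + a := by
    have : Continuous fun u : ℤˣ => ((u : ℤ) : ℝ) := continuous_of_discreteTopology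
    fun_prop
  have h2 : ∀ᶠ q : ℝ × (G × ℤˣ) in nhds (x, γ), q.2.2 = γ.2 := by
    have : Continuous fun q : ℝ × (G × ℤˣ) => q.2.2 := by fun_prop
    exact (this.isOpen_preimage {γ.2} (isOpen_discrete _)).mem_nhds rfl
  have h3 : ∀ᶠ q : ℝ × (G × ℤˣ) in nhds (x, γ),
      ⌊((q.2.2 : ℤ) : ℝ) * q.1 + a⌋ = ⌊((γ.2 : ℤ) : ℝ) * x + a⌋ := by
    have hm : ((γ.2 : ℤ) : ℝ) * x + a ∈
        Set.Ioo ((⌊((γ.2 : ℤ) : ℝ) * x + a⌋ : ℤ) : ℝ) (⌊((γ.2 : ℤ) : ℝ) * x + a⌋ + 1) :=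
      ⟨lt_of_le_of_ne (Int.floor_le _) (h _).symm, Int.lt_floor_add_one _⟩
    filter_upwards [(isOpen_Ioo.preimage h1).mem_nhds hm] with q hq
    exact Int.floor_eq_iff.2 ⟨hq.1.le, hq.2⟩
  have h4 : Continuous fun q : ℝ × (G × ℤˣ) => (q.2.1, (lineLabel a x γ).2) := by fun_prop
  refine h4.continuousAt.congr ?_
  filter_upwards [h2, h3] with q hq2 hq3
  refine Prod.ext rfl (SemidirectProduct.ext ?_ hq2.symm)
  change Multiplicative.ofAdd (_ * _) = Multiplicative.ofAdd (_ * _)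
  rw [hq2] at hq3 ⊢
  rw [hq3]

/-- A `1`-periodic even function `ℝ → [0, 1]` with the value `0` on `ℤ` and `1` on `1/2 + ℤ`. -/
def wave (x : ℝ) : I := ⟨(1 - Real.cos (2 * Real.pi * x)) / 2, by
  have h1 := Real.cos_le_one (2 * Real.pi * x)
  have h2 := Real.neg_one_le_cos (2 * Real.pi * x)
  constructor <;> linarith⟩

theorem continuous_wave : Continuous wave := by
  unfold wave
  fun_prop

theorem wave_smul (m : ℤ) (u : ℤˣ) (x : ℝ) : wave (m + ((u : ℤ) : ℝ) * x) = wave x := by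
  refine Subtype.ext ?_
  change (1 - Real.cos (2 * Real.pi * (m + ((u : ℤ) : ℝ) * x))) / 2 =
    (1 - Real.cos (2 * Real.pi * x)) / 2
  have h : 2 * Real.pi * (m + ((u : ℤ) : ℝ) * x) =
      ((u : ℤ) : ℝ) * (2 * Real.pi * x) + m * (2 * Real.pi) := by ring
  rw [h, Real.cos_add_int_mul_two_pi]
  rcases Int.units_eq_one_or u with rfl | rfl <;> simp

theorem wave_intCast (m : ℤ) : (wave m : ℝ) = 0 := by
  change (1 - Real.cos (2 * Real.pi * m)) / 2 = 0
  rw [mul_comm, Real.cos_int_mul_two_pi]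
  norm_num

theorem wave_half (m : ℤ) : (wave (m + 1 / 2) : ℝ) = 1 := by
  change (1 - Real.cos (2 * Real.pi * (m + 1 / 2))) / 2 = 1
  have h : 2 * Real.pi * (m + 1 / 2) = Real.pi + m * (2 * Real.pi) := by ring
  rw [h, Real.cos_add_int_mul_two_pi, Real.cos_pi]
  norm_num

/-- The weight factor `wave` vanishes at the integers, exactly where `lineLabel 0` jumps; the factor
`1 - wave` plays the same role for `lineLabel (1 / 2)` at the half-integers. -/
theorem ne_intCast_of_wave {x : ℝ} {u : ℤˣ} (h : (wave x : ℝ) ≠ 0) (k : ℤ) :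
    ((u : ℤ) : ℝ) * x + 0 ≠ k := by
  intro h'
  have h1 := wave_smul 0 u x
  rw [Int.cast_zero, zero_add, ← add_zero (_ * x), h'] at h1
  exact h (h1 ▸ wave_intCast k)

theorem ne_intCast_of_one_sub_wave {x : ℝ} {u : ℤˣ} (h : (1 - (wave x : ℝ)) ≠ 0) (k : ℤ) :
    ((u : ℤ) : ℝ) * x + 1 / 2 ≠ k := by
  intro h'
  have h1 := wave_smul 0 u x
  have h2 : ((u : ℤ) : ℝ) * x = ((k - 1 : ℤ) : ℝ) + 1 / 2 := by
    push_cast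
    linarith
  rw [Int.cast_zero, zero_add, h2] at h1
  exact h (by rw [← h1, wave_half, sub_self])

namespace MilnorE

/-- The labels `lineLabel (1 / 2) x γ` at the even and `lineLabel 0 x γ` at the odd indices. -/
def unwind (e : MilnorE (G × ℤˣ)) (x : ℝ) : MilnorE (G × LineGroup) :=
  mk' (weave (wave x) e.weight e.weight)
    (weave_nonneg (wave x).2.1 (wave x).2.2 e.nonneg e.nonneg)
    (sum_weave (wave x) e.sum_eq_one e.sum_eq_one)
    (weaveLabel (fun i => (e.label i).map (lineLabel (1 / 2) x))
      (fun i => (e.label i).map (lineLabel 0 x))) (by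
      intro i hi
      obtain ⟨j, rfl | rfl⟩ := Nat.even_or_odd' i
      · rw [weave_even] at hi
        rw [weaveLabel_even, ne_eq, Option.map_eq_none_iff]
        exact label_ne_none (right_ne_zero_of_mul hi)
      · rw [weave_odd] at hi
        rw [weaveLabel_odd, ne_eq, Option.map_eq_none_iff]
        exact label_ne_none (right_ne_zero_of_mul hi))

theorem unwind_weight_even (e : MilnorE (G × ℤˣ)) (x : ℝ) (i : ℕ) :
    (unwind e x).weight (2 * i) = (1 - wave x) * e.weight i := weave_even _ _ _ _

theorem unwind_weight_odd (e : MilnorE (G × ℤˣ)) (x : ℝ) (i : ℕ) :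
    (unwind e x).weight (2 * i + 1) = wave x * e.weight i := weave_odd _ _ _ _

theorem unwind_label_even {e : MilnorE (G × ℤˣ)} {x : ℝ} {i : ℕ}
    (h : (unwind e x).weight (2 * i) ≠ 0) :
    (unwind e x).label (2 * i) = (e.label i).map (lineLabel (1 / 2) x) :=
  (if_neg h).trans (weaveLabel_even _ _ _)

theorem unwind_label_odd {e : MilnorE (G × ℤˣ)} {x : ℝ} {i : ℕ}
    (h : (unwind e x).weight (2 * i + 1) ≠ 0) :
    (unwind e x).label (2 * i + 1) = (e.label i).map (lineLabel 0 x) :=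
  (if_neg h).trans (weaveLabel_odd _ _ _)

theorem unwind_smul [Group G] (g : G) (m : ℤ) (u : ℤˣ) (e : MilnorE (G × ℤˣ)) (x : ℝ) :
    unwind ((g, u) • e) (m + ((u : ℤ) : ℝ) * x) =
      ((g, ⟨Multiplicative.ofAdd m, u⟩) : G × LineGroup) • unwind e x := by
  have hw : ∀ i, (unwind ((g, u) • e) (m + ((u : ℤ) : ℝ) * x)).weight i =
      (unwind e x).weight i := by
    intro i
    obtain ⟨j, rfl | rfl⟩ := Nat.even_or_odd' i
    · rw [unwind_weight_even, unwind_weight_even, wave_smul]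
      rfl
    · rw [unwind_weight_odd, unwind_weight_odd, wave_smul]
      rfl
  have hl : ∀ a i, (((g, u) • e).label i).map (lineLabel a (m + ((u : ℤ) : ℝ) * x)) =
      ((e.label i).map (lineLabel a x)).map
        (((g, ⟨Multiplicative.ofAdd m, u⟩) : G × LineGroup) * ·) := by
    intro a i
    rw [label_smul, Option.map_map, Option.map_map]
    congr 1
    funext γ
    exact lineLabel_mul a x g m u γ
  refine ext_of_ne_zero hw fun i hi => ?_
  have hi' := hi
  rw [hw] at hi'
  rw [label_smul]
  obtain ⟨j, rfl | rfl⟩ := Nat.even_or_odd' i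
  · rw [unwind_label_even hi, unwind_label_even hi', hl]
  · rw [unwind_label_odd hi, unwind_label_odd hi', hl]

/-- Neither rounding of `x` is continuous. Each copy of the labels fades out where its rounding
jumps, and the two sets of jumps are disjoint, so some copy always carries the weight. -/
theorem continuous_unwind [TopologicalSpace G] :
    Continuous fun q : MilnorE (G × ℤˣ) × ℝ => unwind q.1 q.2 := by
  have c2 : Continuous fun q : MilnorE (G × ℤˣ) × ℝ => (wave q.2 : ℝ) :=
    continuous_subtype_val.comp (continuous_wave.comp continuous_snd)
  have hw : ∀ i, Continuous fun q : MilnorE (G × ℤˣ) × ℝ => (unwind q.1 q.2).weight i := by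
    intro i
    obtain ⟨j, rfl | rfl⟩ := Nat.even_or_odd' i
    · simp_rw [unwind_weight_even]
      exact (continuous_const.sub c2).mul ((continuous_weight j).comp continuous_fst)
    · simp_rw [unwind_weight_odd]
      exact c2.mul ((continuous_weight j).comp continuous_fst)
  have key : ∀ (a : ℝ) (i j : ℕ) (q : MilnorE (G × ℤˣ) × ℝ), q.1.weight i ≠ 0 →
      (∀ (u : ℤˣ) (k : ℤ), ((u : ℤ) : ℝ) * q.2 + a ≠ k) →
      (∀ᶠ q' in nhds q, (unwind q'.1 q'.2).label j = (q'.1.label i).map (lineLabel a q'.2)) →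
      LabelAt (fun q : MilnorE (G × ℤˣ) × ℝ => unwind q.1 q.2) j q := by
    intro a i j q hq hu h
    obtain ⟨g, hg, h'⟩ := labelAt_of_continuous
      (continuous_fst : Continuous fun q : MilnorE (G × ℤˣ) × ℝ => q.1) hq
    refine ⟨fun q' => lineLabel a q'.2 (g q'), ?_, ?_⟩
    · exact ContinuousAt.comp (f := fun q' : MilnorE (G × ℤˣ) × ℝ => (q'.2, g q'))
        (g := fun q : ℝ × (G × ℤˣ) => lineLabel a q.1 q.2)
        (continuousAt_lineLabel (hu _)) (continuous_snd.continuousAt.prodMk hg)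
    · filter_upwards [h, h'] with q' h1 h2
      rw [h1, h2]
      rfl
  refine continuous_of_labelAt hw fun i q hq => ?_
  have hq' := (hw i).continuousAt.eventually_ne hq
  obtain ⟨j, rfl | rfl⟩ := Nat.even_or_odd' i
  · rw [unwind_weight_even] at hq
    refine key (1 / 2) j _ q (right_ne_zero_of_mul hq)
      (fun u k => ne_intCast_of_one_sub_wave (left_ne_zero_of_mul hq) k) ?_
    filter_upwards [hq'] with q' h
    exact unwind_label_even h
  · rw [unwind_weight_odd] at hq
    refine key 0 j _ q (right_ne_zero_of_mul hq)
      (fun u k => ne_intCast_of_wave (left_ne_zero_of_mul hq) k) ?_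
    filter_upwards [hq'] with q' h
    exact unwind_label_odd h

end MilnorE

end Sigma

/-! ### Maps out of Borel constructions -/

/-- A product of an open quotient map with an identity is again a quotient map, for an arbitrary
parameter space `T`. With `T = I` this lets homotopies descend to orbit spaces. -/
theorem exists_lift_of_isOpenQuotientMap {P B T W : Type*} [TopologicalSpace P]
    [TopologicalSpace B] [TopologicalSpace T] [TopologicalSpace W] {q : P → B}
    (hq : IsOpenQuotientMap q) (h : C(T × P, W))
    (hinv : ∀ t p p', q p = q p' → h (t, p) = h (t, p')) :
    ∃ k : C(T × B, W), ∀ t p, k (t, q p) = h (t, p) := by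
  have hq' : IsOpenQuotientMap (Prod.map (id : T → T) q) := IsOpenQuotientMap.id.prodMap hq
  have hf : Function.FactorsThrough h (Prod.map (id : T → T) q) := by
    rintro ⟨t, p⟩ ⟨t', p'⟩ hp
    obtain ⟨rfl, hp⟩ := Prod.ext_iff.1 hp
    exact hinv t p p' hp
  let k : T × B → W := Function.extend (Prod.map id q) h
    fun y => h (y.1, (hq.surjective y.2).choose)
  have hk : ∀ y, k (Prod.map id q y) = h y := hf.extend_apply _
  refine ⟨⟨k, ?_⟩, fun t p => hk (t, p)⟩
  exact hq'.isQuotientMap.continuous_iff.2 (h.continuous.congr fun y => (hk y).symm)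

/-- The action of `u = ±1` on the unit interval by `t ↦ 1/2 + u (t - 1/2)`. -/
def flipI (u : ℤˣ) (t : I) : I := ⟨1 / 2 + ((u : ℤ) : ℝ) * (t.1 - 1 / 2), by
  obtain ⟨x, h0, h1⟩ := t
  rcases Int.units_eq_one_or u with h | h <;> simp [h] <;> constructor <;> linarith⟩

theorem flipI_one (t : I) : flipI 1 t = t := Subtype.ext (by simp [flipI])

theorem flipI_mul (u v : ℤˣ) (t : I) : flipI (u * v) t = flipI u (flipI v t) :=
  Subtype.ext (by simp [flipI, mul_assoc])

theorem continuous_flipI (u : ℤˣ) : Continuous (flipI u) := by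
  unfold flipI
  fun_prop

theorem flipI_boundary {u : ℤˣ} {t : I} (h : t = 0 ∨ t = 1) : flipI u t = 0 ∨ flipI u t = 1 := by
  rcases Int.units_eq_one_or u with rfl | rfl
  · rwa [flipI_one]
  · rcases h with rfl | rfl
    · right
      exact Subtype.ext (by norm_num [flipI])
    · left
      exact Subtype.ext (by norm_num [flipI])

/-- The quotient map onto the Borel construction. -/
def borelMk (Γ : Type*) [Group Γ] {X : Type*} [MulAction Γ X] (e : MilnorE Γ) (x : X) :
    BorelConstruction Γ X := Quotient.mk _ (e, x)

theorem borelMk_surjective {Γ : Type*} [Group Γ] {X : Type*} [MulAction Γ X]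
    (y : BorelConstruction Γ X) : ∃ e x, borelMk Γ e x = y := by
  induction y using Quotient.inductionOn with | h p => exact ⟨p.1, p.2, rfl⟩

theorem borelMk_eq_iff {Γ : Type*} [Group Γ] {X : Type*} [MulAction Γ X] {e e' : MilnorE Γ} {x x' : X} :
    borelMk Γ e x = borelMk Γ e' x' ↔ ∃ g : Γ, e = g • e' ∧ x = g • x' := by
  refine Quotient.eq.trans ⟨?_, ?_⟩
  · rintro ⟨g, hg⟩
    obtain ⟨h1, h2⟩ := Prod.ext_iff.1 hg
    exact ⟨g, h1.symm, h2.symm⟩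
  · rintro ⟨g, h1, h2⟩
    exact ⟨g, Prod.ext h1.symm h2.symm⟩

/-- The point of `EΓ ×_Γ (X × Ĩ)` represented by `(e, x, t)`. -/
def twistedMk (Γ : Type*) [Group Γ] [TopologicalSpace Γ] {X : Type*} [MulAction Γ X] (φ : Γ →ₜ* ℤˣ)
    (e : MilnorE Γ) (x : X) (t : I) : BorelConstruction Γ (X × TwistedInterval φ) := borelMk Γ e (x, t)

section TwistedMk

variable {Γ : Type*} [Group Γ] [TopologicalSpace Γ] {X : Type*} [MulAction Γ X] {φ : Γ →ₜ* ℤˣ}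

theorem twistedMk_surjective (y : BorelConstruction Γ (X × TwistedInterval φ)) :
    ∃ e x t, twistedMk Γ φ e x t = y := by
  obtain ⟨e, ⟨x, t⟩, h⟩ := borelMk_surjective y
  exact ⟨e, x, t, h⟩

theorem twistedMk_eq_iff {e e' : MilnorE Γ} {x x' : X} {t t' : I} :
    twistedMk Γ φ e x t = twistedMk Γ φ e' x' t' ↔
      ∃ g : Γ, e = g • e' ∧ x = g • x' ∧ t = flipI (φ g) t' :=
  borelMk_eq_iff.trans (exists_congr fun _ => and_congr_right fun _ => Prod.ext_iff)

theorem twistedMk_smul (g : Γ) (e : MilnorE Γ) (x : X) (t : I) :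
    twistedMk Γ φ (g • e) (g • x) (flipI (φ g) t) = twistedMk Γ φ e x t :=
  twistedMk_eq_iff.2 ⟨g, rfl, rfl, rfl⟩

end TwistedMk

section Borel

variable {Γ : Type*} [Group Γ] [TopologicalSpace Γ] {X : Type*} [TopologicalSpace X]
  [MulAction Γ X]

instance (φ : Γ →ₜ* ℤˣ) : ContinuousConstSMul Γ (TwistedInterval φ) :=
  ⟨fun g => continuous_flipI (φ g)⟩

variable {φ : Γ →ₜ* ℤˣ}

theorem isOpenQuotientMap_borelMk [ContinuousConstSMul Γ Γ] [ContinuousConstSMul Γ X] :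
    IsOpenQuotientMap fun p : MilnorE Γ × X => borelMk Γ p.1 p.2 :=
  MulAction.isOpenQuotientMap_quotientMk

theorem continuous_borelMk : Continuous fun p : MilnorE Γ × X => borelMk Γ p.1 p.2 :=
  continuous_quot_mk

/-- Families of maps out of a Borel construction. -/
theorem exists_borel_lift [ContinuousConstSMul Γ Γ] [ContinuousConstSMul Γ X]
    {T W : Type*} [TopologicalSpace T] [TopologicalSpace W] (h : C(T × (MilnorE Γ × X), W))
    (hinv : ∀ t (g : Γ) e x, h (t, g • e, g • x) = h (t, e, x)) :
    ∃ k : C(T × BorelConstruction Γ X, W), ∀ t e x, k (t, borelMk Γ e x) = h (t, e, x) := by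
  obtain ⟨k, hk⟩ := exists_lift_of_isOpenQuotientMap isOpenQuotientMap_borelMk h (by
    rintro t ⟨e, x⟩ ⟨e', x'⟩ hp
    obtain ⟨g, rfl, rfl⟩ := borelMk_eq_iff.1 hp
    exact hinv t g e' x')
  exact ⟨k, fun t e x => hk t (e, x)⟩

theorem exists_borel_map [ContinuousConstSMul Γ Γ] [ContinuousConstSMul Γ X]
    {W : Type*} [TopologicalSpace W] (h : C(MilnorE Γ × X, W))
    (hinv : ∀ (g : Γ) e x, h (g • e, g • x) = h (e, x)) :
    ∃ k : C(BorelConstruction Γ X, W), ∀ e x, k (borelMk Γ e x) = h (e, x) := by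
  obtain ⟨k, hk⟩ := exists_borel_lift (T := Unit) (h.comp .snd) fun _ => hinv
  exact ⟨k.comp ((ContinuousMap.const _ ()).prodMk (.id _)), fun e x => hk () e x⟩

theorem continuous_twistedMk :
    Continuous fun p : MilnorE Γ × (X × I) => twistedMk Γ φ p.1 p.2.1 p.2.2 :=
  continuous_borelMk (X := X × TwistedInterval φ)

theorem isOpenQuotientMap_twistedMk [ContinuousConstSMul Γ Γ] [ContinuousConstSMul Γ X] :
    IsOpenQuotientMap fun p : MilnorE Γ × (X × I) => twistedMk Γ φ p.1 p.2.1 p.2.2 :=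
  isOpenQuotientMap_borelMk (X := X × TwistedInterval φ)

variable (φ X) in
/-- The subset `EΓ ×_Γ (X × ∂Ĩ)`. -/
abbrev twistedEnds : Set (BorelConstruction Γ (X × TwistedInterval φ)) :=
  borelSubset Γ (twistedBoundary φ (∅ : Set X))

/-- Flipping the interval preserves its pair of endpoints, so the choice of representative does not
matter. -/
theorem twistedMk_mem {e : MilnorE Γ} {x : X} {t : I} :
    twistedMk Γ φ e x t ∈ twistedEnds X φ ↔ t = 0 ∨ t = 1 := by
  constructor
  · rintro ⟨⟨e', x', t'⟩, h, h'⟩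
    obtain ⟨g, -, -, h2⟩ := twistedMk_eq_iff.1 (h'.symm : twistedMk Γ φ e x t = twistedMk Γ φ e' x' t')
    rw [h2]
    exact flipI_boundary (h.resolve_left (Set.notMem_empty _))
  · exact fun h => ⟨(e, (x, t)), Or.inr h, rfl⟩

/-- Families of maps out of `EΓ ×_Γ (X × Ĩ)`. -/
theorem exists_twisted_lift [ContinuousConstSMul Γ Γ] [ContinuousConstSMul Γ X]
    {T W : Type*} [TopologicalSpace T] [TopologicalSpace W]
    (h : C(T × (MilnorE Γ × (X × I)), W))
    (hinv : ∀ s (g : Γ) e x t, h (s, g • e, g • x, flipI (φ g) t) = h (s, e, x, t)) :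
    ∃ k : C(T × BorelConstruction Γ (X × TwistedInterval φ), W),
      ∀ s e x t, k (s, twistedMk Γ φ e x t) = h (s, e, x, t) := by
  obtain ⟨k, hk⟩ := exists_borel_lift (X := X × TwistedInterval φ)
    (show C(T × (MilnorE Γ × (X × TwistedInterval φ)), W) from h)
    fun s g e x => hinv s g e x.1 x.2
  exact ⟨k, fun s e x t => hk s e (x, t)⟩

theorem exists_twisted_map [ContinuousConstSMul Γ Γ] [ContinuousConstSMul Γ X]
    {W : Type*} [TopologicalSpace W] (h : C(MilnorE Γ × (X × I), W))
    (hinv : ∀ (g : Γ) e x t, h (g • e, g • x, flipI (φ g) t) = h (e, x, t)) :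
    ∃ k : C(BorelConstruction Γ (X × TwistedInterval φ), W),
      ∀ e x t, k (twistedMk Γ φ e x t) = h (e, x, t) := by
  obtain ⟨k, hk⟩ := exists_borel_map (X := X × TwistedInterval φ)
    (show C(MilnorE Γ × (X × TwistedInterval φ), W) from h)
    fun g e x => hinv g e x.1 x.2
  exact ⟨k, fun e x t => hk e (x, t)⟩

theorem twistedMap_id_mk {X' : Type*} [TopologicalSpace X'] [MulAction Γ X'] (f : C(X, X'))
    (hf : ∀ (g : Γ) (x : X), f (g • x) = g • f x) (e : MilnorE Γ) (x : X) (t : I) :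
    twistedMap (φ₁ := φ) (φ₂ := φ) (.id Γ) (fun _ => rfl) f hf (twistedMk Γ φ e x t) =
      twistedMk Γ φ e (f x) t :=
  congrArg (fun e => twistedMk Γ φ e (f x) t) (MilnorE.relabel_id e)

/-! ### Homotopy equivalences of Borel constructions -/

variable (F : OmegaSpectrum.{v}) (n : ℤ)

/-- If `EΓ × X → EΓ` is an equivariant homotopy equivalence, then `h^{φ+n}_Γ(pt)` and
`h^{φ+n}_Γ(X)` agree. -/
theorem fromPoint_bijective [ContinuousConstSMul Γ Γ] [ContinuousConstSMul Γ X]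
    (r : C(MilnorE Γ, X)) (hr : ∀ (g : Γ) e, r (g • e) = g • r e)
    (H : C(I × (MilnorE Γ × X), X)) (H0 : ∀ e x, H (0, e, x) = r e) (H1 : ∀ e x, H (1, e, x) = x)
    (hH : ∀ s (g : Γ) e x, H (s, g • e, g • x) = g • H (s, e, x)) :
    Function.Bijective (F.fromPoint n φ X) := by
  have cont : ContinuousConstSMul Γ PUnit.{1} := ⟨fun g => continuous_const⟩
  -- The homotopy inverse is the graph of `r`.
  obtain ⟨k, hk⟩ := exists_twisted_map (φ := φ) (X := PUnit.{1})
    (W := BorelConstruction Γ (X × TwistedInterval φ))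
    ⟨fun p => twistedMk Γ φ p.1 (r p.1) p.2.2, continuous_twistedMk.comp
      (by fun_prop : Continuous fun p : MilnorE Γ × (PUnit.{1} × I) => (p.1, r p.1, p.2.2))⟩
    (fun g e x t => by
      change twistedMk Γ φ (g • e) (r (g • e)) (flipI (φ g) t) = _
      rw [hr, twistedMk_smul]
      rfl)
  obtain ⟨K, hK⟩ := exists_twisted_lift (φ := φ) (X := X) (T := I)
    (W := BorelConstruction Γ (X × TwistedInterval φ))
    ⟨fun p => twistedMk Γ φ p.2.1 (H (p.1, p.2.1, p.2.2.1)) p.2.2.2, continuous_twistedMk.comp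
      (by fun_prop : Continuous fun p : I × (MilnorE Γ × (X × I)) =>
        (p.2.1, H (p.1, p.2.1, p.2.2.1), p.2.2.2))⟩
    (fun s g e x t => by
      change twistedMk Γ φ (g • e) (H (s, g • e, g • x)) (flipI (φ g) t) = _
      rw [hH, twistedMk_smul]
      rfl)
  replace hk : ∀ e x t, k (twistedMk Γ φ e x t) = twistedMk Γ φ e (r e) t := hk
  replace hK : ∀ s e x t, K (s, twistedMk Γ φ e x t) = twistedMk Γ φ e (H (s, e, x)) t := hK
  -- Forgetting the point of `X` after inserting `r e` is the identity, so one of the two homotopies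
  -- is constant (`.snd`).
  refine F.pullback_bijective (n + 1) _ _ k ?_ K ?_ ?_ ?_ .snd ?_ ?_ ?_
  · intro y hy
    obtain ⟨e, x, t, rfl⟩ := twistedMk_surjective y
    rw [hk]
    exact twistedMk_mem.2 (twistedMk_mem.1 hy)
  · intro y
    obtain ⟨e, x, t, rfl⟩ := twistedMk_surjective y
    rw [twistedMap_id_mk, hk, hK, H0]
  · intro y
    obtain ⟨e, x, t, rfl⟩ := twistedMk_surjective y
    rw [hK, H1]
  · intro s y hy
    obtain ⟨e, x, t, rfl⟩ := twistedMk_surjective y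
    rw [hK]
    exact twistedMk_mem.2 (twistedMk_mem.1 hy)
  · intro y
    obtain ⟨e, x, t, rfl⟩ := twistedMk_surjective y
    rw [hk, twistedMap_id_mk]
    rfl
  · exact fun _ => rfl
  · exact fun _ _ hy => hy

/-- The case of `fromPoint_bijective` of a space that contracts equivariantly to a fixed point. -/
theorem fromPoint_bijective_of_fixedPoint [ContinuousConstSMul Γ Γ] [ContinuousConstSMul Γ X]
    (x₀ : X) (hx₀ : ∀ g : Γ, g • x₀ = x₀) (H : C(I × X, X)) (H0 : ∀ x, H (0, x) = x₀)
    (H1 : ∀ x, H (1, x) = x) (hH : ∀ s (g : Γ) x, H (s, g • x) = g • H (s, x)) :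
    Function.Bijective (F.fromPoint n φ X) :=
  fromPoint_bijective F n (.const _ x₀) (fun g _ => (hx₀ g).symm)
    (H.comp ⟨fun p => (p.1, p.2.2), by fun_prop⟩) (fun _ x => H0 x) (fun _ x => H1 x)
    fun s g _ x => hH s g x

/-! ### Functoriality of twisted cohomology -/

variable {Γ₁ Γ₂ Γ₃ : Type*} [Group Γ₁] [TopologicalSpace Γ₁] [Group Γ₂] [TopologicalSpace Γ₂]
  [Group Γ₃] [TopologicalSpace Γ₃] {X₁ X₂ X₃ : Type*} [TopologicalSpace X₁] [TopologicalSpace X₂]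
  [TopologicalSpace X₃] [MulAction Γ₁ X₁] [MulAction Γ₂ X₂] [MulAction Γ₃ X₃]
  {φ₁ : Γ₁ →ₜ* ℤˣ} {φ₂ : Γ₂ →ₜ* ℤˣ} {φ₃ : Γ₃ →ₜ* ℤˣ}

theorem twistedPullback_twistedPullback (ψ : Γ₁ →ₜ* Γ₂) (hψ : ∀ g, φ₂ (ψ g) = φ₁ g)
    (f : C(X₁, X₂)) (hf : ∀ (g : Γ₁) (x : X₁), f (g • x) = ψ g • f x) (ψ' : Γ₂ →ₜ* Γ₃)
    (hψ' : ∀ g, φ₃ (ψ' g) = φ₂ g) (f' : C(X₂, X₃))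
    (hf' : ∀ (g : Γ₂) (x : X₂), f' (g • x) = ψ' g • f' x) (a : F.twistedCoh n φ₃ X₃ ∅) :
    F.twistedPullback n ψ hψ f hf (F.twistedPullback n ψ' hψ' f' hf' a) =
      F.twistedPullback n (ψ'.comp ψ) (fun g => (hψ' (ψ g)).trans (hψ g)) (f'.comp f)
        (fun g x => (congrArg f' (hf g x)).trans (hf' (ψ g) (f x))) a := by
  refine (F.pullback_comp_apply (n + 1) _ _ _ _ a).trans (F.pullback_congr (n + 1) _ _ ?_ a)
  intro y
  obtain ⟨e, x, t, rfl⟩ := twistedMk_surjective y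
  refine congrArg (fun e => twistedMk Γ₃ φ₃ e (f' (f x)) t) ?_
  exact MilnorE.relabel_relabel ψ ψ' e

theorem twistedPullback_congr {ψ ψ' : Γ₁ →ₜ* Γ₂} {hψ : ∀ g, φ₂ (ψ g) = φ₁ g}
    {hψ' : ∀ g, φ₂ (ψ' g) = φ₁ g} {f f' : C(X₁, X₂)}
    {hf : ∀ (g : Γ₁) (x : X₁), f (g • x) = ψ g • f x}
    {hf' : ∀ (g : Γ₁) (x : X₁), f' (g • x) = ψ' g • f' x} (h : ∀ g, ψ g = ψ' g)
    (h' : ∀ x, f x = f' x) (a : F.twistedCoh n φ₂ X₂ ∅) :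
    F.twistedPullback n ψ hψ f hf a = F.twistedPullback n ψ' hψ' f' hf' a := by
  obtain rfl : ψ = ψ' := ContinuousMonoidHom.ext h
  obtain rfl : f = f' := ContinuousMap.ext h'
  rfl

end Borel

/-! ### Continuity of the actions -/

instance {Γ X : Type*} [Group Γ] [TopologicalSpace X] [MulAction Γ X] [ContinuousConstSMul Γ X]
    (S : SubMulAction Γ X) : ContinuousConstSMul Γ S :=
  ⟨fun g => ((continuous_const_smul g).comp continuous_subtype_val).subtype_mk _⟩

instance : DiscreteTopology LineGroup := ⟨rfl⟩

theorem continuous_flipI_uncurry : Continuous fun p : ℤˣ × I => flipI p.1 p.2 :=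
  continuous_prod_of_discrete_left.2 continuous_flipI

section

variable (G : Type u) [Group G] [TopologicalSpace G]

instance : ContinuousConstSMul (G × ℤˣ) (ReflCircle G) :=
  ⟨fun p => continuous_zpow (G := Circle) (p.2 : ℤ)⟩

instance : ContinuousConstSMul (G × LineGroup) (SymLine G) :=
  ⟨fun p => by
    have h : Continuous fun x : ℝ =>
      ((p.2.left.toAdd : ℤ) : ℝ) + ((p.2.right : ℤ) : ℝ) * x := by fun_prop
    exact h⟩

instance [IsTopologicalGroup G] : ContinuousConstSMul (G × LineGroup) (G × LineGroup) :=
  ⟨fun p => (continuous_const_smul p.1).prodMap continuous_of_discreteTopology⟩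

/-! ### The two points of `U ∩ V` -/

/-- The sign of the imaginary part of a point of `U ∩ V = {i, -i}`. -/
def imSign (a : arcUV G) : ℤˣ := if 0 < (show Circle from a.1 : ℂ).im then 1 else -1

variable {G}

theorem re_arcUV (a : arcUV G) : (show Circle from a.1 : ℂ).re = 0 := le_antisymm a.2.2 a.2.1

theorem im_arcUV (a : arcUV G) :
    (show Circle from a.1 : ℂ).im = 1 ∨ (show Circle from a.1 : ℂ).im = -1 := by
  have h := Circle.normSq_coe (show Circle from a.1)
  rw [Complex.normSq_apply, re_arcUV, mul_zero, zero_add] at h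
  exact mul_self_eq_one_iff.1 h

theorem im_arcUV_eq (a : arcUV G) : (show Circle from a.1 : ℂ).im = ((imSign G a : ℤ) : ℝ) := by
  unfold imSign
  rcases im_arcUV a with h | h <;> rw [h] <;> norm_num

theorem arcUV_ext {a b : arcUV G} (h : imSign G a = imSign G b) : a = b := by
  refine Subtype.ext (Circle.ext (Complex.ext ?_ ?_))
  · exact (re_arcUV a).trans (re_arcUV b).symm
  · exact (im_arcUV_eq a).trans (h ▸ (im_arcUV_eq b).symm)

theorem im_zpow_units (z : Circle) (u : ℤˣ) :
    ((z ^ (u : ℤ) : Circle) : ℂ).im = ((u : ℤ) : ℝ) * (z : ℂ).im := by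
  rcases Int.units_eq_one_or u with rfl | rfl <;> simp

theorem imSign_smul (γ : G × ℤˣ) (a : arcUV G) : imSign G (γ • a) = γ.2 * imSign G a := by
  have h : (((imSign G (γ • a) : ℤ)) : ℝ) = ((γ.2 : ℤ) : ℝ) * ((imSign G a : ℤ) : ℝ) := by
    rw [← im_arcUV_eq, ← im_arcUV_eq]
    exact im_zpow_units (show Circle from a.1) γ.2
  refine Units.ext ?_
  exact_mod_cast h

theorem imSign_pointI : imSign G (pointI G) = 1 := by
  refine if_pos ?_
  change 0 < Complex.I.im
  simp

/-- `{i, -i}` is the single orbit `(G × ℤ₂^R) / G`, and the sign names the element of `ℤ₂^R` that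
carries `i` to `a`. -/
theorem imSign_smul_pointI (g : G) (a : arcUV G) :
    a = ((g, imSign G a) : G × ℤˣ) • pointI G :=
  arcUV_ext (by rw [imSign_smul, imSign_pointI, mul_one])

theorem continuous_imSign : Continuous (imSign G) := by
  have him : Continuous fun a : arcUV G => (show Circle from a.1 : ℂ).im := by
    have h : Continuous fun z : Circle => (z : ℂ).im := by fun_prop
    exact h.comp (continuous_subtype_val (p := fun z : ReflCircle G => z ∈ arcUV G))
  refine continuous_iff_continuousAt.2 fun a => ?_
  refine continuousAt_const.congr (f := fun _ => imSign G a) ?_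
  rcases im_arcUV a with h | h
  · filter_upwards [(isOpen_lt continuous_const him).mem_nhds
      (show (0 : ℝ) < (show Circle from a.1 : ℂ).im by rw [h]; norm_num)] with b hb
    exact (if_pos (by rw [h]; norm_num)).trans (if_pos hb).symm
  · filter_upwards [(isOpen_lt him continuous_const).mem_nhds
      (show (show Circle from a.1 : ℂ).im < 0 by rw [h]; norm_num)] with b hb
    exact (if_neg (by rw [h]; norm_num)).trans (if_neg (not_lt.2 (le_of_lt hb))).symm

/-- Replacing all second components of the labels by `u`. -/
def setSign (u : ℤˣ) (e : MilnorE (G × ℤˣ)) : MilnorE (G × ℤˣ) :=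
  MilnorE.relabel (fun γ => (γ.1, u)) e

theorem continuous_setSign :
    Continuous fun p : ℤˣ × MilnorE (G × ℤˣ) => setSign p.1 p.2 :=
  continuous_prod_of_discrete_left.2 fun _ =>
    MilnorE.continuous_relabel (continuous_fst.prodMk continuous_const)

/-- With `u = imSign G a`, overwriting the signs is equivariant jointly in the point `a` and in `e`.
-/
theorem setSign_smul (γ : G × ℤˣ) (u : ℤˣ) (e : MilnorE (G × ℤˣ)) :
    setSign (γ.2 * u) (γ • e) = γ • setSign u e :=
  (MilnorE.relabel_relabel (fun δ => γ * δ) (fun γ' => (γ'.1, γ.2 * u)) e).trans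
    (MilnorE.relabel_relabel (fun γ' => (γ'.1, u)) (fun δ => γ * δ) e).symm

variable (F : OmegaSpectrum.{v}) (n : ℤ) (φ : G →ₜ* ℤˣ)

/-- Cohomology of an orbit is that of its stabilizer. The inverse moves every point to `i`, keeping
the `G`-components of the labels. The change of the `E`-coordinate that remains is undone by the
homotopy of the two projections. -/
theorem twoPointsToG_bijective [IsTopologicalGroup G] :
    Function.Bijective (twoPointsToG F n φ) := by
  obtain ⟨C, C0, C1, hC⟩ := MilnorE.exists_homotopy (G × ℤˣ)
  have hfst : Continuous (MilnorE.relabel (Prod.fst : G × ℤˣ → G)) :=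
    MilnorE.continuous_relabel continuous_fst
  -- Moving `-i` to `i` uses the reflection, which also flips the twisted interval; hence the factor
  -- `flipI (imSign G a)`.
  obtain ⟨k, hk⟩ := exists_twisted_map (φ := pointTwist φ) (X := arcUV G)
    (W := BorelConstruction G (PUnit.{1} × TwistedInterval φ))
    ⟨fun p => twistedMk G φ (MilnorE.relabel Prod.fst p.1) PUnit.unit
        (flipI (imSign G p.2.1) p.2.2),
      continuous_twistedMk.comp ((hfst.comp continuous_fst).prodMk (continuous_const.prodMk
        (continuous_flipI_uncurry.comp ((continuous_imSign.comp
          (continuous_fst.comp continuous_snd)).prodMk (continuous_snd.comp continuous_snd)))))⟩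
    (fun γ e a t => by
      refine twistedMk_eq_iff.2 ⟨γ.1, ?_, rfl, ?_⟩
      · exact MilnorE.relabel_smul (MonoidHom.fst G ℤˣ) γ e
      · change flipI (imSign G (γ • a)) (flipI (φ γ.1 * γ.2) t) =
          flipI (φ γ.1) (flipI (imSign G a) t)
        rw [imSign_smul, ← flipI_mul, ← flipI_mul]
        congr 1
        rw [mul_comm (φ γ.1), mul_mul_mul_comm, Int.units_mul_self, one_mul, mul_comm])
  replace hk : ∀ e a t, k (twistedMk (G × ℤˣ) (pointTwist φ) e a t) =
    twistedMk G φ (MilnorE.relabel Prod.fst e) PUnit.unit (flipI (imSign G a) t) := hk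
  -- The composite on the two points replaces `e` by `setSign (imSign G a) e`, up to the group
  -- action, and `C` connects this to `e`.
  obtain ⟨K, hK⟩ := exists_twisted_lift (φ := pointTwist φ) (X := arcUV G) (T := I)
    (W := BorelConstruction (G × ℤˣ) (arcUV G × TwistedInterval (pointTwist φ)))
    ⟨fun p => twistedMk (G × ℤˣ) (pointTwist φ)
        (C (p.1, setSign (imSign G p.2.2.1) p.2.1, p.2.1)) p.2.2.1 p.2.2.2,
      continuous_twistedMk.comp (Continuous.prodMk (C.continuous.comp (continuous_fst.prodMk
        (Continuous.prodMk (continuous_setSign.comp (Continuous.prodMk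
          (continuous_imSign.comp (by fun_prop)) (by fun_prop))) (by fun_prop)))) (by fun_prop))⟩
    (fun s γ e a t => by
      change twistedMk _ _ (C (s, setSign (imSign G (γ • a)) (γ • e), γ • e)) (γ • a)
        (flipI (pointTwist φ γ) t) = twistedMk _ _ (C (s, setSign (imSign G a) e, e)) a t
      rw [imSign_smul, setSign_smul, hC, twistedMk_smul])
  replace hK : ∀ s e a t, K (s, twistedMk (G × ℤˣ) (pointTwist φ) e a t) =
    twistedMk (G × ℤˣ) (pointTwist φ) (C (s, setSign (imSign G a) e, e)) a t := hK
  refine F.pullback_bijective (n + 1) _ _ k ?_ .snd ?_ ?_ ?_ K ?_ ?_ ?_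
  · intro y hy
    obtain ⟨e, a, t, rfl⟩ := twistedMk_surjective y
    rw [hk]
    exact twistedMk_mem.2 (flipI_boundary (twistedMk_mem.1 hy))
  · intro y
    obtain ⟨e, x, t, rfl⟩ := twistedMk_surjective y
    change twistedMk G φ e x t = k (twistedMk (G × ℤˣ) (pointTwist φ)
      (MilnorE.relabel (inclG G) e) (pointI G) t)
    rw [hk, imSign_pointI, flipI_one]
    exact congrArg (fun e => twistedMk G φ e PUnit.unit t)
      ((MilnorE.relabel_relabel (inclG G) Prod.fst e).trans (MilnorE.relabel_id e)).symm
  · exact fun _ => rfl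
  · exact fun _ _ hy => hy
  · intro y
    obtain ⟨e, a, t, rfl⟩ := twistedMk_surjective y
    rw [hk, hK, C0]
    change _ = twistedMk (G × ℤˣ) (pointTwist φ)
      (MilnorE.relabel (inclG G) (MilnorE.relabel Prod.fst e)) (pointI G) (flipI (imSign G a) t)
    -- The representative based at `i` has all signs equal to `1`; acting by `(1, imSign G a)`
    -- returns it to `a`.
    refine twistedMk_eq_iff.2 ⟨(1, imSign G a), ?_, imSign_smul_pointI 1 a, ?_⟩
    · refine Eq.trans ?_ ((MilnorE.relabel_relabel _ _ _).trans
        (MilnorE.relabel_relabel _ _ e)).symm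
      refine congrArg (fun f => MilnorE.relabel f e) (funext fun γ => ?_)
      exact Prod.ext (one_mul γ.1).symm (mul_one (imSign G a)).symm
    · change t = flipI (φ 1 * imSign G a) (flipI (imSign G a) t)
      rw [map_one, one_mul, ← flipI_mul, Int.units_mul_self, flipI_one]
  · intro y
    obtain ⟨e, a, t, rfl⟩ := twistedMk_surjective y
    rw [hK, C1]
  · intro s y hy
    obtain ⟨e, a, t, rfl⟩ := twistedMk_surjective y
    rw [hK]
    exact twistedMk_mem.2 (twistedMk_mem.1 hy)

/-! ### The line -/

/-- The translation part of a label transforms by the same affine formula as a point of the line, so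
its average is an equivariant map `EΓ → ℝ`. The action is affine, so straight lines from this
average to any point are equivariant. -/
theorem fromPoint_symLine_bijective [IsTopologicalGroup G] :
    Function.Bijective (F.fromPoint n (lineTwist φ) (SymLine G)) := by
  let l : G × LineGroup → ℝ := fun γ => ((γ.2.left.toAdd : ℤ) : ℝ)
  have hl : Continuous l :=
    (continuous_of_discreteTopology (f := fun x : LineGroup => ((x.left.toAdd : ℤ) : ℝ))).comp
      continuous_snd
  have hr : ∀ (γ : G × LineGroup) (e : MilnorE (G × LineGroup)),
      MilnorE.average l (γ • e) =
        ((γ.2.left.toAdd : ℤ) : ℝ) + ((γ.2.right : ℤ) : ℝ) * MilnorE.average l e := by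
    intro γ e
    refine MilnorE.average_smul (fun γ' => ?_) e
    change (((γ.2.left * γ'.2.left ^ (γ.2.right : ℤ)).toAdd : ℤ) : ℝ) = _
    simp [l]
  have hH : Continuous fun p : I × (MilnorE (G × LineGroup) × ℝ) =>
      (1 - (p.1 : ℝ)) * MilnorE.average l p.2.1 + p.1 * p.2.2 := by
    have := (MilnorE.continuous_average hl).comp
      (continuous_fst.comp continuous_snd : Continuous fun p : I × (MilnorE (G × LineGroup) × ℝ) =>
        p.2.1)
    exact Continuous.add (Continuous.mul (by fun_prop) this) (by fun_prop)
  refine fromPoint_bijective (X := SymLine G) F n ⟨MilnorE.average l, MilnorE.continuous_average hl⟩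
    hr ⟨_, hH⟩ (fun e x => ?_) (fun e x => ?_) (fun s γ e x => ?_)
  · have h : ∀ x : ℝ, (1 - ((0 : I) : ℝ)) * MilnorE.average l e + ((0 : I) : ℝ) * x =
      MilnorE.average l e := fun x => by simp
    exact h x
  · have h : ∀ x : ℝ, (1 - ((1 : I) : ℝ)) * MilnorE.average l e + ((1 : I) : ℝ) * x = x :=
      fun x => by simp
    exact h x
  · have h : ∀ x : ℝ, (1 - (s : ℝ)) * MilnorE.average l (γ • e) +
        s * (((γ.2.left.toAdd : ℤ) : ℝ) + ((γ.2.right : ℤ) : ℝ) * x) =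
        ((γ.2.left.toAdd : ℤ) : ℝ) + ((γ.2.right : ℤ) : ℝ) *
          ((1 - (s : ℝ)) * MilnorE.average l e + s * x) := fun x => by
      rw [hr]
      ring
    exact h x

/-! ### The covering of the circle by the line -/

theorem isOpenQuotientMap_lineToCircle : IsOpenQuotientMap (lineToCircle G) := by
  refine ⟨fun z => ?_, (lineToCircle G).continuous, ?_⟩
  · obtain ⟨y, hy⟩ := Circle.exp_surjective (show Circle from z)
    refine ⟨(y / (2 * Real.pi) : ℝ), ?_⟩
    change Circle.exp (2 * Real.pi * (y / (2 * Real.pi))) = _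
    rw [mul_div_cancel₀ y Real.two_pi_pos.ne', hy]
  · exact isLocalHomeomorph_circleExp.isOpenMap.comp
      (Homeomorph.mulLeft₀ (2 * Real.pi) Real.two_pi_pos.ne').isOpenMap

theorem lineToCircle_eq {x y : ℝ} {γ : G × ℤˣ}
    (h : lineToCircle G x = γ • lineToCircle G y) :
    ∃ m : ℤ, x = m + ((γ.2 : ℤ) : ℝ) * y := by
  have h' : Circle.exp (2 * Real.pi * x) = Circle.exp (2 * Real.pi * y) ^ (γ.2 : ℤ) := h
  rw [← Circle.exp_zsmul, Circle.exp_eq_exp] at h'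
  obtain ⟨m, hm⟩ := h'
  refine ⟨m, mul_left_cancel₀ Real.two_pi_pos.ne' (hm.trans ?_)⟩
  rw [zsmul_eq_mul]
  ring

variable {φ}

theorem twistedMk_circle_surjective
    (y : BorelConstruction (G × ℤˣ) (ReflCircle G × TwistedInterval (pointTwist φ))) :
    ∃ e x t, twistedMk (G × ℤˣ) (pointTwist φ) e (lineToCircle G x) t = y := by
  obtain ⟨e, z, t, rfl⟩ := twistedMk_surjective y
  obtain ⟨x, rfl⟩ := isOpenQuotientMap_lineToCircle.surjective z
  exact ⟨e, x, t, rfl⟩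

/-- Families of maps out of `E(G × ℤ₂^R) ×_{G × ℤ₂^R} (S¹ × Ĩ)`, with the circle as a quotient of
the line. -/
theorem exists_circle_lift [IsTopologicalGroup G] {T W : Type*} [TopologicalSpace T]
    [TopologicalSpace W] (h : C(T × (MilnorE (G × ℤˣ) × (ℝ × I)), W))
    (hinv : ∀ s (g : G) (m : ℤ) (u : ℤˣ) e x t,
      h (s, ((g, u) : G × ℤˣ) • e, m + ((u : ℤ) : ℝ) * x, flipI (φ g * u) t) = h (s, e, x, t)) :
    ∃ k : C(T × BorelConstruction (G × ℤˣ) (ReflCircle G × TwistedInterval (pointTwist φ)), W),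
      ∀ s e (x : ℝ) t,
        k (s, twistedMk (G × ℤˣ) (pointTwist φ) e (lineToCircle G x) t) = h (s, e, x, t) := by
  obtain ⟨k, hk⟩ := exists_lift_of_isOpenQuotientMap
    ((isOpenQuotientMap_twistedMk (φ := pointTwist φ)).comp (IsOpenQuotientMap.id.prodMap
      ((isOpenQuotientMap_lineToCircle (G := G)).prodMap IsOpenQuotientMap.id))) h (by
    rintro s ⟨e, x, t⟩ ⟨e', x', t'⟩ hp
    obtain ⟨⟨g, u⟩, rfl, h2, rfl⟩ := twistedMk_eq_iff.1 hp
    obtain ⟨m, rfl⟩ := lineToCircle_eq h2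
    exact hinv s g m u e' x' t')
  exact ⟨k, fun s e x t => hk s (e, x, t)⟩

theorem relabel_projPointGroup_unwind_smul (g : G) (m : ℤ) (u : ℤˣ) (e : MilnorE (G × ℤˣ)) (x : ℝ) :
    MilnorE.relabel (projPointGroup G)
      (MilnorE.unwind (((g, u) : G × ℤˣ) • e) (m + ((u : ℤ) : ℝ) * x)) =
    ((g, u) : G × ℤˣ) • MilnorE.relabel (projPointGroup G) (MilnorE.unwind e x) := by
  rw [MilnorE.unwind_smul]
  exact MilnorE.relabel_smul (projPointGroup G).toMonoidHom _ _

variable (φ)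

/-- The translations act freely on the line with quotient the circle. An inverse must lift labels
from the point group to the line group, consistently for all lifts `x` of a point of the circle, and
`unwind` does this. Both composites fix the space and interval coordinates and alter only the
`E`-coordinate. -/
theorem circleToLine_bijective [IsTopologicalGroup G] :
    Function.Bijective (circleToLine F n φ) := by
  obtain ⟨C, C0, C1, hC⟩ := MilnorE.exists_homotopy (G × ℤˣ)
  obtain ⟨C', C0', C1', hC'⟩ := MilnorE.exists_homotopy (G × LineGroup)
  have hproj : Continuous (MilnorE.relabel (projPointGroup G)) :=
    MilnorE.continuous_relabel (projPointGroup G).continuous_toFun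
  -- Another lift of the same point of the circle changes the unwound labels and `x` by one common
  -- element of the line group, so the class does not change.
  obtain ⟨k, hk⟩ := exists_circle_lift (φ := φ) (T := Unit)
    (W := BorelConstruction (G × LineGroup) (SymLine G × TwistedInterval (lineTwist φ)))
    ⟨fun p => twistedMk (G × LineGroup) (lineTwist φ) (MilnorE.unwind p.2.1 p.2.2.1)
        (show SymLine G from p.2.2.1) p.2.2.2,
      (continuous_twistedMk (X := SymLine G)).comp (Continuous.prodMk
        (MilnorE.continuous_unwind.comp (Continuous.prodMk (by fun_prop) (by fun_prop)))
        (continuous_snd.comp continuous_snd))⟩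
    (fun s g m u e x t => by
      refine twistedMk_eq_iff.2 ⟨(g, ⟨Multiplicative.ofAdd m, u⟩), ?_, rfl, rfl⟩
      exact MilnorE.unwind_smul g m u e x)
  replace hk : ∀ e (x : ℝ) t, k ((), twistedMk (G × ℤˣ) (pointTwist φ) e (lineToCircle G x) t) =
    twistedMk (G × LineGroup) (lineTwist φ) (MilnorE.unwind e x) (show SymLine G from x) t :=
    fun e x t => hk () e x t
  -- Over the line: from the projected and unwound labels to the given ones.
  obtain ⟨H, hH⟩ := exists_twisted_lift (φ := lineTwist φ) (X := SymLine G) (T := I)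
    (W := BorelConstruction (G × LineGroup) (SymLine G × TwistedInterval (lineTwist φ)))
    (show C(I × (MilnorE (G × LineGroup) × (SymLine G × I)), _) from
      ⟨fun p => twistedMk (G × LineGroup) (lineTwist φ)
        (C' (p.1, MilnorE.unwind (MilnorE.relabel (projPointGroup G) p.2.1) p.2.2.1, p.2.1))
        p.2.2.1 p.2.2.2,
      continuous_twistedMk.comp (Continuous.prodMk (C'.continuous.comp (continuous_fst.prodMk
        (Continuous.prodMk (MilnorE.continuous_unwind.comp (Continuous.prodMk
          (hproj.comp (by fun_prop)) (continuous_fst.comp (continuous_snd.comp continuous_snd))))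
          (by fun_prop)))) (by fun_prop))⟩)
    (fun s γ e x t => by
      refine twistedMk_eq_iff.2 ⟨γ, ?_, rfl, rfl⟩
      refine Eq.trans ?_ (hC' γ s _ e)
      refine congrArg (fun e' => C' (s, e', γ • e)) ?_
      refine Eq.trans (congrArg (fun e' => MilnorE.unwind e' _)
        (MilnorE.relabel_smul (projPointGroup G).toMonoidHom γ e)) ?_
      exact MilnorE.unwind_smul γ.1 γ.2.left.toAdd γ.2.right _ _)
  replace hH : ∀ s e (x : ℝ) t, H (s, twistedMk (G × LineGroup) (lineTwist φ) e
      (show SymLine G from x) t) = twistedMk (G × LineGroup) (lineTwist φ)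
        (C' (s, MilnorE.unwind (MilnorE.relabel (projPointGroup G) e) x, e))
        (show SymLine G from x) t := hH
  -- Over the circle: from the unwound and projected labels to the given ones. Projection undoes the
  -- rounding but leaves the labels doubled over even and odd indices, so a homotopy is still
  -- needed.
  obtain ⟨K, hK⟩ := exists_circle_lift (φ := φ) (T := I)
    (W := BorelConstruction (G × ℤˣ) (ReflCircle G × TwistedInterval (pointTwist φ)))
    ⟨fun p => twistedMk (G × ℤˣ) (pointTwist φ)
        (C (p.1, MilnorE.relabel (projPointGroup G) (MilnorE.unwind p.2.1 p.2.2.1), p.2.1))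
        (lineToCircle G p.2.2.1) p.2.2.2,
      continuous_twistedMk.comp (Continuous.prodMk (C.continuous.comp (continuous_fst.prodMk
        (Continuous.prodMk (hproj.comp (MilnorE.continuous_unwind.comp
          (Continuous.prodMk (by fun_prop) (by fun_prop)))) (by fun_prop))))
        (Continuous.prodMk ((lineToCircle G).continuous.comp
          (continuous_fst.comp (continuous_snd.comp continuous_snd)))
          (continuous_snd.comp (continuous_snd.comp continuous_snd))))⟩
    (fun s g m u e x t => by
      refine twistedMk_eq_iff.2 ⟨(g, u), ?_, ?_, rfl⟩
      · refine Eq.trans ?_ (hC (g, u) s _ e)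
        exact congrArg (fun e' => C (s, e', ((g, u) : G × ℤˣ) • e))
          (relabel_projPointGroup_unwind_smul g m u e x)
      · exact lineToCircle_smul G (g, ⟨Multiplicative.ofAdd m, u⟩) x)
  replace hK : ∀ s e (x : ℝ) t, K (s, twistedMk (G × ℤˣ) (pointTwist φ) e (lineToCircle G x) t) =
    twistedMk (G × ℤˣ) (pointTwist φ)
      (C (s, MilnorE.relabel (projPointGroup G) (MilnorE.unwind e x), e)) (lineToCircle G x) t := hK
  refine F.pullback_bijective (n + 1) _ _
    (k.comp ((ContinuousMap.const _ ()).prodMk (.id _))) ?_ H ?_ ?_ ?_ K ?_ ?_ ?_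
  · intro y hy
    obtain ⟨e, x, t, rfl⟩ := twistedMk_circle_surjective y
    exact (hk e x t).symm ▸ twistedMk_mem.2 (twistedMk_mem.1 hy)
  · intro y
    obtain ⟨e, x, t, rfl⟩ := twistedMk_surjective y
    refine (hH 0 e x t).trans (Eq.trans ?_ (hk (MilnorE.relabel (projPointGroup G) e) x t).symm)
    rw [C0']
  · intro y
    obtain ⟨e, x, t, rfl⟩ := twistedMk_surjective y
    refine (hH 1 e x t).trans ?_
    rw [C1']
  · intro s y hy
    obtain ⟨e, x, t, rfl⟩ := twistedMk_surjective y
    exact (hH s e x t).symm ▸ twistedMk_mem.2 (twistedMk_mem.1 hy)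
  · intro y
    obtain ⟨e, x, t, rfl⟩ := twistedMk_circle_surjective y
    refine (hK 0 e x t).trans ?_
    rw [C0]
    exact (congrArg (twistedMap (φ₁ := lineTwist φ) (φ₂ := pointTwist φ) (projPointGroup G)
      (fun _ => rfl) (lineToCircle G) (lineToCircle_smul G)) (hk e x t)).symm
  · intro y
    obtain ⟨e, x, t, rfl⟩ := twistedMk_circle_surjective y
    refine (hK 1 e x t).trans ?_
    rw [C1]
  · intro s y hy
    obtain ⟨e, x, t, rfl⟩ := twistedMk_circle_surjective y
    exact (hK s e x t).symm ▸ twistedMk_mem.2 (twistedMk_mem.1 hy)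

end

/-! ### Bicollared covers of Borel constructions -/

section BorelCover

variable {Γ : Type*} [Group Γ] [TopologicalSpace Γ] {X : Type*} [TopologicalSpace X]
  [MulAction Γ X] (φ : Γ →ₜ* ℤˣ)

/-- The map `EΓ ×_Γ (S × Ĩ) → EΓ ×_Γ (X × Ĩ)` induced by the inclusion of an invariant subspace. -/
abbrev twistedIncl (S : SubMulAction Γ X) :
    C(BorelConstruction Γ (S × TwistedInterval φ), BorelConstruction Γ (X × TwistedInterval φ)) :=
  twistedMap (.id Γ) (fun _ => rfl) (subIncl S) (fun _ _ => rfl)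

/-- The map `EΓ ×_Γ (S × Ĩ) → EΓ ×_Γ (T × Ĩ)` induced by an inclusion of invariant subspaces. -/
abbrev twistedInclLE {S T : SubMulAction Γ X} (h : S ≤ T) :
    C(BorelConstruction Γ (S × TwistedInterval φ), BorelConstruction Γ (T × TwistedInterval φ)) :=
  twistedMap (.id Γ) (fun _ => rfl) (subInclLE h) (fun _ _ => rfl)

variable {φ}

theorem twistedIncl_mk (S : SubMulAction Γ X) (e : MilnorE Γ) (x : S) (t : I) :
    twistedIncl φ S (twistedMk Γ φ e x t) = twistedMk Γ φ e x.1 t :=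
  twistedMap_id_mk (subIncl S) (fun _ _ => rfl) e x t

theorem twistedInclLE_mk {S T : SubMulAction Γ X} (h : S ≤ T) (e : MilnorE Γ) (x : S) (t : I) :
    twistedInclLE φ h (twistedMk Γ φ e x t) = twistedMk Γ φ e (Set.inclusion h x) t :=
  twistedMap_id_mk (subInclLE h) (fun _ _ => rfl) e x t

theorem twistedIncl_twistedInclLE {S T : SubMulAction Γ X} (h : S ≤ T)
    (y : BorelConstruction Γ (S × TwistedInterval φ)) :
    twistedIncl φ T (twistedInclLE φ h y) = twistedIncl φ S y := by
  obtain ⟨e, x, t, rfl⟩ := twistedMk_surjective y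
  rw [twistedInclLE_mk, twistedIncl_mk, twistedIncl_mk]

theorem twistedMk_mem_range_twistedIncl (S : SubMulAction Γ X) {e : MilnorE Γ} {x : X} {t : I} :
    twistedMk Γ φ e x t ∈ Set.range (twistedIncl φ S) ↔ x ∈ S := by
  refine ⟨?_, fun hx => ⟨twistedMk Γ φ e ⟨x, hx⟩ t, twistedIncl_mk S e ⟨x, hx⟩ t⟩⟩
  rintro ⟨y, hy⟩
  obtain ⟨e', x', t', rfl⟩ := twistedMk_surjective y
  rw [twistedIncl_mk] at hy
  obtain ⟨g, -, h, -⟩ := twistedMk_eq_iff.1 hy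
  exact (S.smul_mem_iff' g).1 (h ▸ x'.2)

theorem twistedIncl_mem (S : SubMulAction Γ X) (y : BorelConstruction Γ (S × TwistedInterval φ)) :
    y ∈ twistedEnds S φ ↔ twistedIncl φ S y ∈ twistedEnds X φ := by
  obtain ⟨e, x, t, rfl⟩ := twistedMk_surjective y
  rw [twistedIncl_mk, twistedMk_mem, twistedMk_mem]

/-- A quotient of a subspace need not be a subspace of the quotient. Here `S` is closed and
invariant, so the preimage in `EΓ × X × I` of the image of a closed set is the preimage upstairs
over `S`, which is closed. -/
theorem isClosedEmbedding_twistedIncl [ContinuousConstSMul Γ Γ] [ContinuousConstSMul Γ X]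
    (S : SubMulAction Γ X) (hS : IsClosed (S : Set X)) :
    Topology.IsClosedEmbedding (twistedIncl φ S) := by
  have inj : Function.Injective (twistedIncl φ S) := by
    intro y y' h
    obtain ⟨e, x, t, rfl⟩ := twistedMk_surjective y
    obtain ⟨e', x', t', rfl⟩ := twistedMk_surjective y'
    rw [twistedIncl_mk, twistedIncl_mk] at h
    obtain ⟨g, h1, h2, h3⟩ := twistedMk_eq_iff.1 h
    exact twistedMk_eq_iff.2 ⟨g, h1, Subtype.ext h2, h3⟩
  refine .of_continuous_injective_isClosedMap (twistedIncl φ S).continuous inj fun K hK => ?_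
  have hj : Topology.IsClosedEmbedding
      (Prod.map id (Prod.map Subtype.val id) : MilnorE Γ × (S × I) → MilnorE Γ × (X × I)) :=
    Topology.IsClosedEmbedding.id.prodMap
      (hS.isClosedEmbedding_subtypeVal.prodMap Topology.IsClosedEmbedding.id)
  refine (isOpenQuotientMap_twistedMk (φ := φ)).isQuotientMap.isClosed_preimage.1 ?_
  convert hj.isClosedMap _ (hK.preimage (continuous_twistedMk (φ := φ))) using 1
  ext ⟨e, x, t⟩
  constructor
  · rintro ⟨y, hy, h⟩
    have hx : x ∈ S := (twistedMk_mem_range_twistedIncl S).1 ⟨y, h⟩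
    obtain rfl : y = twistedMk Γ φ e ⟨x, hx⟩ t := inj (h.trans (twistedIncl_mk S e ⟨x, hx⟩ t).symm)
    exact ⟨(e, ⟨x, hx⟩, t), hy, rfl⟩
  · rintro ⟨⟨e', x', t'⟩, h, h'⟩
    obtain ⟨rfl, h''⟩ := Prod.ext_iff.1 h'
    obtain ⟨rfl, rfl⟩ := Prod.ext_iff.1 h''
    exact ⟨_, h, twistedIncl_mk S _ _ _⟩

/-- An equivariantly bicollared cover of `X` induces a bicollared cover of `EΓ ×_Γ (X × Ĩ)`. -/
theorem nonempty_bicollaredCover_twisted [ContinuousConstSMul Γ Γ] [ContinuousConstSMul Γ X]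
    (U V : SubMulAction Γ X) (c : C(X, ℝ)) (hc : ∀ (g : Γ) x, c (g • x) = c x)
    (hU : ∀ x, x ∈ U ↔ 0 ≤ c x) (hV : ∀ x, x ∈ V ↔ c x ≤ 0)
    (p : C(I × X, X)) (hp : ∀ s (g : Γ) x, p (s, g • x) = g • p (s, x))
    (p_zero : ∀ x, p (0, x) = x) (p_nonneg : ∀ s x, 0 ≤ c x → 0 ≤ c (p (s, x)))
    (p_nonpos : ∀ s x, c x ≤ 0 → c (p (s, x)) ≤ 0) (p_one : ∀ x, |c x| ≤ 1 → c (p (1, x)) = 0)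
    (p_one_of_eq_zero : ∀ x, c x = 0 → p (1, x) = x) :
    Nonempty (BicollaredCover (twistedEnds X φ) (twistedEnds U φ) (twistedEnds V φ)
      (twistedEnds ↥(U ⊓ V) φ) (twistedIncl φ U) (twistedIncl φ V)
      (twistedInclLE φ (inf_le_left : U ⊓ V ≤ U)) (twistedInclLE φ (inf_le_right : U ⊓ V ≤ V))) := by
  have cU : IsClosed (U : Set X) :=
    (Set.ext hU : (U : Set X) = {x | 0 ≤ c x}) ▸ isClosed_le continuous_const c.continuous
  have cV : IsClosed (V : Set X) :=
    (Set.ext hV : (V : Set X) = {x | c x ≤ 0}) ▸ isClosed_le c.continuous continuous_const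
  have hA : ∀ x, x ∈ U ⊓ V ↔ c x = 0 := fun x =>
    ⟨fun h => le_antisymm ((hV x).1 h.2) ((hU x).1 h.1), fun h => ⟨(hU x).2 h.ge, (hV x).2 h.le⟩⟩
  have eA : (twistedIncl φ U).comp (twistedInclLE φ (inf_le_left : U ⊓ V ≤ U)) =
      twistedIncl φ (U ⊓ V) := ContinuousMap.ext (twistedIncl_twistedInclLE _)
  obtain ⟨c', hc'⟩ := exists_twisted_map (φ := φ) (X := X) (W := ℝ) ⟨fun q => c q.2.1, by fun_prop⟩
    fun g e x t => hc g x
  obtain ⟨p', hp'⟩ := exists_twisted_lift (φ := φ) (X := X) (T := I)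
    (W := BorelConstruction Γ (X × TwistedInterval φ))
    ⟨fun q => twistedMk Γ φ q.2.1 (p (q.1, q.2.2.1)) q.2.2.2, continuous_twistedMk.comp
      (by fun_prop : Continuous fun q : I × (MilnorE Γ × (X × I)) =>
        (q.2.1, p (q.1, q.2.2.1), q.2.2.2))⟩
    (fun s g e x t => by
      change twistedMk Γ φ (g • e) (p (s, g • x)) (flipI (φ g) t) = _
      rw [hp, twistedMk_smul]
      rfl)
  replace hc' : ∀ e x t, c' (twistedMk Γ φ e x t) = c x := hc'
  replace hp' : ∀ s e x t, p' (s, twistedMk Γ φ e x t) = twistedMk Γ φ e (p (s, x)) t := hp'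
  refine ⟨{ c := c', p := p', indU := (isClosedEmbedding_twistedIncl U cU).isEmbedding,
            indV := (isClosedEmbedding_twistedIncl V cV).isEmbedding,
            indA := eA ▸ (isClosedEmbedding_twistedIncl (U ⊓ V) (cU.inter cV)).isEmbedding,
            comm := fun y => (twistedIncl_twistedInclLE _ y).trans
              (twistedIncl_twistedInclLE _ y).symm,
            memU := twistedIncl_mem U, memV := twistedIncl_mem V, rangeU := ?_, rangeV := ?_,
            rangeA := ?_, p_zero := ?_, p_nonneg := ?_, p_nonpos := ?_, p_one := ?_,
            p_one_of_eq_zero := ?_, p_base := ?_, memA := ?_ }⟩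
  · intro y
    obtain ⟨e, x, t, rfl⟩ := twistedMk_surjective y
    rw [twistedMk_mem_range_twistedIncl, hc', hU]
  · intro y
    obtain ⟨e, x, t, rfl⟩ := twistedMk_surjective y
    rw [twistedMk_mem_range_twistedIncl, hc', hV]
  · intro y
    obtain ⟨e, x, t, rfl⟩ := twistedMk_surjective y
    rw [eA, twistedMk_mem_range_twistedIncl, hc', hA]
  · intro y
    obtain ⟨e, x, t, rfl⟩ := twistedMk_surjective y
    rw [hp', p_zero]
  · intro s y
    obtain ⟨e, x, t, rfl⟩ := twistedMk_surjective y
    rw [hp', hc', hc']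
    exact p_nonneg s x
  · intro s y
    obtain ⟨e, x, t, rfl⟩ := twistedMk_surjective y
    rw [hp', hc', hc']
    exact p_nonpos s x
  · intro y
    obtain ⟨e, x, t, rfl⟩ := twistedMk_surjective y
    rw [hp', hc', hc']
    exact p_one x
  · intro y
    obtain ⟨e, x, t, rfl⟩ := twistedMk_surjective y
    rw [hp', hc']
    exact fun h => by rw [p_one_of_eq_zero x h]
  · intro s y
    obtain ⟨e, x, t, rfl⟩ := twistedMk_surjective y
    rw [hp', twistedMk_mem, twistedMk_mem]
    exact id
  · intro y
    rw [twistedIncl_mem, twistedIncl_twistedInclLE]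

end BorelCover

/-! ### Normalization of nonzero complex numbers -/

/-- The point `w / |w|` of the circle, for a nonzero complex number `w`. -/
def direction (w : ℂ) : Circle :=
  if h : w = 0 then 1 else ⟨w / ‖w‖, mem_sphere_zero_iff_norm.2 (by simp [h])⟩

theorem coe_direction {w : ℂ} (h : w ≠ 0) : (direction w : ℂ) = w / ‖w‖ :=
  congrArg Subtype.val (dif_neg h)

theorem re_direction {w : ℂ} (h : w ≠ 0) : (direction w : ℂ).re = w.re / ‖w‖ := by
  rw [coe_direction h, Complex.div_ofReal_re]

theorem direction_coe (z : Circle) : direction z = z :=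
  Circle.ext (by rw [coe_direction z.coe_ne_zero, Circle.norm_coe, Complex.ofReal_one, div_one])

theorem continuous_direction {T : Type*} [TopologicalSpace T] {f : T → ℂ} (hf : Continuous f)
    (h : ∀ t, f t ≠ 0) : Continuous fun t => direction (f t) := by
  refine Topology.IsInducing.subtypeVal.continuous_iff.2 ?_
  have h' : Continuous fun t => f t / (‖f t‖ : ℂ) :=
    hf.div (by fun_prop) fun t => by simpa using h t
  exact h'.congr fun t => (coe_direction (h t)).symm

theorem direction_conj (w : ℂ) : direction (starRingEnd ℂ w) = (direction w)⁻¹ := by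
  by_cases h : w = 0
  · simp [h, direction]
  · refine Circle.ext ?_
    rw [coe_direction ((map_ne_zero _).2 h), Circle.coe_inv_eq_conj, coe_direction h]
    simp

theorem direction_zpow_units (w : ℂ) (u : ℤˣ) :
    direction ⟨w.re, ((u : ℤ) : ℝ) * w.im⟩ = direction w ^ (u : ℤ) := by
  rcases Int.units_eq_one_or u with rfl | rfl
  · simp
  · rw [Units.val_neg, Units.val_one, zpow_neg_one, ← direction_conj]
    congr 1
    simp [Complex.ext_iff]

theorem Circle.re_mul_self_add_im_mul_self (z : Circle) :
    (z : ℂ).re * (z : ℂ).re + (z : ℂ).im * (z : ℂ).im = 1 := by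
  rw [← Complex.normSq_apply, Circle.normSq_coe]

/-! ### The contractions of the arcs -/

/-- The straight line from `ε` to `z`, where `ε = ±1` is the centre of an arc. -/
def arcLine (ε s : ℝ) (z : Circle) : ℂ := ⟨ε * (1 - s) + s * (z : ℂ).re, s * (z : ℂ).im⟩

/-- On the half of the circle around `ε` the real part times `ε` is at least `1 - s`. The segment
could meet `0` only at `s = 1`, where it is at `z` itself. -/
theorem arcLine_ne_zero {ε : ℝ} (hε : ε * ε = 1) (s : I) {z : Circle} (hz : 0 ≤ ε * (z : ℂ).re) :
    arcLine ε s z ≠ 0 := by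
  intro h
  obtain ⟨h1, h2⟩ := Complex.ext_iff.1 h
  replace h1 : ε * (1 - s) + s * (z : ℂ).re = 0 := h1
  replace h2 : s * (z : ℂ).im = 0 := h2
  have h3 : (1 - (s : ℝ)) + s * (ε * (z : ℂ).re) = 0 := by linear_combination ε * h1 - (1 - s) * hε
  have h4 : (s : ℝ) = 1 := le_antisymm s.2.2 (by nlinarith [mul_nonneg s.2.1 hz])
  rw [h4] at h1 h2
  have := z.re_mul_self_add_im_mul_self
  rw [show (z : ℂ).re = 0 by linarith, show (z : ℂ).im = 0 by linarith] at this
  norm_num at this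

theorem arcLine_zpow_units (ε s : ℝ) (z : Circle) (u : ℤˣ) :
    arcLine ε s (z ^ (u : ℤ)) =
      ⟨(arcLine ε s z).re, ((u : ℤ) : ℝ) * (arcLine ε s z).im⟩ := by
  refine Complex.ext ?_ ?_
  · exact congrArg (fun r => ε * (1 - s) + s * r) (re_zpow_units z u)
  · exact (congrArg (s * ·) (im_zpow_units z u)).trans (mul_left_comm _ _ _)

theorem arcLine_re_nonneg {ε : ℝ} (hε : ε * ε = 1) (s : I) {z : Circle} (hz : 0 ≤ ε * (z : ℂ).re) :
    0 ≤ ε * (direction (arcLine ε s z) : ℂ).re := by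
  rw [re_direction (arcLine_ne_zero hε s hz), mul_div_assoc']
  refine div_nonneg ?_ (norm_nonneg _)
  change 0 ≤ ε * (ε * (1 - s) + s * (z : ℂ).re)
  nlinarith [mul_nonneg s.2.1 hz, s.2.2]

theorem arcLine_zero (ε : ℝ) (z : Circle) : arcLine ε 0 z = ε :=
  Complex.ext (by simp [arcLine]) (by simp [arcLine])

theorem arcLine_one (ε : ℝ) (z : Circle) : arcLine ε 1 z = z :=
  Complex.ext (by simp [arcLine]) (by simp [arcLine])

section Arcs

variable {G : Type u} [Group G] [TopologicalSpace G] [IsTopologicalGroup G] (F : OmegaSpectrum.{v})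
  (n : ℤ) (φ : G →ₜ* ℤˣ)

/-- An invariant arc of the circle with centre `ε = ±1` contracts equivariantly to its centre. -/
theorem fromPoint_arc_bijective {ε : ℝ} (hε : ε * ε = 1) (S : SubMulAction (G × ℤˣ) (ReflCircle G))
    (hS : ∀ z : ReflCircle G, z ∈ S ↔ 0 ≤ ε * (show Circle from z : ℂ).re) :
    Function.Bijective (F.fromPoint n (pointTwist φ) S) := by
  have hε0 : (ε : ℂ) ≠ 0 := fun h => by
    rw [Complex.ofReal_eq_zero] at h
    simp [h] at hε
  have h0 : 0 ≤ ε * (direction ε : ℂ).re := by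
    rw [re_direction hε0, mul_div_assoc', Complex.ofReal_re, hε]
    positivity
  have hH : Continuous fun q : I × S => direction (arcLine ε q.1 (show Circle from q.2.1)) := by
    refine continuous_direction ?_ fun q => arcLine_ne_zero hε q.1 ((hS _).1 q.2.2)
    have h : Continuous fun q : I × Circle => arcLine ε q.1 q.2 := by
      have : Continuous fun q : I × Circle => Complex.equivRealProdCLM.symm
          (ε * (1 - q.1) + q.1 * (q.2 : ℂ).re, q.1 * (q.2 : ℂ).im) := by fun_prop
      exact this
    exact h.comp (continuous_id.prodMap (continuous_subtype_val (p := fun z => z ∈ S)))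
  refine fromPoint_bijective_of_fixedPoint F n (X := S) ⟨direction ε, (hS _).2 h0⟩ (fun g => ?_)
    ⟨fun q => ⟨direction (arcLine ε q.1 (show Circle from q.2.1)),
      (hS _).2 (arcLine_re_nonneg hε q.1 ((hS _).1 q.2.2))⟩, hH.subtype_mk _⟩
    (fun z => Subtype.ext ?_) (fun z => Subtype.ext ?_) (fun s g z => Subtype.ext ?_)
  · refine Subtype.ext ((direction_zpow_units ε g.2).symm.trans (congrArg direction ?_))
    exact Complex.ext rfl (by simp)
  · exact congrArg direction (arcLine_zero ε _)
  · exact (congrArg direction (arcLine_one ε _)).trans (direction_coe _)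
  · exact (congrArg direction (arcLine_zpow_units ε s _ g.2)).trans (direction_zpow_units _ _)

theorem mem_arcU (z : ReflCircle G) : z ∈ arcU G ↔ 0 ≤ (show Circle from z : ℂ).re := Iff.rfl

theorem mem_arcV (z : ReflCircle G) : z ∈ arcV G ↔ (show Circle from z : ℂ).re ≤ 0 := Iff.rfl

theorem fromPoint_arcU_bijective :
    Function.Bijective (F.fromPoint n (pointTwist φ) (arcU G)) :=
  fromPoint_arc_bijective F n φ (ε := 1) (one_mul 1) _ fun z => by rw [mem_arcU, one_mul]

theorem fromPoint_arcV_bijective :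
    Function.Bijective (F.fromPoint n (pointTwist φ) (arcV G)) :=
  fromPoint_arc_bijective F n φ (ε := -1) (by norm_num) _ fun z => by
    rw [mem_arcV, neg_one_mul, neg_nonneg]

end Arcs

/-! ### The bicollar of `{i, -i}` in the circle -/

/-- The odd function that vanishes on `[-a, a]` and is a translation on either side. -/
def shrink (a r : ℝ) : ℝ := max (r - a) 0 + min (r + a) 0

theorem shrink_nonneg {a r : ℝ} (ha : 0 ≤ a) (hr : 0 ≤ r) : 0 ≤ shrink a r := by
  rw [shrink, min_eq_right (by linarith), add_zero]
  exact le_max_right _ _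

theorem shrink_nonpos {a r : ℝ} (ha : 0 ≤ a) (hr : r ≤ 0) : shrink a r ≤ 0 := by
  rw [shrink, max_eq_right (by linarith), zero_add]
  exact min_le_right _ _

theorem shrink_eq_zero {a r : ℝ} (h : |r| ≤ a) : shrink a r = 0 := by
  obtain ⟨h1, h2⟩ := abs_le.1 h
  rw [shrink, max_eq_right (by linarith), min_eq_right (by linarith), add_zero]

theorem shrink_zero (r : ℝ) : shrink 0 r = r := by
  rw [shrink, sub_zero, add_zero, max_add_min, add_zero]

theorem abs_le_of_shrink_eq_zero {a r : ℝ} (ha : 0 ≤ a) (h : shrink a r = 0) : |r| ≤ a := by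
  refine abs_le.2 ⟨?_, ?_⟩ <;> by_contra! hr <;> unfold shrink at h
  · rw [max_eq_right (by linarith), min_eq_left (by linarith)] at h
    linarith
  · rw [max_eq_left (by linarith), min_eq_right (by linarith)] at h
    linarith

/-- The push of the circle towards `{i, -i}`, before normalization. -/
def circlePush (s : ℝ) (z : Circle) : ℂ := ⟨shrink (s / 2) (z : ℂ).re, (z : ℂ).im⟩

/-- A zero would need vanishing imaginary part, hence `|re z| = 1`, but `shrink (s / 2)` only kills
real parts of size at most `1/2`. -/
theorem circlePush_ne_zero (s : I) (z : Circle) : circlePush s z ≠ 0 := by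
  intro h
  obtain ⟨h1, h2⟩ := Complex.ext_iff.1 h
  replace h1 := abs_le_of_shrink_eq_zero (by linarith [s.2.1]) (h1 : shrink (s / 2) (z : ℂ).re = 0)
  replace h2 : (z : ℂ).im = 0 := h2
  have h3 := z.re_mul_self_add_im_mul_self
  rw [h2, mul_zero, add_zero, ← abs_mul_abs_self] at h3
  nlinarith [s.2.2, abs_nonneg (z : ℂ).re]

theorem circlePush_zpow_units (s : ℝ) (z : Circle) (u : ℤˣ) :
    circlePush s (z ^ (u : ℤ)) = ⟨(circlePush s z).re, ((u : ℤ) : ℝ) * (circlePush s z).im⟩ :=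
  Complex.ext (congrArg (shrink (s / 2)) (re_zpow_units z u)) (im_zpow_units z u)

theorem continuous_circlePush : Continuous fun q : I × Circle => circlePush q.1 q.2 := by
  have : Continuous fun q : I × Circle => Complex.equivRealProdCLM.symm
      (shrink (q.1 / 2) (q.2 : ℂ).re, (q.2 : ℂ).im) := by
    unfold shrink
    fun_prop
  exact this

theorem re_direction_circlePush (s : I) (z : Circle) :
    (direction (circlePush s z) : ℂ).re = shrink (s / 2) (z : ℂ).re / ‖circlePush s z‖ :=
  re_direction (circlePush_ne_zero s z)

section Cover

variable {G : Type u} [Group G] [TopologicalSpace G] [IsTopologicalGroup G] (F : OmegaSpectrum.{v})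
  (φ : G →ₜ* ℤˣ)

/-- With `c = 2 re z` the bicollar `|c| ≤ 1` is the set `|re z| ≤ 1/2`, which the push by `shrink (1
/ 2)` collapses onto the imaginary axis. The push is odd in the real part and leaves the imaginary
part alone, so after normalization it preserves both arcs and commutes with conjugation. -/
theorem nonempty_bicollaredCover_circle :
    Nonempty (BicollaredCover (twistedEnds (ReflCircle G) (pointTwist φ))
      (twistedEnds (arcU G) (pointTwist φ)) (twistedEnds (arcV G) (pointTwist φ))
      (twistedEnds ↥(arcU G ⊓ arcV G) (pointTwist φ))
      (twistedIncl (pointTwist φ) (arcU G)) (twistedIncl (pointTwist φ) (arcV G))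
      (twistedInclLE (pointTwist φ) (inf_le_left : arcU G ⊓ arcV G ≤ arcU G))
      (twistedInclLE (pointTwist φ) (inf_le_right : arcU G ⊓ arcV G ≤ arcV G))) := by
  have hc : Continuous fun z : Circle => 2 * (z : ℂ).re := by fun_prop
  refine nonempty_bicollaredCover_twisted (arcU G) (arcV G)
    (show C(ReflCircle G, ℝ) from (⟨_, hc⟩ : C(Circle, ℝ)))
    (fun g z => congrArg (2 * ·) (re_zpow_units _ g.2))
    (fun z => (mul_nonneg_iff_of_pos_left (two_pos (α := ℝ))).symm)
    (fun z => show (show Circle from z : ℂ).re ≤ 0 ↔ 2 * (show Circle from z : ℂ).re ≤ 0 from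
      ⟨fun h => by linarith, fun h => by linarith⟩)
    (show C(I × ReflCircle G, ReflCircle G) from
      (⟨fun q => direction (circlePush q.1 q.2), continuous_direction continuous_circlePush
        fun q => circlePush_ne_zero q.1 q.2⟩ : C(I × Circle, Circle)))
    (fun s g z => ?_) (fun z => ?_) (fun s z h => ?_) (fun s z h => ?_) (fun z h => ?_)
    (fun z h => ?_)
  · exact (congrArg direction (circlePush_zpow_units s _ g.2)).trans (direction_zpow_units _ _)
  · refine (congrArg direction ?_).trans (direction_coe _)
    refine Complex.ext ?_ rfl
    change shrink (((0 : I) : ℝ) / 2) _ = _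
    rw [Set.Icc.coe_zero, zero_div, shrink_zero]
  · replace h : 0 ≤ 2 * (show Circle from z : ℂ).re := h
    change 0 ≤ 2 * (direction (circlePush s (show Circle from z)) : ℂ).re
    rw [re_direction_circlePush]
    have := div_nonneg (shrink_nonneg (a := s / 2) (by linarith [s.2.1])
      (by linarith : 0 ≤ (show Circle from z : ℂ).re)) (norm_nonneg (circlePush s z))
    linarith
  · replace h : 2 * (show Circle from z : ℂ).re ≤ 0 := h
    change 2 * (direction (circlePush s (show Circle from z)) : ℂ).re ≤ 0
    rw [re_direction_circlePush]
    have := div_nonpos_of_nonpos_of_nonneg (shrink_nonpos (a := s / 2) (by linarith [s.2.1])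
      (by linarith : (show Circle from z : ℂ).re ≤ 0)) (norm_nonneg (circlePush s z))
    linarith
  · replace h : |2 * (show Circle from z : ℂ).re| ≤ 1 := h
    change 2 * (direction (circlePush (1 : I) (show Circle from z)) : ℂ).re = 0
    rw [abs_mul, abs_two] at h
    rw [re_direction_circlePush, shrink_eq_zero, zero_div, mul_zero]
    rw [Set.Icc.coe_one]
    linarith
  · replace h : 2 * (show Circle from z : ℂ).re = 0 := h
    refine (congrArg direction ?_).trans (direction_coe _)
    refine Complex.ext ?_ rfl
    have h' : (show Circle from z : ℂ).re = 0 := by linarith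
    refine (shrink_eq_zero ?_).trans h'.symm
    rw [h', abs_zero, Set.Icc.coe_one]
    norm_num

end Cover

/-! ### Lifting the arcs to the line -/

/-- The angle in `[-π/2, π/2]`, divided by `2π`, of the point with imaginary part `im z` in the
right half of the circle. -/
def arcAngle (z : Circle) : ℝ := Real.arcsin (z : ℂ).im / (2 * Real.pi)

theorem continuous_arcAngle : Continuous arcAngle :=
  (Real.continuous_arcsin.comp (by fun_prop)).div_const _

theorem arcAngle_zpow_units (z : Circle) (u : ℤˣ) :
    arcAngle (z ^ (u : ℤ)) = ((u : ℤ) : ℝ) * arcAngle z := by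
  unfold arcAngle
  rw [im_zpow_units]
  rcases Int.units_eq_one_or u with rfl | rfl
  · simp
  · simp [neg_div]

theorem two_pi_mul_arcAngle (z : Circle) :
    2 * Real.pi * arcAngle z = Real.arcsin (z : ℂ).im :=
  mul_div_cancel₀ _ Real.two_pi_pos.ne'

theorem Circle.sin_arcsin_im (z : Circle) : Real.sin (Real.arcsin (z : ℂ).im) = (z : ℂ).im := by
  have h := z.re_mul_self_add_im_mul_self
  exact Real.sin_arcsin (by nlinarith [mul_self_nonneg (z : ℂ).re])
    (by nlinarith [mul_self_nonneg (z : ℂ).re])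

theorem Circle.cos_arcsin_im (z : Circle) : Real.cos (Real.arcsin (z : ℂ).im) = |(z : ℂ).re| := by
  rw [Real.cos_arcsin, ← Real.sqrt_mul_self_eq_abs]
  congr 1
  linarith [z.re_mul_self_add_im_mul_self]

theorem Circle.exp_eq_of_cos_sin {x : ℝ} {z : Circle} (h1 : Real.cos x = (z : ℂ).re)
    (h2 : Real.sin x = (z : ℂ).im) : Circle.exp x = z := by
  refine Circle.ext (Complex.ext ?_ ?_)
  · rw [Circle.coe_exp, Complex.exp_ofReal_mul_I_re, h1]
  · rw [Circle.coe_exp, Complex.exp_ofReal_mul_I_im, h2]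

section Lifts

variable {G : Type u} [Group G] [TopologicalSpace G]

variable (G) in
/-- The lift of the arc `U` to the line around `0`. -/
def liftU : C(arcU G, SymLine G) :=
  ⟨fun z => arcAngle (show Circle from z.1),
    continuous_arcAngle.comp (continuous_subtype_val (p := fun z : ReflCircle G => z ∈ arcU G))⟩

variable (G) in
/-- The lift of the arc `V` to the line around `1/2`. -/
def liftV : C(arcV G, SymLine G) :=
  ⟨fun z => (1 / 2 - arcAngle (show Circle from z.1) : ℝ),
    (continuous_const.sub continuous_arcAngle : Continuous fun z => 1 / 2 - arcAngle z).comp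
      (continuous_subtype_val (p := fun z : ReflCircle G => z ∈ arcV G))⟩

theorem liftU_smul (γ : G × ℤˣ) (z : arcU G) :
    liftU G (γ • z) = inclReflection G 0 γ • liftU G z := by
  have h : ∀ (z : Circle) (u : ℤˣ),
      arcAngle (z ^ (u : ℤ)) = ((if u = 1 then 0 else 0 : ℤ) : ℝ) + ((u : ℤ) : ℝ) * arcAngle z :=
    fun z u => by rw [arcAngle_zpow_units, ite_self, Int.cast_zero, zero_add]
  exact h _ _

/-- Conjugation negates `arcAngle`, which on `1/2 - arcAngle` is the reflection `x ↦ 1 - x`. This is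
why the second arc sees the reflection about `1/2`. -/
theorem liftV_smul (γ : G × ℤˣ) (z : arcV G) :
    liftV G (γ • z) = inclReflection G 1 γ • liftV G z := by
  have h : ∀ (z : Circle) (u : ℤˣ), 1 / 2 - arcAngle (z ^ (u : ℤ)) =
      ((if u = 1 then 0 else 1 : ℤ) : ℝ) + ((u : ℤ) : ℝ) * (1 / 2 - arcAngle z) := fun z u => by
    rw [arcAngle_zpow_units]
    rcases Int.units_eq_one_or u with rfl | rfl
    · simp
    · rw [if_neg (by decide)]
      push_cast
      ring
  exact h _ _

theorem lineToCircle_liftU (z : arcU G) : lineToCircle G (liftU G z) = z.1 := by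
  have h : ∀ z : Circle, 0 ≤ (z : ℂ).re → Circle.exp (2 * Real.pi * arcAngle z) = z := by
    intro z hz
    rw [two_pi_mul_arcAngle]
    exact Circle.exp_eq_of_cos_sin (z.cos_arcsin_im.trans (abs_of_nonneg hz)) z.sin_arcsin_im
  exact h _ z.2

theorem lineToCircle_liftV (z : arcV G) : lineToCircle G (liftV G z) = z.1 := by
  have h : ∀ z : Circle, (z : ℂ).re ≤ 0 →
      Circle.exp (2 * Real.pi * (1 / 2 - arcAngle z)) = z := by
    intro z hz
    rw [mul_sub, two_pi_mul_arcAngle, mul_one_div, mul_div_cancel_left₀ _ (two_ne_zero' ℝ)]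
    refine Circle.exp_eq_of_cos_sin ?_ ((Real.sin_pi_sub _).trans z.sin_arcsin_im)
    rw [Real.cos_pi_sub, z.cos_arcsin_im, abs_of_nonpos hz, neg_neg]
  exact h _ z.2

variable (F : OmegaSpectrum.{v}) (n : ℤ) (φ : G →ₜ* ℤˣ)

/-- If classes on the circle and at the point agree on the line, then so do their restrictions to
an arc that lifts to a neighbourhood of the fixed point of `x ↦ k - x`. -/
theorem spacePullback_eq_fromPoint_forgetTranslation {S : SubMulAction (G × ℤˣ) (ReflCircle G)}
    (k : ℤ) (l : C(S, SymLine G)) (hl : ∀ (γ : G × ℤˣ) z, l (γ • z) = inclReflection G k γ • l z)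
    (hl' : ∀ z, lineToCircle G (l z) = z.1)
    {x : F.twistedCoh n (pointTwist φ) (ReflCircle G) ∅} {y : SPT F n (lineTwist φ)}
    (h : circleToLine F n φ x = F.fromPoint n (lineTwist φ) (SymLine G) y) :
    F.spacePullback n (pointTwist φ) (subIncl S) (fun _ _ => rfl) x =
      F.fromPoint n (pointTwist φ) S (forgetTranslation F n φ k y) := by
  -- The inclusion of `S` into the circle factors through the line via `l`, with `inclReflection G
  -- k` a section of the projection of groups. On the line the class comes from the point, where
  -- only the change of group remains.
  calc _ = F.twistedPullback n (φ₁ := pointTwist φ) (φ₂ := lineTwist φ) (inclReflection G k)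
        (fun _ => rfl) l hl (circleToLine F n φ x) :=
        (twistedPullback_congr F n (fun _ => rfl) (fun z => (hl' z).symm) x).trans
          (twistedPullback_twistedPullback F n _ _ _ _ _ _ _ _ x).symm
    _ = _ := by
        rw [h]
        exact (twistedPullback_twistedPullback F n _ _ _ _ _ _ _ _ y).trans
          ((twistedPullback_congr F n (fun _ => rfl) (fun _ => rfl) y).trans
            (twistedPullback_twistedPullback F n (φ₁ := pointTwist φ) (φ₂ := pointTwist φ)
              (φ₃ := lineTwist φ) (.id (G × ℤˣ)) (fun _ => rfl) (.const S PUnit.unit)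
              (fun _ _ => rfl) (inclReflection G k) (fun _ => rfl) (.id PUnit)
              (fun _ _ => rfl) y).symm)

/-- The maps of spaces compose to the identity of the point, so by functoriality only the
restriction of the group is left. -/
theorem twoPointsToG_spacePullback_fromPoint {S : SubMulAction (G × ℤˣ) (ReflCircle G)}
    (hS : arcU G ⊓ arcV G ≤ S) (b : SPT F n (pointTwist φ)) :
    twoPointsToG F n φ (F.spacePullback n (pointTwist φ) (subInclLE hS) (fun _ _ => rfl)
      (F.fromPoint n (pointTwist φ) S b)) = forgetReflection F n φ b :=
  (congrArg (twoPointsToG F n φ)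
    (twistedPullback_twistedPullback F n _ _ _ _ _ _ _ _ b)).trans
    ((twistedPullback_twistedPullback F n _ _ _ _ _ _ _ _ b).trans
      (twistedPullback_congr F n (fun _ => rfl) (fun _ => rfl) b))

end Lifts

end

/-! ### The long exact sequence of SPT phases -/

theorem mainTheorem4 (F : OmegaSpectrum.{v}) (G : Type u) [Group G] [TopologicalSpace G]
    [IsTopologicalGroup G] (φ : G →ₜ* ℤˣ) :
    -- identification of the terms
    (∀ n : ℤ,
      Function.Bijective (F.fromPoint n (pointTwist φ) (arcU G)) ∧
      Function.Bijective (F.fromPoint n (pointTwist φ) (arcV G)) ∧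
      Function.Bijective (twoPointsToG F n φ) ∧
      Function.Bijective (F.fromPoint n (lineTwist φ) (SymLine G)) ∧
      Function.Bijective (circleToLine F n φ)) ∧
    -- the Mayer-Vietoris sequence of the circle
    ∃ δ : ∀ n : ℤ, F.twistedCoh n (pointTwist φ) ↥(arcU G ⊓ arcV G) ∅ →+
        F.twistedCoh (n + 1) (pointTwist φ) (ReflCircle G) ∅,
      (∀ n : ℤ, F.IsMVConnecting n (pointTwist φ) (arcU G) (arcV G) (δ n)) ∧
      (∀ n : ℤ,
        Function.Exact (F.mvRestrict n (pointTwist φ) (arcU G) (arcV G))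
          (F.mvDifference n (pointTwist φ) (arcU G) (arcV G)) ∧
        Function.Exact (F.mvDifference n (pointTwist φ) (arcU G) (arcV G)) (δ n) ∧
        Function.Exact (δ n) (F.mvRestrict (n + 1) (pointTwist φ) (arcU G) (arcV G))) ∧
    -- the long exact sequence of SPT phases
    ∃ α : ∀ d : ℤ, SPT F d φ →+ SPT F (d + 1) (lineTwist φ),
      (∀ d : ℤ,
        Function.Exact (betaMap F d φ) (gammaMap F d φ) ∧
        Function.Exact (gammaMap F d φ) (α d) ∧
        Function.Exact (α d) (betaMap F (d + 1) φ)) ∧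
    -- the two sequences correspond to each other under the identification of the terms
    ∃ θ : ∀ d : ℤ, SPT F d (lineTwist φ) ≃+ F.twistedCoh d (pointTwist φ) (ReflCircle G) ∅,
      (∀ (d : ℤ) (y : SPT F d (lineTwist φ)),
        circleToLine F d φ (θ d y) = F.fromPoint d (lineTwist φ) (SymLine G) y) ∧
      (∀ (d : ℤ) (x : F.twistedCoh d (pointTwist φ) ↥(arcU G ⊓ arcV G) ∅),
        θ (d + 1) (α d (twoPointsToG F d φ x)) = δ d x) ∧
      (∀ (d : ℤ) (y : SPT F d (lineTwist φ)),
        F.mvRestrict d (pointTwist φ) (arcU G) (arcV G) (θ d y) =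
          (F.fromPoint d (pointTwist φ) (arcU G) (betaMap F d φ y).1,
            F.fromPoint d (pointTwist φ) (arcV G) (betaMap F d φ y).2)) ∧
      (∀ (d : ℤ) (b : SPT F d (pointTwist φ) × SPT F d (pointTwist φ)),
        twoPointsToG F d φ (F.mvDifference d (pointTwist φ) (arcU G) (arcV G)
          (F.fromPoint d (pointTwist φ) (arcU G) b.1,
            F.fromPoint d (pointTwist φ) (arcV G) b.2)) = gammaMap F d φ b) := by
  have bU := fun n => fromPoint_arcU_bijective F n φ
  have bV := fun n => fromPoint_arcV_bijective F n φ
  have bT := fun n => twoPointsToG_bijective F n φ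
  have bL := fun n => fromPoint_symLine_bijective F n φ
  have bC := fun n => circleToLine_bijective F n φ
  obtain ⟨D⟩ := nonempty_bicollaredCover_circle φ
  -- Twisted degree `n` is ordinary degree `n + 1` of the Borel construction; hence the shift.
  let δ : ∀ n : ℤ, F.twistedCoh n (pointTwist φ) ↥(arcU G ⊓ arcV G) ∅ →+
    F.twistedCoh (n + 1) (pointTwist φ) (ReflCircle G) ∅ := fun n => D.connecting F (n + 1)
  have e₁ : ∀ n, Function.Exact (F.mvRestrict n (pointTwist φ) (arcU G) (arcV G))
    (F.mvDifference n (pointTwist φ) (arcU G) (arcV G)) :=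
    fun n => D.exact_restrict_difference F (n + 1)
  have e₂ : ∀ n, Function.Exact (F.mvDifference n (pointTwist φ) (arcU G) (arcV G)) (δ n) :=
    fun n => D.exact_difference_connecting F (n + 1)
  have e₃ : ∀ n, Function.Exact (δ n) (F.mvRestrict (n + 1) (pointTwist φ) (arcU G) (arcV G)) :=
    fun n => D.exact_connecting_restrict F (n + 1)
  let T := fun n => AddEquiv.ofBijective (twoPointsToG F n φ) (bT n)
  let C := fun n => AddEquiv.ofBijective (circleToLine F n φ) (bC n)
  let P := fun n => (AddEquiv.ofBijective _ (bU n)).prodCongr (AddEquiv.ofBijective _ (bV n))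
  let θ : ∀ d : ℤ, SPT F d (lineTwist φ) ≃+ F.twistedCoh d (pointTwist φ) (ReflCircle G) ∅ :=
    fun d => (AddEquiv.ofBijective _ (bL d)).trans (C d).symm
  -- `α` is defined by transporting the connecting map, while `betaMap` and `gammaMap` are defined
  -- independently and have to be matched.
  let α : ∀ d : ℤ, SPT F d φ →+ SPT F (d + 1) (lineTwist φ) := fun d =>
    (θ (d + 1)).symm.toAddMonoidHom.comp ((δ d).comp (T d).symm.toAddMonoidHom)
  have hθ : ∀ d y, circleToLine F d φ (θ d y) = F.fromPoint d (lineTwist φ) (SymLine G) y :=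
    fun d y => (C d).apply_symm_apply _
  have hα : ∀ d x, θ (d + 1) (α d (twoPointsToG F d φ x)) = δ d x := fun d x =>
    ((θ (d + 1)).apply_symm_apply _).trans (congrArg (δ d) ((T d).symm_apply_apply x))
  have hβ : ∀ d y, F.mvRestrict d (pointTwist φ) (arcU G) (arcV G) (θ d y) =
      (F.fromPoint d (pointTwist φ) (arcU G) (betaMap F d φ y).1,
        F.fromPoint d (pointTwist φ) (arcV G) (betaMap F d φ y).2) := fun d y =>
    Prod.ext
      (spacePullback_eq_fromPoint_forgetTranslation F d φ 0 (liftU G) liftU_smul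
        lineToCircle_liftU (hθ d y))
      (spacePullback_eq_fromPoint_forgetTranslation F d φ 1 (liftV G) liftV_smul
        lineToCircle_liftV (hθ d y))
  have hγ : ∀ d b, twoPointsToG F d φ (F.mvDifference d (pointTwist φ) (arcU G) (arcV G)
      (F.fromPoint d (pointTwist φ) (arcU G) b.1, F.fromPoint d (pointTwist φ) (arcV G) b.2)) =
        gammaMap F d φ b := fun d b =>
    (map_sub (twoPointsToG F d φ) _ _).trans (congrArg₂ _
      (twoPointsToG_spacePullback_fromPoint F d φ inf_le_left b.1)
      (twoPointsToG_spacePullback_fromPoint F d φ inf_le_right b.2))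
  refine ⟨fun n => ⟨bU n, bV n, bT n, bL n, bC n⟩, δ,
    fun n => D.isMayerVietorisConnecting_connecting F (n + 1), fun n => ⟨e₁ n, e₂ n, e₃ n⟩, α,
    fun d => ?_, θ, hθ, hα, hβ, hγ⟩
  -- The three squares of the ladder of isomorphisms from the SPT sequence to the Mayer–Vietoris
  -- sequence; exactness is carried back along it.
  have sβ : ∀ d, (F.mvRestrict d (pointTwist φ) (arcU G) (arcV G)).comp (θ d).toAddMonoidHom =
      (P d).toAddMonoidHom.comp (betaMap F d φ) := fun d => AddMonoidHom.ext (hβ d)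
  have sγ : (F.mvDifference d (pointTwist φ) (arcU G) (arcV G)).comp (P d).toAddMonoidHom =
      (T d).symm.toAddMonoidHom.comp (gammaMap F d φ) := AddMonoidHom.ext fun b =>
    (T d).injective ((hγ d b).trans ((T d).apply_symm_apply _).symm)
  have sα : (δ d).comp (T d).symm.toAddMonoidHom =
      (θ (d + 1)).toAddMonoidHom.comp (α d) := AddMonoidHom.ext fun x =>
    ((θ (d + 1)).apply_symm_apply _).symm
  exact ⟨(Function.Exact.iff_of_ladder_addEquiv (θ d) (P d) (T d).symm (sβ d) sγ).1 (e₁ d),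
    (Function.Exact.iff_of_ladder_addEquiv (P d) (T d).symm (θ (d + 1)) sγ sα).1 (e₂ d),
    (Function.Exact.iff_of_ladder_addEquiv (T d).symm (θ (d + 1)) (P (d + 1)) sα (sβ (d + 1))).1
      (e₃ d)⟩
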